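/- For $N\ge 2$ let $\sigma^N$ be the uniform probability measure on $\mathbb S^{N-1}(\sqrt N)\subset\mathbb R^N$. For $i<j$ and $\theta\in[0,2\pi]$ let $R_{i,j,\theta}$ be the rotation $v_i(\theta)=v_i\cos\theta+v_j\sin\theta$, $v_j(\theta)=-v_i\sin\theta+v_j\cos\theta$, which leaves the other coordinates fixed. For a probability density $F$ with respect to $\sigma^N$ and $\gamma\in[0,1]$ put $$H_N(F)=\int F\log F\,d\sigma^N\in[0,\infty],$$ $$D_{N,\gamma}(F)=\frac1{4\pi}\frac{N}{\binom N2}\sum_{i<j}\int_0^{2\pi}\!\!\int (1+v_i^2+v_j^2)^\gamma\,\psi(F,F\circ R_{i,j,\theta})\,d\sigma^N d\theta\in[0,\infty],$$ where $\psi(x,y)=(x-y)\log(x/y)$; here $\psi(0,0)=0$ and $\psi(x,0)=\psi(0,x)=\infty$ for $x>0$. Let $(F_N)_{N\ge2}$ be a family of permutation symmetric probability densities on $\mathbb S^{N-1}(\sqrt N)$ with the log-power property of order $\beta>0$ with constant $C_F>0$, that is, for every $N\ge 2$, $$\frac1{2\pi}\int_0^{2\pi}\!\!\int\psi_\beta(F_N,F_N\circ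 R_{1,2,\theta})\,d\sigma^N d\theta\le C_F^{1+\beta},\qquad \psi_\beta(x,y)=|x-y|\,\Bigl|\log\frac xy\Bigr|^{1+\beta},$$ with the same conventions when $x$ or $y$ vanishes. Let $\gamma\in[0,1]$. (i) Suppose that $k>1+\frac1\beta$ and that $M_{2k}=\sup_{N}\int_{\mathbb R}|v|^{2k}\,d\Pi_1(F_N)(v)<\infty$, where $\Pi_1(F_N)$ is the law of $v_1$ under $F_N\,d\sigma^N$. Then for every $N\ge2$ $$\frac{D_{N,\gamma}(F_N)}N\ge\mathcal C_\epsilon\Bigl(\frac{H_N(F_N)}N\Bigr)^{1+\epsilon},\qquad \epsilon=\frac{(1-\gamma)(1+\beta)}{k\beta-(1+\beta)},$$ where for $\gamma<1$ $$\mathcal C_\epsilon=\frac{k\beta-(1+\beta)}{(1+\beta)(1-\gamma)}\left(\frac{(1+\beta)(1-\gamma)}{k\beta-\gamma(1+\beta)}\right)^{\frac{k\beta-\gamma(1+\beta)}{k\beta-(1+\beta)}}\frac{2^{\frac{1-\gamma}{k\beta-(1+\beta)}}}{3^{\frac{2k\beta-k\beta\gamma-\gamma(1+\beta)}{k\beta-(1+\beta)}}}\cdot\frac1{C_F^{\frac{(1+\beta)(1-\gamma)}{k\beta-(1+\beta)}}(1+2M_{2k})^{\frac{\beta(1-\gamma)}{k\beta-(1+\beta)}}},$$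 and $\mathcal C_\epsilon=\frac13$ (the limit of this expression) for $\gamma=1$. (ii) Suppose that for some $a,\mu>0$ one has $M_{\exp}=\sup_N\int e^{a|v_1|^\mu}F_N\,d\sigma^N<\infty$. Then for every $N\ge2$ with $H_N(F_N)<\infty$ $$\frac{D_{N,\gamma}(F_N)}N\ge\frac16\left|\frac{2^{1+\mu}}a\log\left(\frac{4\,C_F^{\frac{1+\beta}\beta}\Bigl(\frac{2^{2+\mu}(1+\beta)}{a\beta\mu e}\Bigr)^{\frac{2(1+\beta)}{\beta\mu}}e^{\frac a{2^{\mu/2}}}M_{\exp}}{\Bigl(\frac{H_N(F_N)}{6N}\Bigr)^{\frac{1+\beta}\beta}}\right)\right|^{-\frac{2(1-\gamma)}\mu}\frac{H_N(F_N)}N$$ (the right-hand side being $0$ if $H_N(F_N)=0$), and $D_{N,\gamma}(F_N)=\infty$ whenever $H_N(F_N)=\infty$. -/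

import Mathlib

open MeasureTheory
open scoped ENNReal

noncomputable section

/-- The velocity space `ℝ^N` of `N` particles, with its Euclidean norm. -/
abbrev KacSpace (N : ℕ) : Type := EuclideanSpace ℝ (Fin N)

/-- The uniform probability measure `σ^N` on the Kac sphere `S^{N-1}(√N)`, regarded as a measure on
the ambient space `ℝ^N`: the normalized surface measure of the unit sphere, scaled by `√N`. -/
def kacSigma (N : ℕ) : Measure (KacSpace N) :=
  ((volume : Measure (KacSpace N)).toSphere Set.univ)⁻¹ •
    ((volume : Measure (KacSpace N)).toSphere).map
      (fun x : Metric.sphere (0 : KacSpace N) 1 => Real.sqrt (N : ℝ) • (x : KacSpace N))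

/-- The rotation `R_{i,j,θ}` by the angle `θ` in the plane of the coordinates `i`, `j`. -/
def kacRotation {N : ℕ} (i j : Fin N) (θ : ℝ) (v : KacSpace N) : KacSpace N :=
  WithLp.toLp 2 (fun k =>
    if k = i then v i * Real.cos θ + v j * Real.sin θ
    else if k = j then -(v i) * Real.sin θ + v j * Real.cos θ
    else v k)

/-- Probability densities on the Kac sphere with respect to `σ^N`. A density is represented by a
function on the ambient space; only its values on the sphere matter, up to null sets. -/
structure IsKacDensity {N : ℕ} (F : KacSpace N → ℝ) : Prop where
  aemeasurable : AEMeasurable F (kacSigma N)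
  nonneg : ∀ᵐ v ∂(kacSigma N), 0 ≤ F v
  mass_one : ∫⁻ v, ENNReal.ofReal (F v) ∂(kacSigma N) = 1

/-- Symmetry of a density under permutations of the particles. -/
def IsKacSymmetric {N : ℕ} (F : KacSpace N → ℝ) : Prop :=
  ∀ π : Equiv.Perm (Fin N),
    ∀ᵐ v ∂(kacSigma N), F (WithLp.toLp 2 (fun k => v (π k))) = F v

/-- `ψ(x,y) = (x - y) log (x / y)` for `x, y ≥ 0`, with the usual values `ψ(0,0) = 0` and
`ψ(x,0) = ψ(0,x) = +∞` for `x > 0`. -/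
def kacPsi (x y : ℝ) : ℝ≥0∞ :=
  if x = y then 0
  else if x = 0 ∨ y = 0 then ⊤
  else ENNReal.ofReal ((x - y) * Real.log (x / y))

/-- `ψ_β(x,y) = |x - y| |log (x / y)|^{1+β}` for `x, y ≥ 0`, with the usual values
`ψ_β(0,0) = 0` and `ψ_β(x,0) = ψ_β(0,x) = +∞` for `x > 0`. -/
def kacPsiPow (β x y : ℝ) : ℝ≥0∞ :=
  if x = y then 0
  else if x = 0 ∨ y = 0 then ⊤
  else ENNReal.ofReal (|x - y| * |Real.log (x / y)| ^ (1 + β))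

open Classical in
/-- The relative entropy `H_N(F) = ∫ F log F dσ^N ∈ [0,∞]` of a probability density `F`. As
`x log x ≥ -1/e`, the integral is `+∞` when `F log F` is not integrable; as `σ^N` and `F dσ^N` are
probability measures, it is nonnegative by Jensen's inequality. -/
def kacEntropy {N : ℕ} (F : KacSpace N → ℝ) : ℝ≥0∞ :=
  if Integrable (fun v => F v * Real.log (F v)) (kacSigma N) then
    ENNReal.ofReal (∫ v, F v * Real.log (F v) ∂(kacSigma N))
  else ⊤

/-- The entropy production
`D_{N,γ}(F) = (1/4π) N / (N choose 2) ∑_{i<j} ∫_0^{2π} ∫ (1+v_i²+v_j²)^γ ψ(F, F∘R_{i,j,θ}) dσ^N dθ`,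
an element of `[0,∞]`. -/
def kacProduction {N : ℕ} (γ : ℝ) (F : KacSpace N → ℝ) : ℝ≥0∞ :=
  ENNReal.ofReal (1 / (4 * Real.pi) * ((N : ℝ) / (N.choose 2 : ℝ))) *
    ∑ p : Fin N × Fin N with p.1 < p.2,
      ∫⁻ θ in Set.Ioc 0 (2 * Real.pi), ∫⁻ v,
        ENNReal.ofReal ((1 + ((v p.1) ^ 2 + (v p.2) ^ 2)) ^ γ) *
          kacPsi (F v) (F (kacRotation p.1 p.2 θ v)) ∂(kacSigma N)

/-- The family `(F_N)_{N ≥ 2}` has the log-power property of order `β` with constant `C`. -/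
def HasLogPower (β C : ℝ) (F : (N : ℕ) → KacSpace N → ℝ) : Prop :=
  ∀ (N : ℕ) (hN : 2 ≤ N),
    ENNReal.ofReal (1 / (2 * Real.pi)) *
      ∫⁻ θ in Set.Ioc 0 (2 * Real.pi), ∫⁻ v,
        kacPsiPow β (F N v) (F N (kacRotation ⟨0, by omega⟩ ⟨1, by omega⟩ θ v)) ∂(kacSigma N)
      ≤ ENNReal.ofReal (C ^ (1 + β))

/-- The first marginal `Π_1(F)`: the law of `v_1` under `F dσ^N`. -/
def kacMarginal {N : ℕ} (hN : 2 ≤ N) (F : KacSpace N → ℝ) : Measure ℝ :=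
  ((kacSigma N).withDensity (fun v => ENNReal.ofReal (F v))).map
    (fun v => v (⟨0, by omega⟩ : Fin N))

/-- `sup_{N ≥ 2} M_p(Π_1(F_N))`, the uniform absolute moment of order `p` of the first marginals. -/
def kacMoment (p : ℝ) (F : (N : ℕ) → KacSpace N → ℝ) : ℝ≥0∞ :=
  ⨆ (N : ℕ) (hN : 2 ≤ N), ∫⁻ x, ENNReal.ofReal (|x| ^ p) ∂(kacMarginal hN (F N))

/-- `sup_{N ≥ 2} ∫ exp (a |v_1|^μ) F_N dσ^N`, the uniform exponential moment. -/
def kacExpMoment (a μ : ℝ) (F : (N : ℕ) → KacSpace N → ℝ) : ℝ≥0∞ :=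
  ⨆ (N : ℕ) (hN : 2 ≤ N), ∫⁻ v,
    ENNReal.ofReal (Real.exp (a * |v (⟨0, by omega⟩ : Fin N)| ^ μ)) *
      ENNReal.ofReal (F N v) ∂(kacSigma N)

/-- The exponent `ε = (1-γ)(1+β) / (kβ-(1+β))`. -/
def kacEps (γ β k : ℝ) : ℝ := (1 - γ) * (1 + β) / (k * β - (1 + β))

open Classical in
/-- The constant `𝒞_ε` in terms of `γ`, `β`, `k`, the log-power constant `C` and the moment `M`. The
formula for `γ < 1` tends to `1/3` as `γ → 1`, and this is the value taken for `γ = 1`. -/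
def kacConst (γ β k C M : ℝ) : ℝ :=
  if γ = 1 then 1 / 3
  else
    (k * β - (1 + β)) / ((1 + β) * (1 - γ)) *
      ((1 + β) * (1 - γ) / (k * β - γ * (1 + β))) ^
        ((k * β - γ * (1 + β)) / (k * β - (1 + β))) *
      ((2 : ℝ) ^ ((1 - γ) / (k * β - (1 + β))) /
        (3 : ℝ) ^ ((2 * k * β - k * β * γ - γ * (1 + β)) / (k * β - (1 + β)))) *
      (1 / (C ^ ((1 + β) * (1 - γ) / (k * β - (1 + β))) *
        (1 + 2 * M) ^ (β * (1 - γ) / (k * β - (1 + β)))))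

/-- The right-hand side of the bound under an exponential moment, as a function of `h = H_N(F_N)/N`:
`(1/6) |(2^{1+μ}/a) log (K / (h/6)^{(1+β)/β})|^{-2(1-γ)/μ} h` with
`K = 4 C^{(1+β)/β} (2^{2+μ}(1+β)/(aβμe))^{2(1+β)/(βμ)} e^{a/2^{μ/2}} M`. -/
def kacExpBound (γ β a μ C M h : ℝ) : ℝ :=
  1 / 6 *
    |(2 : ℝ) ^ (1 + μ) / a *
      Real.log
        (4 * C ^ ((1 + β) / β) *
            ((2 : ℝ) ^ (2 + μ) * (1 + β) / (a * β * μ * Real.exp 1)) ^ (2 * (1 + β) / (β * μ)) *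
            Real.exp (a / (2 : ℝ) ^ (μ / 2)) * M /
          (h / 6) ^ ((1 + β) / β))| ^ (-(2 * (1 - γ) / μ)) * h

end

/-!
# Entropy production of Kac's walk with weights `(1 + v_i² + v_j²)^γ`

The argument has two independent halves: Villani's inequality for `γ = 1`, which holds for every
density, and an interpolation that passes from `γ = 1` to `γ < 1` by means of the log-power property
and moment bounds.

For `γ = 1` the inequality is `H_N ≤ 3 D_{N,1}` (`kacEntropy_le_three_mul_kacProduction_one`). Let
`f` first be a polynomial that is positive on the sphere, let `L_ij` be the generators of the
rotations, and let `u_t` be the flow of `f` under the heat equation of `T = ∑_{i<j} L_ij²`. Since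
polynomials are finite sums of eigenvectors of `T`, this flow is an explicit finite sum
(`exists_isHeatFlow`), and it stays positive by the minimum principle (`IsHeatFlow.le_of_le`). Two
facts are combined along the flow.
* The Fisher information `∑_{i<j} ∫ (L_ij u)² / u` is the rate of decrease of the entropy, and by the
  curvature bound `Γ₂ ≥ (N - 2) Γ` (`curvature_bound`) it decays exponentially (`fisherInfo_decay`).
  Hence for `N ≥ 3` its integral over the short time interval `[0, 1/(4N)]` already controls the
  entropy of `f` (`polyEntropy_le_integral_fisherInfo`).
* The weight `1 + v_i² + v_j² - 4Nt` is a supersolution of the backward heat equation, is at least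
  `v_i² + v_j²` on that interval, and equals `1 + v_i² + v_j²` at time zero. As `ψ` is convex, its
  weighted integral at time zero therefore dominates a time integral of squared differences of
  logarithmic derivatives (`integral_pairDissipation_le`), which after averaging over the angle
  dominates the Fisher information in the plane of `i` and `j`
  (`four_pi_mul_le_integral_pairDissipation`).

For `N = 2` there is no curvature, but the rotations act transitively on the circle and convexity is
enough (`two_pi_mul_polyEntropy_le`). A general density `F` is approximated by its averages `F_m`
(`kacSmooth`) against the rotation invariant kernels `(1 + ⟨v, y⟩ / (2N))^m`, suitably normalized,
which are positive polynomials on the sphere. By Jensen's inequality for `ψ`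
(`kacPsi_kacSmooth_le`) and the uniform convergence of the averaged weight to `1 + v_i² + v_j²`, the
production of `F_m` is at most `1 + δ` times that of `F` for large `m` (`psi_kacSmooth_le`), and the
entropy is lower semicontinuous (`kacEntropy_le_of_eventually_le`).

For `γ < 1` put `u = 1 + v_i² + v_j²` and split the integral for `D_{N,1}` at `u = A`. Where `u ≤ A`
one has `u ≤ A^{1-γ} u^γ`, which gives `A^{1-γ} D_{N,γ}`. Where `u > A`, Hölder's inequality with the
log-power property bounds the remainder by a constant times a power of the tail
`∫_{u > A} u^{(1+β)/β} (F + F ∘ R)` (`kacEntropy_div_le`). By symmetry of `F` the tail reduces to the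
pair of the first two coordinates, and it decays like a power of `A` under power moments
(`kacTail_le_of_moment`) and like `exp (-c A^{μ/2})` under exponential moments
(`kacTail_le_of_expMoment`). Choosing `A` as a function of `H_N / N` gives the two bounds
(`le_of_forall_interpolation` with `kacConst_mul_rpow_eq`, and `le_of_forall_exp_interpolation`).
-/


open scoped Pointwise

noncomputable section

/-! ### The Kac sphere -/

/-- The Kac sphere `S^{N-1}(√N)`. -/
def kacSphere (N : ℕ) : Set (KacSpace N) := Metric.sphere 0 (Real.sqrt N)

lemma isCompact_kacSphere (N : ℕ) : IsCompact (kacSphere N) := isCompact_sphere _ _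

lemma measurableSet_kacSphere (N : ℕ) : MeasurableSet (kacSphere N) :=
  (isCompact_kacSphere N).isClosed.measurableSet

lemma mem_kacSphere_iff {N : ℕ} {v : KacSpace N} : v ∈ kacSphere N ↔ ∑ k, v k ^ 2 = N := by
  rw [kacSphere, mem_sphere_zero_iff_norm, EuclideanSpace.norm_eq,
    Real.sqrt_inj (by positivity) (by positivity)]
  simp

lemma mem_kacSphere_iff_inner {N : ℕ} {v : KacSpace N} : v ∈ kacSphere N ↔ inner ℝ v v = (N : ℝ) := by
  rw [mem_kacSphere_iff, PiLp.inner_apply]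
  simp [sq]

/-! ### The uniform measure on the Kac sphere -/

section Sigma
variable {N : ℕ}

/-- The action of a linear isometry on the unit sphere. -/
def sphereMap (e : KacSpace N ≃ₗᵢ[ℝ] KacSpace N) (x : Metric.sphere (0 : KacSpace N) 1) :
    Metric.sphere (0 : KacSpace N) 1 := ⟨e x, by simp⟩

lemma continuous_sphereMap (e : KacSpace N ≃ₗᵢ[ℝ] KacSpace N) : Continuous (sphereMap e) := by
  unfold sphereMap
  exact Continuous.subtype_mk (e.continuous.comp continuous_subtype_val) _

lemma map_toSphere_sphereMap (e : KacSpace N ≃ₗᵢ[ℝ] KacSpace N) :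
    (volume : Measure (KacSpace N)).toSphere.map (sphereMap e)
      = (volume : Measure (KacSpace N)).toSphere := by
  ext s hs
  have hm := (continuous_sphereMap e).measurable
  rw [Measure.map_apply hm hs, Measure.toSphere_apply' _ (hm hs), Measure.toSphere_apply' _ hs]
  congr 1
  have : (Set.Ioo (0 : ℝ) 1 • (Subtype.val '' (sphereMap e ⁻¹' s)) : Set (KacSpace N))
      = e ⁻¹' (Set.Ioo (0 : ℝ) 1 • (Subtype.val '' s)) := by
    ext x
    simp only [Set.mem_smul, Set.mem_image, Set.mem_preimage, Subtype.exists]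
    constructor
    · rintro ⟨r, hr, _, ⟨y, hy, hys, rfl⟩, rfl⟩
      exact ⟨r, hr, e y, ⟨e y, by simpa using hy, hys, rfl⟩, by simp⟩
    · rintro ⟨r, hr, _, ⟨y, hy, hys, rfl⟩, h⟩
      refine ⟨r, hr, e.symm y, ⟨e.symm y, by simpa using hy, ?_, rfl⟩, ?_⟩
      · simpa [sphereMap] using hys
      · rw [← map_smul, h, e.symm_apply_apply]
  rw [this]
  exact e.measurePreserving.measure_preimage_equiv (f := e.toMeasurableEquiv) _

lemma measurable_sphere_scale : Measurable
    (fun x : Metric.sphere (0 : KacSpace N) 1 => Real.sqrt (N : ℝ) • (x : KacSpace N)) :=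
  (continuous_subtype_val.const_smul (Real.sqrt (N : ℝ))).measurable

lemma measurePreserving_kacSigma (e : KacSpace N ≃ₗᵢ[ℝ] KacSpace N) :
    MeasurePreserving e (kacSigma N) (kacSigma N) := by
  refine ⟨e.continuous.measurable, ?_⟩
  rw [kacSigma, Measure.map_smul]
  congr 1
  rw [Measure.map_map e.continuous.measurable measurable_sphere_scale]
  conv_rhs => rw [← map_toSphere_sphereMap e]
  rw [Measure.map_map measurable_sphere_scale (continuous_sphereMap e).measurable]
  congr 1
  ext x
  simp [sphereMap]

lemma ae_mem_kacSphere (N : ℕ) : ∀ᵐ v ∂(kacSigma N), v ∈ kacSphere N := by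
  rw [kacSigma]
  refine Measure.ae_smul_measure ?_ _
  refine (ae_map_iff (p := fun v => v ∈ kacSphere N) measurable_sphere_scale.aemeasurable
    (measurableSet_kacSphere N)).mpr ?_
  refine Filter.Eventually.of_forall fun x => ?_
  simp [kacSphere, norm_smul]

lemma restrict_kacSphere (N : ℕ) : (kacSigma N).restrict (kacSphere N) = kacSigma N :=
  Measure.restrict_eq_self_of_ae_mem (ae_mem_kacSphere N)

instance [h : Fact (2 ≤ N)] : Nonempty (Fin N) := ⟨⟨0, by have := h.out; omega⟩⟩

instance kacSigma.isProbabilityMeasure [Fact (2 ≤ N)] : IsProbabilityMeasure (kacSigma N) := by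
  constructor
  rw [kacSigma, Measure.smul_apply, Measure.map_apply measurable_sphere_scale .univ, Set.preimage_univ,
    smul_eq_mul]
  refine ENNReal.inv_mul_cancel ?_ (measure_ne_top _ _)
  rw [Ne, Measure.measure_univ_eq_zero]
  exact Measure.toSphere_ne_zero _

lemma kacSigma_ball_pos [Fact (2 ≤ N)] {v : KacSpace N} (hv : v ∈ kacSphere N) {δ : ℝ} (hδ : 0 < δ) :
    0 < kacSigma N (Metric.ball v δ) := by
  rw [kacSigma, Measure.smul_apply, Measure.map_apply measurable_sphere_scale measurableSet_ball,
    smul_eq_mul]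
  refine ENNReal.mul_pos (ENNReal.inv_ne_zero.mpr (measure_ne_top _ _)) (IsOpen.measure_pos _ ?_ ?_).ne'
  · exact Metric.isOpen_ball.preimage (continuous_subtype_val.const_smul (Real.sqrt (N : ℝ)))
  · have hN : 0 < Real.sqrt N := by
      have : 2 ≤ N := Fact.out
      positivity
    refine ⟨⟨(Real.sqrt N)⁻¹ • v, ?_⟩, ?_⟩
    · have : ‖v‖ = Real.sqrt N := by simpa [kacSphere] using hv
      simp [norm_smul, this, abs_of_pos hN, hN.ne']
    · simp [smul_smul, hN.ne', hδ]

lemma kacSphere_nonempty [Fact (2 ≤ N)] : (kacSphere N).Nonempty := by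
  have : 2 ≤ N := Fact.out
  exact NormedSpace.sphere_nonempty.mpr (by positivity)

end Sigma

/-! ### Integrals of continuous functions on the sphere -/

section Integration
variable {X Y : Type*} [TopologicalSpace X] [TopologicalSpace Y]

lemma integral_swap_of_continuousOn [MeasurableSpace X] [MeasurableSpace Y]
    [OpensMeasurableSpace X] [OpensMeasurableSpace Y] [SecondCountableTopologyEither X Y]
    [T2Space X] [T2Space Y]
    {μ : Measure X} {ν : Measure Y} [IsFiniteMeasureOnCompacts μ] [IsFiniteMeasureOnCompacts ν]
    [SFinite μ] [SFinite ν] {K : Set X} {L : Set Y} (hK : IsCompact K) (hL : IsCompact L)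
    {f : X → Y → ℝ} (hf : ContinuousOn (Function.uncurry f) (K ×ˢ L)) :
    ∫ x in K, ∫ y in L, f x y ∂ν ∂μ = ∫ y in L, ∫ x in K, f x y ∂μ ∂ν := by
  refine integral_integral_swap ?_
  rw [Measure.prod_restrict]
  exact hf.integrableOn_compact (hK.prod hL)
end Integration

/-! ### Rotations in coordinate planes -/

section Rotation
variable {N : ℕ}

lemma kacRotation_apply (i j : Fin N) (θ : ℝ) (v : KacSpace N) (k : Fin N) :
    kacRotation i j θ v k = if k = i then v i * Real.cos θ + v j * Real.sin θ
      else if k = j then -(v i) * Real.sin θ + v j * Real.cos θ else v k := rfl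

lemma kacRotation_fst (i j : Fin N) (θ : ℝ) (v : KacSpace N) :
    kacRotation i j θ v i = v i * Real.cos θ + v j * Real.sin θ := by
  simp [kacRotation_apply]

lemma kacRotation_snd {i j : Fin N} (h : i ≠ j) (θ : ℝ) (v : KacSpace N) :
    kacRotation i j θ v j = -(v i) * Real.sin θ + v j * Real.cos θ := by
  simp [kacRotation_apply, h.symm]

lemma kacRotation_of_ne {i j k : Fin N} (hi : k ≠ i) (hj : k ≠ j) (θ : ℝ) (v : KacSpace N) :
    kacRotation i j θ v k = v k := by
  simp [kacRotation_apply, hi, hj]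

lemma kacRotation_add {i j : Fin N} (h : i ≠ j) (a b : ℝ) (v : KacSpace N) :
    kacRotation i j (a + b) v = kacRotation i j a (kacRotation i j b v) := by
  ext k
  rcases eq_or_ne k i with rfl | hi
  · simp only [kacRotation_fst, kacRotation_snd h, Real.cos_add, Real.sin_add]; ring
  rcases eq_or_ne k j with rfl | hj
  · simp only [kacRotation_fst, kacRotation_snd h, Real.cos_add, Real.sin_add]; ring
  · simp only [kacRotation_of_ne hi hj]

lemma kacRotation_zero (i j : Fin N) (v : KacSpace N) : kacRotation i j 0 v = v := by
  ext k
  rw [kacRotation_apply]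
  split_ifs with h1 h2
  · simp [h1]
  · simp [h2]
  · rfl

lemma kacRotation_two_pi (i j : Fin N) (θ : ℝ) (v : KacSpace N) :
    kacRotation i j (θ + 2 * Real.pi) v = kacRotation i j θ v := by
  ext k
  simp [kacRotation_apply]

lemma sum_sq_kacRotation {i j : Fin N} (h : i ≠ j) (θ : ℝ) (v : KacSpace N) :
    ∑ k, kacRotation i j θ v k ^ 2 = ∑ k, v k ^ 2 := by
  rw [← sub_eq_zero, ← Finset.sum_sub_distrib,
    ← Finset.sum_subset (Finset.subset_univ {i, j}), Finset.sum_pair h]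
  · rw [kacRotation_fst, kacRotation_snd h]
    linear_combination (v i ^ 2 + v j ^ 2) * Real.sin_sq_add_cos_sq θ
  · intro k _ hk
    simp only [Finset.mem_insert, Finset.mem_singleton, not_or] at hk
    rw [kacRotation_of_ne hk.1 hk.2, sub_self]

/-- The rotation `kacRotation i j θ` as a linear isometry of `ℝ^N`. -/
def kacRotIsom {i j : Fin N} (h : i ≠ j) (θ : ℝ) : KacSpace N ≃ₗᵢ[ℝ] KacSpace N where
  toFun := kacRotation i j θ
  invFun := kacRotation i j (-θ)
  map_add' v w := by
    ext k
    simp only [kacRotation_apply, PiLp.add_apply]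
    split_ifs <;> ring
  map_smul' c v := by
    ext k
    simp only [kacRotation_apply, PiLp.smul_apply, smul_eq_mul, RingHom.id_apply]
    split_ifs <;> ring
  left_inv v := by
    rw [← kacRotation_add h, neg_add_cancel, kacRotation_zero]
  right_inv v := by
    rw [← kacRotation_add h, add_neg_cancel, kacRotation_zero]
  norm_map' v := by
    simp only [EuclideanSpace.norm_eq, Real.norm_eq_abs, sq_abs]
    exact congrArg Real.sqrt (sum_sq_kacRotation h θ v)

@[simp] lemma kacRotIsom_apply {i j : Fin N} (h : i ≠ j) (θ : ℝ) (v : KacSpace N) :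
    kacRotIsom h θ v = kacRotation i j θ v := rfl

lemma measurePreserving_kacRotation {i j : Fin N} (h : i ≠ j) (θ : ℝ) :
    MeasurePreserving (kacRotation i j θ) (kacSigma N) (kacSigma N) :=
  measurePreserving_kacSigma (kacRotIsom h θ)

lemma kacRotation_mem {i j : Fin N} (h : i ≠ j) (θ : ℝ) {v : KacSpace N} (hv : v ∈ kacSphere N) :
    kacRotation i j θ v ∈ kacSphere N := by
  rw [mem_kacSphere_iff] at hv ⊢
  rw [sum_sq_kacRotation h, hv]

lemma continuous_kacRotation (i j : Fin N) :
    Continuous (fun p : ℝ × KacSpace N => kacRotation i j p.1 p.2) := by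
  unfold kacRotation
  refine (PiLp.continuous_toLp 2 _).comp (continuous_pi fun k => ?_)
  split_ifs <;> fun_prop

/-- The radius in the plane of rotation is invariant. -/
lemma sq_add_sq_kacRotation {i j : Fin N} (h : i ≠ j) (θ : ℝ) (v : KacSpace N) :
    kacRotation i j θ v i ^ 2 + kacRotation i j θ v j ^ 2 = v i ^ 2 + v j ^ 2 := by
  rw [kacRotation_fst, kacRotation_snd h]
  linear_combination (v i ^ 2 + v j ^ 2) * Real.sin_sq_add_cos_sq θ

lemma integral_comp_kacRotation {i j : Fin N} (h : i ≠ j) (θ : ℝ) (f : KacSpace N → ℝ) :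
    ∫ v, f (kacRotation i j θ v) ∂kacSigma N = ∫ v, f v ∂kacSigma N :=
  (measurePreserving_kacRotation h θ).integral_comp
    (kacRotIsom h θ).toHomeomorph.measurableEmbedding f

end Rotation

/-! ### Integration by parts along rotation fields -/

section IntegrationByParts
variable {N : ℕ}

lemma integrable_of_continuousOn_kacSphere [Fact (2 ≤ N)] {f : KacSpace N → ℝ}
    (hf : ContinuousOn f (kacSphere N)) : Integrable f (kacSigma N) := by
  rw [← restrict_kacSphere]
  exact hf.integrableOn_compact (isCompact_kacSphere N)

lemma integral_congr_kacSphere {f g : KacSpace N → ℝ} (h : ∀ v ∈ kacSphere N, f v = g v) :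
    ∫ v, f v ∂kacSigma N = ∫ v, g v ∂kacSigma N :=
  integral_congr_ae ((ae_mem_kacSphere N).mono h)

lemma integral_mono_kacSphere [Fact (2 ≤ N)] {f g : KacSpace N → ℝ}
    (hf : ContinuousOn f (kacSphere N)) (hg : ContinuousOn g (kacSphere N))
    (h : ∀ v ∈ kacSphere N, f v ≤ g v) :
    ∫ v, f v ∂kacSigma N ≤ ∫ v, g v ∂kacSigma N :=
  integral_mono_ae (integrable_of_continuousOn_kacSphere hf)
    (integrable_of_continuousOn_kacSphere hg) ((ae_mem_kacSphere N).mono h)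

lemma continuousOn_integral_kacSigma [Fact (2 ≤ N)] {X : Type*} [TopologicalSpace X]
    [FirstCountableTopology X] {K : Set X} (hK : IsCompact K) {f : X → KacSpace N → ℝ}
    (hf : ContinuousOn (Function.uncurry f) (K ×ˢ kacSphere N)) :
    ContinuousOn (fun x => ∫ v, f x v ∂kacSigma N) K := by
  obtain ⟨B, hB⟩ := (hK.prod (isCompact_kacSphere N)).exists_bound_of_continuousOn hf
  refine continuousOn_of_dominated (bound := fun _ => B) ?_ ?_ (integrable_const B) ?_
  · intro x hx
    exact (integrable_of_continuousOn_kacSphere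
      (hf.comp (by fun_prop : ContinuousOn (fun v => (x, v)) _)
        fun v hv => ⟨hx, hv⟩)).aestronglyMeasurable
  · intro x hx
    filter_upwards [ae_mem_kacSphere N] with v hv
    exact hB (x, v) ⟨hx, hv⟩
  · filter_upwards [ae_mem_kacSphere N] with v hv
    exact hf.comp (by fun_prop : ContinuousOn (fun x => (x, v)) _) fun x hx => ⟨hx, hv⟩

lemma intervalIntegral_integral_swap [Fact (2 ≤ N)] {a b : ℝ} (hab : a ≤ b)
    {f : ℝ → KacSpace N → ℝ}
    (hf : ContinuousOn (Function.uncurry f) (Set.Icc a b ×ˢ kacSphere N)) :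
    ∫ t in a..b, ∫ v, f t v ∂kacSigma N = ∫ v, (∫ t in a..b, f t v) ∂kacSigma N := by
  simp only [intervalIntegral.integral_of_le hab, ← integral_Icc_eq_integral_Ioc]
  have := integral_swap_of_continuousOn (μ := volume) (ν := kacSigma N)
    (isCompact_Icc (a := a) (b := b)) (isCompact_kacSphere N) hf
  rwa [restrict_kacSphere] at this

/-- `φ'` is the derivative of `φ` on the sphere along the rotations in the plane of the coordinates
`i`, `j`. -/
def HasRotDeriv (i j : Fin N) (φ φ' : KacSpace N → ℝ) : Prop :=
  ∀ v ∈ kacSphere N, HasDerivAt (fun θ => φ (kacRotation i j θ v)) (φ' v) 0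

lemma HasRotDeriv.hasDerivAt {i j : Fin N} (hij : i ≠ j) {φ φ' : KacSpace N → ℝ}
    (h : HasRotDeriv i j φ φ') {v : KacSpace N} (hv : v ∈ kacSphere N) (θ : ℝ) :
    HasDerivAt (fun s => φ (kacRotation i j s v)) (φ' (kacRotation i j θ v)) θ := by
  have h1 := h _ (kacRotation_mem hij θ hv)
  have h3 := HasDerivAt.comp_sub_const θ θ ((sub_self θ).symm ▸ h1)
  refine h3.congr_of_eventuallyEq (Filter.Eventually.of_forall fun s => ?_)
  simp only
  rw [← kacRotation_add hij, sub_add_cancel]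

lemma HasRotDeriv.comp_kacRotation {i j : Fin N} (hij : i ≠ j) {φ φ' : KacSpace N → ℝ}
    (h : HasRotDeriv i j φ φ') (θ : ℝ) :
    HasRotDeriv i j (fun v => φ (kacRotation i j θ v)) (fun v => φ' (kacRotation i j θ v)) := by
  intro v hv
  have := h _ (kacRotation_mem hij θ hv)
  refine this.congr_of_eventuallyEq (Filter.Eventually.of_forall fun s => ?_)
  simp only
  rw [← kacRotation_add hij, ← kacRotation_add hij, add_comm]

lemma continuousOn_comp_kacRotation {i j : Fin N} (hij : i ≠ j) {φ : KacSpace N → ℝ}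
    (h : ContinuousOn φ (kacSphere N)) (s : Set ℝ) :
    ContinuousOn (Function.uncurry fun θ v => φ (kacRotation i j θ v)) (s ×ˢ kacSphere N) :=
  h.comp (continuous_kacRotation i j).continuousOn fun p hp => kacRotation_mem hij p.1 hp.2

/-- Derivatives along rotations have mean zero over each orbit. -/
lemma HasRotDeriv.intervalIntegral_eq_zero {i j : Fin N} (hij : i ≠ j)
    {φ φ' : KacSpace N → ℝ} (h : HasRotDeriv i j φ φ') (hc : ContinuousOn φ' (kacSphere N))
    {v : KacSpace N} (hv : v ∈ kacSphere N) :
    ∫ θ in (0 : ℝ)..2 * Real.pi, φ' (kacRotation i j θ v) = 0 := by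
  rw [intervalIntegral.integral_eq_sub_of_hasDerivAt (fun θ _ => h.hasDerivAt hij hv θ)]
  · rw [← zero_add (2 * Real.pi), kacRotation_two_pi, sub_self]
  · refine Continuous.intervalIntegrable ?_ _ _
    rw [← continuousOn_univ]
    exact (continuousOn_comp_kacRotation hij hc Set.univ).comp
      (by fun_prop : ContinuousOn (fun θ => (θ, v)) _) fun θ _ => ⟨trivial, hv⟩

/-- Integration by parts on the sphere: derivatives along rotations have integral zero. -/
lemma HasRotDeriv.integral_eq_zero [Fact (2 ≤ N)] {i j : Fin N} (hij : i ≠ j)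
    {φ φ' : KacSpace N → ℝ} (h : HasRotDeriv i j φ φ') (hc : ContinuousOn φ' (kacSphere N)) :
    ∫ v, φ' v ∂kacSigma N = 0 := by
  have hpi := Real.pi_pos
  have h1 := intervalIntegral_integral_swap (N := N) (a := 0) (b := 2 * Real.pi) (by positivity)
    (continuousOn_comp_kacRotation hij hc _)
  rw [integral_congr_kacSphere (fun v hv => h.intervalIntegral_eq_zero hij hc hv)] at h1
  simp only [integral_comp_kacRotation hij, intervalIntegral.integral_const, integral_zero,
    smul_eq_mul, sub_zero, mul_eq_zero] at h1
  rcases h1 with h1 | h1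
  · rcases h1 with h1 | h1 <;> linarith
  · exact h1

end IntegrationByParts

/-! ### Polynomial functions and the spherical Laplacian -/

section Polynomials
open MvPolynomial
variable {N : ℕ}

/-- Evaluation of a polynomial in `N` variables at a point of `ℝ^N`. -/
def polyEval (p : MvPolynomial (Fin N) ℝ) (v : KacSpace N) : ℝ := eval (fun k => v k) p

@[simp] lemma polyEval_add (p q : MvPolynomial (Fin N) ℝ) (v : KacSpace N) :
    polyEval (p + q) v = polyEval p v + polyEval q v := by simp [polyEval]
@[simp] lemma polyEval_sub (p q : MvPolynomial (Fin N) ℝ) (v : KacSpace N) :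
    polyEval (p - q) v = polyEval p v - polyEval q v := by simp [polyEval]
@[simp] lemma polyEval_neg (p : MvPolynomial (Fin N) ℝ) (v : KacSpace N) :
    polyEval (-p) v = -polyEval p v := by simp [polyEval]
@[simp] lemma polyEval_mul (p q : MvPolynomial (Fin N) ℝ) (v : KacSpace N) :
    polyEval (p * q) v = polyEval p v * polyEval q v := by simp [polyEval]
@[simp] lemma polyEval_C (a : ℝ) (v : KacSpace N) : polyEval (C a) v = a := by simp [polyEval]
@[simp] lemma polyEval_one (v : KacSpace N) : polyEval 1 v = 1 := by simp [polyEval]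
@[simp] lemma polyEval_zero (v : KacSpace N) : polyEval 0 v = 0 := by simp [polyEval]
@[simp] lemma polyEval_X (k : Fin N) (v : KacSpace N) : polyEval (X k) v = v k := by simp [polyEval]
@[simp] lemma polyEval_smul (a : ℝ) (p : MvPolynomial (Fin N) ℝ) (v : KacSpace N) :
    polyEval (a • p) v = a * polyEval p v := by simp [polyEval, smul_eval]
@[simp] lemma polyEval_sum {ι : Type*} (s : Finset ι) (p : ι → MvPolynomial (Fin N) ℝ)
    (v : KacSpace N) : polyEval (∑ i ∈ s, p i) v = ∑ i ∈ s, polyEval (p i) v := by simp [polyEval]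
@[simp] lemma polyEval_pow (p : MvPolynomial (Fin N) ℝ) (n : ℕ) (v : KacSpace N) :
    polyEval (p ^ n) v = polyEval p v ^ n := by simp [polyEval]

@[fun_prop] lemma continuous_polyEval (p : MvPolynomial (Fin N) ℝ) : Continuous (polyEval p) := by
  unfold polyEval
  exact (MvPolynomial.continuous_eval p).comp (by fun_prop)

/-- The derivation `x_j ∂_i - x_i ∂_j`, the derivative along the rotations `kacRotation i j`. -/
def rotDeriv (i j : Fin N) : Derivation ℝ (MvPolynomial (Fin N) ℝ) (MvPolynomial (Fin N) ℝ) :=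
  (X j : MvPolynomial (Fin N) ℝ) • pderiv i - (X i : MvPolynomial (Fin N) ℝ) • pderiv j

lemma rotDeriv_apply (i j : Fin N) (p : MvPolynomial (Fin N) ℝ) :
    rotDeriv i j p = X j * pderiv i p - X i * pderiv j p := rfl

/-- The Euler field `∑ x_k ∂_k`. -/
def eulerDeriv (N : ℕ) : Derivation ℝ (MvPolynomial (Fin N) ℝ) (MvPolynomial (Fin N) ℝ) :=
  ∑ k, (X k : MvPolynomial (Fin N) ℝ) • pderiv k

lemma eulerDeriv_apply (p : MvPolynomial (Fin N) ℝ) :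
    eulerDeriv N p = ∑ k, X k * pderiv k p := by
  change Derivation.coeFnAddMonoidHom (∑ k, (X k : MvPolynomial (Fin N) ℝ) • pderiv k) p = _
  rw [map_sum, Finset.sum_apply]; rfl

/-- The Laplacian of `ℝ^N` on polynomials. -/
def polyLaplacian (p : MvPolynomial (Fin N) ℝ) : MvPolynomial (Fin N) ℝ :=
  ∑ k, pderiv k (pderiv k p)

/-- The polynomial `|x|²`. -/
def normSqPoly (N : ℕ) : MvPolynomial (Fin N) ℝ := ∑ k, X k ^ 2

/-- The pairs `i < j`. -/
def kacPairs (N : ℕ) : Finset (Fin N × Fin N) := {p | p.1 < p.2}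

lemma ne_of_mem_kacPairs {A : Fin N × Fin N} (h : A ∈ kacPairs N) : A.1 ≠ A.2 := by
  simp only [kacPairs, Finset.mem_filter] at h
  exact h.2.ne

/-- `N` times the Laplace-Beltrami operator of the Kac sphere, as the sum of the squares of the
rotation fields. -/
def sphereLaplacian (N : ℕ) : MvPolynomial (Fin N) ℝ →ₗ[ℝ] MvPolynomial (Fin N) ℝ :=
  ∑ A ∈ kacPairs N, (rotDeriv A.1 A.2).toLinearMap ∘ₗ (rotDeriv A.1 A.2).toLinearMap

lemma sphereLaplacian_apply (p : MvPolynomial (Fin N) ℝ) :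
    sphereLaplacian N p = ∑ A ∈ kacPairs N, rotDeriv A.1 A.2 (rotDeriv A.1 A.2 p) := by
  simp [sphereLaplacian]

lemma sum_kacPairs {M : Type*} [AddCommGroup M] {f : Fin N → Fin N → M}
    (hs : ∀ i j, f i j = f j i) (hd : ∀ i, f i i = 0) :
    2 • ∑ A ∈ kacPairs N, f A.1 A.2 = ∑ i, ∑ j, f i j := by
  rw [← Fintype.sum_prod_type' (f := f)]
  have h1 : ∑ A ∈ kacPairs N, f A.1 A.2
      = ∑ A : Fin N × Fin N with A.2 < A.1, f A.1 A.2 :=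
    Finset.sum_bij' (fun A _ => A.swap) (fun A _ => A.swap) (by simp [kacPairs])
      (by simp [kacPairs]) (by simp) (by simp) (fun A _ => hs _ _)
  have h2 : ∑ A : Fin N × Fin N with ¬ A.1 < A.2, f A.1 A.2
      = ∑ A : Fin N × Fin N with A.2 < A.1, f A.1 A.2 := by
    refine (Finset.sum_subset (fun A hA => ?_) fun A hA hA' => ?_).symm
    · simp only [Finset.mem_filter, Finset.mem_univ, true_and] at hA ⊢
      exact hA.le.not_gt
    · simp only [Finset.mem_filter, Finset.mem_univ, true_and] at hA hA'
      have : A.1 = A.2 := le_antisymm (not_lt.mp hA') (not_lt.mp hA)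
      rw [this, hd]
  rw [← Finset.sum_filter_add_sum_filter_not Finset.univ (fun A : Fin N × Fin N => A.1 < A.2), h2,
    ← h1, two_nsmul, kacPairs]

lemma rotDeriv_self (i : Fin N) (p : MvPolynomial (Fin N) ℝ) : rotDeriv i i p = 0 := by
  simp [rotDeriv_apply]

lemma rotDeriv_swap (i j : Fin N) (p : MvPolynomial (Fin N) ℝ) :
    rotDeriv j i p = - rotDeriv i j p := by
  simp [rotDeriv_apply]

lemma pderiv_comm (i j : Fin N) (p : MvPolynomial (Fin N) ℝ) :
    pderiv i (pderiv j p) = pderiv j (pderiv i p) := by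
  have : ⁅(pderiv i : Derivation ℝ (MvPolynomial (Fin N) ℝ) (MvPolynomial (Fin N) ℝ)),
      (pderiv j : Derivation ℝ (MvPolynomial (Fin N) ℝ) (MvPolynomial (Fin N) ℝ))⁆ = 0 := by
    refine derivation_ext fun k => ?_
    rw [Derivation.commutator_apply, pderiv_X, pderiv_X]
    simp only [Pi.single_apply]
    split_ifs <;> simp
  have h := congrArg (fun D => D p) this
  simpa [Derivation.commutator_apply, sub_eq_zero] using h

lemma sum_mul_ite_X (q : Fin N → MvPolynomial (Fin N) ℝ) (i : Fin N) :
    ∑ j, q j * pderiv i (X j : MvPolynomial (Fin N) ℝ) = q i := by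
  simp [pderiv_X, Pi.single_apply]

lemma eulerDeriv_eulerDeriv (p : MvPolynomial (Fin N) ℝ) :
    eulerDeriv N (eulerDeriv N p) = eulerDeriv N p
      + ∑ i, ∑ j, X i * X j * pderiv i (pderiv j p) := by
  have e1 : ∀ i j : Fin N, X i * pderiv i (X j * pderiv j p)
      = X i * pderiv j p * pderiv i (X j) + X i * X j * pderiv i (pderiv j p) := by
    intro i j
    rw [Derivation.leibniz, smul_eq_mul, smul_eq_mul]
    ring
  rw [eulerDeriv_apply (eulerDeriv N p), eulerDeriv_apply]
  simp only [map_sum, Finset.mul_sum, e1, Finset.sum_add_distrib]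
  simp only [sum_mul_ite_X (fun j => X _ * pderiv j p)]

lemma rotDeriv_rotDeriv (p : MvPolynomial (Fin N) ℝ) (i j : Fin N) :
    rotDeriv i j (rotDeriv i j p) =
      X j * pderiv i p * pderiv i (X j) + X j ^ 2 * pderiv i (pderiv i p) - X j * pderiv j p
         - X i * X j * pderiv i (pderiv j p) - X i * pderiv i p
         - X i * X j * pderiv i (pderiv j p)
         + X i * pderiv j p * pderiv j (X i) + X i ^ 2 * pderiv j (pderiv j p) := by
  simp only [rotDeriv_apply, map_sub, Derivation.leibniz, smul_eq_mul, pderiv_X_self]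
  rw [pderiv_comm j i p]
  ring

lemma sum_rotDeriv_rotDeriv (p : MvPolynomial (Fin N) ℝ) :
    ∑ i, ∑ j, rotDeriv i j (rotDeriv i j p)
      = 2 * (normSqPoly N * polyLaplacian p) + 2 * eulerDeriv N p
        - 2 * (N : MvPolynomial (Fin N) ℝ) * eulerDeriv N p
        - 2 * ∑ i, ∑ j, X i * X j * pderiv i (pderiv j p) := by
  simp only [rotDeriv_rotDeriv, Finset.sum_add_distrib, Finset.sum_sub_distrib]
  simp only [sum_mul_ite_X (fun j => X j * pderiv _ p)]
  rw [Finset.sum_comm (f := fun i j => X i * pderiv j p * pderiv j (X i))]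
  simp only [sum_mul_ite_X (fun j => X j * pderiv _ p), Finset.sum_const, Finset.card_univ,
    Fintype.card_fin, ← eulerDeriv_apply, ← Finset.mul_sum, ← Finset.sum_mul, nsmul_eq_mul]
  rw [normSqPoly, polyLaplacian]
  ring

/-- The spherical Laplacian in terms of the Laplacian of `ℝ^N` and the Euler field. -/
lemma sphereLaplacian_eq (p : MvPolynomial (Fin N) ℝ) :
    sphereLaplacian N p = normSqPoly N * polyLaplacian p - eulerDeriv N (eulerDeriv N p)
      - ((N : ℝ) - 2) • eulerDeriv N p := by
  have h1 := sum_kacPairs (N := N) (f := fun i j => rotDeriv i j (rotDeriv i j p))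
    (fun i j => by rw [rotDeriv_swap i j, rotDeriv_swap i j, map_neg, neg_neg])
    (fun i => by rw [rotDeriv_self])
  rw [← sphereLaplacian_apply, sum_rotDeriv_rotDeriv] at h1
  rw [eulerDeriv_eulerDeriv]
  have h3 : (2 : MvPolynomial (Fin N) ℝ) ≠ 0 := by
    rw [← map_ofNat (C : ℝ →+* MvPolynomial (Fin N) ℝ) 2, Ne, C_eq_zero]
    norm_num
  apply mul_left_cancel₀ h3
  simp only [nsmul_eq_mul, smul_eq_C_mul, map_sub, map_natCast, map_ofNat, Nat.cast_ofNat] at h1 ⊢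
  rw [h1]
  ring

end Polynomials

/-! ### Invariance of the polynomial operators under isometries -/

section PolynomialSymmetry
open MvPolynomial
variable {N : ℕ}

lemma rotDeriv_normSqPoly (i j : Fin N) : rotDeriv i j (normSqPoly N) = 0 := by
  have h : ∀ i : Fin N, pderiv i (normSqPoly N) = 2 * X i := by
    intro i
    rw [normSqPoly, map_sum, ← sum_mul_ite_X (fun j => 2 * X j) i]
    refine Finset.sum_congr rfl fun k _ => ?_
    rw [Derivation.leibniz_pow]
    simp only [nsmul_eq_mul, smul_eq_mul]
    push_cast
    ring
  rw [rotDeriv_apply, h, h]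
  ring

lemma polyLaplacian_X_mul (i : Fin N) (p : MvPolynomial (Fin N) ℝ) :
    polyLaplacian (X i * p) = X i * polyLaplacian p + 2 * pderiv i p := by
  have e : ∀ k : Fin N, pderiv k (pderiv k (X i * p))
      = X i * pderiv k (pderiv k p) + 2 * (pderiv k p * pderiv i (X k)) := by
    intro k
    have hc : pderiv k (X i : MvPolynomial (Fin N) ℝ) = pderiv i (X k) := by
      rw [pderiv_X, pderiv_X, Pi.single_apply, Pi.single_apply]; simp only [eq_comm]
    have hz : pderiv k (pderiv i (X k : MvPolynomial (Fin N) ℝ)) = 0 := by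
      rw [pderiv_X, Pi.single_apply]; split_ifs <;> simp
    simp only [Derivation.leibniz, smul_eq_mul, map_add, hc, hz]
    ring
  simp only [polyLaplacian, e, Finset.sum_add_distrib, ← Finset.mul_sum]
  rw [sum_mul_ite_X (fun k => pderiv k p)]

lemma pderiv_polyLaplacian (i : Fin N) (p : MvPolynomial (Fin N) ℝ) :
    pderiv i (polyLaplacian p) = polyLaplacian (pderiv i p) := by
  rw [polyLaplacian, map_sum, polyLaplacian]
  refine Finset.sum_congr rfl fun k _ => ?_
  rw [pderiv_comm i k, pderiv_comm i k]

lemma polyLaplacian_sub (p q : MvPolynomial (Fin N) ℝ) :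
    polyLaplacian (p - q) = polyLaplacian p - polyLaplacian q := by
  simp [polyLaplacian, Finset.sum_sub_distrib]

lemma rotDeriv_polyLaplacian (i j : Fin N) (p : MvPolynomial (Fin N) ℝ) :
    rotDeriv i j (polyLaplacian p) = polyLaplacian (rotDeriv i j p) := by
  rw [rotDeriv_apply, rotDeriv_apply, polyLaplacian_sub, polyLaplacian_X_mul, polyLaplacian_X_mul,
    pderiv_polyLaplacian, pderiv_polyLaplacian, pderiv_comm j i]
  ring

lemma rotDeriv_X (i j k : Fin N) :
    rotDeriv i j (X k) = (if k = i then X j else 0) - (if k = j then X i else 0) := by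
  rw [rotDeriv_apply, pderiv_X, pderiv_X, Pi.single_apply, Pi.single_apply]
  simp

lemma eulerDeriv_X (k : Fin N) : eulerDeriv N (X k) = X k := by
  rw [eulerDeriv_apply]
  simp [pderiv_X, Pi.single_apply]

lemma rotDeriv_eulerDeriv (i j : Fin N) (p : MvPolynomial (Fin N) ℝ) :
    rotDeriv i j (eulerDeriv N p) = eulerDeriv N (rotDeriv i j p) := by
  have : ⁅rotDeriv i j, eulerDeriv N⁆ = 0 := by
    refine derivation_ext fun k => ?_
    rw [Derivation.commutator_apply, eulerDeriv_X, rotDeriv_X]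
    split_ifs <;> simp [eulerDeriv_X]
  have h := congrArg (fun D => D p) this
  simpa [Derivation.commutator_apply, sub_eq_zero] using h

/-- The rotation fields commute with the spherical Laplacian. -/
lemma rotDeriv_sphereLaplacian (i j : Fin N) (p : MvPolynomial (Fin N) ℝ) :
    rotDeriv i j (sphereLaplacian N p) = sphereLaplacian N (rotDeriv i j p) := by
  rw [sphereLaplacian_eq, sphereLaplacian_eq, map_sub, map_sub, Derivation.leibniz,
    rotDeriv_normSqPoly, Derivation.map_smul, rotDeriv_eulerDeriv, rotDeriv_eulerDeriv,
    rotDeriv_polyLaplacian]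
  simp

/-- The matrix entries of a linear isometry. -/
def isomEntry (e : KacSpace N ≃ₗᵢ[ℝ] KacSpace N) (a k : Fin N) : ℝ :=
  e (EuclideanSpace.single k 1) a

lemma isom_apply_eq_sum (e : KacSpace N ≃ₗᵢ[ℝ] KacSpace N) (v : KacSpace N) (a : Fin N) :
    e v a = ∑ k, isomEntry e a k * v k := by
  have hv : v = ∑ k, v k • EuclideanSpace.single k (1 : ℝ) := by
    ext i
    simp [Finset.sum_apply, Pi.single_apply]
  conv_lhs => rw [hv, map_sum]
  simp [isomEntry, mul_comm]

lemma sum_isomEntry_mul (e : KacSpace N ≃ₗᵢ[ℝ] KacSpace N) (k l : Fin N) :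
    ∑ a, isomEntry e a k * isomEntry e a l = if k = l then 1 else 0 := by
  have h := e.inner_map_map (EuclideanSpace.single k (1 : ℝ)) (EuclideanSpace.single l 1)
  rw [PiLp.inner_apply] at h
  simp only [RCLike.inner_apply, conj_trivial, EuclideanSpace.inner_single_left, one_mul,
    PiLp.single_apply] at h
  rw [← h]
  exact Finset.sum_congr rfl fun a _ => mul_comm _ _

lemma sum_isomEntry_mul' (e : KacSpace N ≃ₗᵢ[ℝ] KacSpace N) (a b : Fin N) :
    ∑ k, isomEntry e a k * isomEntry e b k = if a = b then 1 else 0 := by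
  let M : Matrix (Fin N) (Fin N) ℝ := Matrix.of fun a k => isomEntry e a k
  have h : M.transpose * M = 1 := by
    ext k l
    rw [Matrix.mul_apply, Matrix.one_apply, ← sum_isomEntry_mul e]
    rfl
  have h' : M * M.transpose = 1 := mul_eq_one_comm.mp h
  rw [← Matrix.one_apply, ← h', Matrix.mul_apply]
  rfl

/-- Substitution of a linear isometry into a polynomial. -/
def isomSubst (e : KacSpace N ≃ₗᵢ[ℝ] KacSpace N) :
    MvPolynomial (Fin N) ℝ →ₐ[ℝ] MvPolynomial (Fin N) ℝ :=
  aeval fun a => ∑ k, C (isomEntry e a k) * X k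

lemma isomSubst_X (e : KacSpace N ≃ₗᵢ[ℝ] KacSpace N) (a : Fin N) :
    isomSubst e (X a) = ∑ k, C (isomEntry e a k) * X k := by simp [isomSubst]

lemma polyEval_isomSubst (e : KacSpace N ≃ₗᵢ[ℝ] KacSpace N) (p : MvPolynomial (Fin N) ℝ)
    (v : KacSpace N) : polyEval (isomSubst e p) v = polyEval p (e v) := by
  induction p using MvPolynomial.induction_on with
  | C a => simp [← algebraMap_eq]
  | add p q hp hq => simp [hp, hq]
  | mul_X p n hp => simp [hp, isomSubst_X, isom_apply_eq_sum]

lemma pderiv_isomSubst (e : KacSpace N ≃ₗᵢ[ℝ] KacSpace N) (k : Fin N)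
    (p : MvPolynomial (Fin N) ℝ) :
    pderiv k (isomSubst e p) = ∑ a, C (isomEntry e a k) * isomSubst e (pderiv a p) := by
  induction p using MvPolynomial.induction_on with
  | C a =>
    rw [← algebraMap_eq, AlgHom.commutes]
    simp
  | add p q hp hq => simp [hp, hq, mul_add, Finset.sum_add_distrib]
  | mul_X p n hp =>
    have h1 : pderiv k (isomSubst e (X n)) = C (isomEntry e n k) := by
      rw [isomSubst_X, map_sum]
      simp [pderiv_X, Pi.single_apply]
    rw [map_mul, Derivation.leibniz, hp, h1]
    simp only [Derivation.leibniz, map_add, smul_eq_mul, map_mul, mul_add, Finset.sum_add_distrib,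
      Finset.mul_sum]
    congr 1
    · rw [Finset.sum_eq_single n]
      · simp [mul_comm]
      · intro b _ hb
        simp [pderiv_X, hb.symm]
      · simp
    · exact Finset.sum_congr rfl fun a _ => by ring

lemma isomSubst_polyLaplacian (e : KacSpace N ≃ₗᵢ[ℝ] KacSpace N) (p : MvPolynomial (Fin N) ℝ) :
    polyLaplacian (isomSubst e p) = isomSubst e (polyLaplacian p) := by
  have h : ∀ k, pderiv k (pderiv k (isomSubst e p))
      = ∑ a, ∑ b, C (isomEntry e a k * isomEntry e b k) * isomSubst e (pderiv b (pderiv a p)) := by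
    intro k
    rw [pderiv_isomSubst, map_sum]
    refine Finset.sum_congr rfl fun a _ => ?_
    rw [pderiv_C_mul, pderiv_isomSubst, Finset.mul_sum]
    exact Finset.sum_congr rfl fun b _ => by rw [C_mul]; ring
  rw [polyLaplacian, polyLaplacian, map_sum]
  simp only [h]
  rw [Finset.sum_comm]
  refine Finset.sum_congr rfl fun a _ => ?_
  rw [Finset.sum_comm]
  simp only [← Finset.sum_mul, ← map_sum, sum_isomEntry_mul']
  rw [Finset.sum_eq_single a]
  · simp
  · intro b _ hb
    simp [hb.symm]
  · simp

lemma isomSubst_eulerDeriv (e : KacSpace N ≃ₗᵢ[ℝ] KacSpace N) (p : MvPolynomial (Fin N) ℝ) :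
    eulerDeriv N (isomSubst e p) = isomSubst e (eulerDeriv N p) := by
  simp only [eulerDeriv_apply, pderiv_isomSubst, map_sum, map_mul, isomSubst_X, Finset.mul_sum,
    Finset.sum_mul]
  rw [Finset.sum_comm]
  exact Finset.sum_congr rfl fun a _ => Finset.sum_congr rfl fun b _ => by ring

lemma isomSubst_normSqPoly (e : KacSpace N ≃ₗᵢ[ℝ] KacSpace N) :
    isomSubst e (normSqPoly N) = normSqPoly N := by
  rw [normSqPoly, map_sum]
  simp only [sq, map_mul, isomSubst_X, Finset.sum_mul_sum]
  rw [Finset.sum_comm]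
  refine Finset.sum_congr rfl fun k _ => ?_
  rw [Finset.sum_comm]
  have : ∀ l, ∑ a, C (isomEntry e a k) * X k * (C (isomEntry e a l) * X l)
      = C (if k = l then 1 else 0) * (X k * X l : MvPolynomial (Fin N) ℝ) := by
    intro l
    rw [← sum_isomEntry_mul e, map_sum, Finset.sum_mul]
    exact Finset.sum_congr rfl fun a _ => by rw [C_mul]; ring
  simp only [this]
  rw [Finset.sum_eq_single k]
  · simp
  · intro b _ hb
    simp [hb.symm]
  · simp

/-- The spherical Laplacian commutes with linear isometries. -/
lemma sphereLaplacian_isomSubst (e : KacSpace N ≃ₗᵢ[ℝ] KacSpace N) (p : MvPolynomial (Fin N) ℝ) :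
    sphereLaplacian N (isomSubst e p) = isomSubst e (sphereLaplacian N p) := by
  rw [sphereLaplacian_eq, sphereLaplacian_eq, map_sub, map_sub, map_mul, isomSubst_normSqPoly,
    map_smul, isomSubst_eulerDeriv, isomSubst_eulerDeriv, isomSubst_polyLaplacian]

lemma hasDerivAt_kacRotation {i j : Fin N} (hij : i ≠ j) (k : Fin N) (v : KacSpace N) :
    HasDerivAt (fun θ => kacRotation i j θ v k) (polyEval (rotDeriv i j (X k)) v) 0 := by
  simp only [kacRotation_apply, rotDeriv_X, polyEval_sub]
  have hs := Real.hasDerivAt_sin 0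
  have hc := Real.hasDerivAt_cos 0
  split_ifs with h1 h2 h3
  · exact absurd (h1.symm.trans h2) hij
  · exact ((hc.const_mul (v i)).fun_add (hs.const_mul (v j))).congr_deriv (by simp)
  · exact ((hs.const_mul (-(v i))).fun_add (hc.const_mul (v j))).congr_deriv (by simp)
  · exact (hasDerivAt_const (0 : ℝ) (v k)).congr_deriv (by simp)

lemma hasRotDeriv_polyEval {i j : Fin N} (hij : i ≠ j) (p : MvPolynomial (Fin N) ℝ) :
    HasRotDeriv i j (polyEval p) (polyEval (rotDeriv i j p)) := by
  intro v _
  induction p using MvPolynomial.induction_on with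
  | C a =>
    rw [← algebraMap_eq, Derivation.map_algebraMap]
    simpa [algebraMap_eq] using hasDerivAt_const (0 : ℝ) a
  | add p q hp hq =>
    simp only [polyEval_add, map_add]
    exact hp.fun_add hq
  | mul_X p n hp =>
    have h := hp.fun_mul (hasDerivAt_kacRotation hij n v)
    simp only [kacRotation_zero] at h
    simp only [polyEval_mul, polyEval_X, Derivation.leibniz, smul_eq_mul, polyEval_add]
    exact h.congr_deriv (by ring)

end PolynomialSymmetry

/-! ### The heat flow on polynomials -/

section HeatFlow
open MvPolynomial
variable {N : ℕ}

/-- The eigenvalues of minus the spherical Laplacian. -/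
def sphereEigenvalue (N l : ℕ) : ℝ := l * (l + N - 2)

@[simp] lemma sphereEigenvalue_zero (N : ℕ) : sphereEigenvalue N 0 = 0 := by
  simp [sphereEigenvalue]

lemma sphereEigenvalue_lt (hN : 2 ≤ N) {l d : ℕ} (h : l < d) :
    sphereEigenvalue N l < sphereEigenvalue N d := by
  have h1 : (l : ℝ) + 1 ≤ d := by exact_mod_cast h
  have h2 : (2 : ℝ) ≤ N := by exact_mod_cast hN
  have h3 : (0 : ℝ) ≤ l := by positivity
  unfold sphereEigenvalue
  nlinarith

/-- `p` is a sum of eigenvectors of the spherical Laplacian with indices below `n`, the first of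
which is constant on the sphere. -/
def HasEigenDecomp (n : ℕ) (p : MvPolynomial (Fin N) ℝ) : Prop :=
  ∃ c : ℕ → MvPolynomial (Fin N) ℝ,
    (∀ l, sphereLaplacian N (c l) = -(sphereEigenvalue N l) • c l) ∧
    (∃ κ : ℝ, ∀ v ∈ kacSphere N, polyEval (c 0) v = κ) ∧
    p = ∑ l ∈ Finset.range n, c l

lemma HasEigenDecomp.mono {n m : ℕ} (h : n ≤ m) {p : MvPolynomial (Fin N) ℝ}
    (hp : HasEigenDecomp n p) : HasEigenDecomp m p := by
  obtain ⟨c, h1, ⟨κ, h2⟩, h3⟩ := hp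
  refine ⟨fun l => if l < n then c l else 0, fun l => ?_, ?_, ?_⟩
  · dsimp only
    split_ifs
    · exact h1 l
    · simp
  · by_cases hn : 0 < n
    · exact ⟨κ, fun v hv => by simp [hn, h2 v hv]⟩
    · exact ⟨0, fun v hv => by simp [hn]⟩
  · rw [h3, ← Finset.sum_filter]
    congr 1
    ext l
    simp only [Finset.mem_range, Finset.mem_filter]
    omega

lemma HasEigenDecomp.add {n : ℕ} {p q : MvPolynomial (Fin N) ℝ}
    (hp : HasEigenDecomp n p) (hq : HasEigenDecomp n q) : HasEigenDecomp n (p + q) := by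
  obtain ⟨c, h1, ⟨κ, h2⟩, h3⟩ := hp
  obtain ⟨c', h1', ⟨κ', h2'⟩, h3'⟩ := hq
  refine ⟨fun l => c l + c' l, fun l => ?_, ⟨κ + κ', fun v hv => ?_⟩, ?_⟩
  · rw [map_add, h1, h1', smul_add]
  · rw [polyEval_add, h2 v hv, h2' v hv]
  · rw [Finset.sum_add_distrib, h3, h3']

lemma hasEigenDecomp_zero (n : ℕ) : HasEigenDecomp n (0 : MvPolynomial (Fin N) ℝ) :=
  ⟨fun _ => 0, by simp, ⟨0, by simp⟩, by simp⟩

lemma sphereLaplacian_normSqPoly_mul (p : MvPolynomial (Fin N) ℝ) :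
    sphereLaplacian N (normSqPoly N * p) = normSqPoly N * sphereLaplacian N p := by
  simp only [sphereLaplacian_apply, Derivation.leibniz, rotDeriv_normSqPoly, smul_eq_mul, mul_zero,
    add_zero, Finset.mul_sum]

lemma polyEval_normSqPoly {v : KacSpace N} (hv : v ∈ kacSphere N) :
    polyEval (normSqPoly N) v = N := by
  simp only [normSqPoly, polyEval_sum, polyEval_pow, polyEval_X]
  exact mem_kacSphere_iff.mp hv

lemma HasEigenDecomp.normSqPoly_mul {n : ℕ} {p : MvPolynomial (Fin N) ℝ}
    (hp : HasEigenDecomp n p) : HasEigenDecomp n (normSqPoly N * p) := by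
  obtain ⟨c, h1, ⟨κ, h2⟩, h3⟩ := hp
  refine ⟨fun l => normSqPoly N * c l, fun l => ?_, ⟨N * κ, fun v hv => ?_⟩, ?_⟩
  · rw [sphereLaplacian_normSqPoly_mul, h1, mul_smul_comm]
  · rw [polyEval_mul, h2 v hv, polyEval_normSqPoly hv]
  · rw [h3, Finset.mul_sum]

lemma eulerDeriv_of_isHomogeneous {d : ℕ} {p : MvPolynomial (Fin N) ℝ} (hp : p.IsHomogeneous d) :
    eulerDeriv N p = (d : ℝ) • p := by
  rw [eulerDeriv_apply, hp.sum_X_mul_pderiv, Nat.cast_smul_eq_nsmul]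

lemma isHomogeneous_polyLaplacian {d : ℕ} {p : MvPolynomial (Fin N) ℝ} (hp : p.IsHomogeneous d) :
    (polyLaplacian p).IsHomogeneous (d - 2) := by
  refine IsHomogeneous.sum _ _ _ fun k _ => ?_
  have := (hp.pderiv (i := k)).pderiv (i := k)
  rwa [Nat.sub_sub] at this

/-- Homogeneous polynomials of degree `d` are sums of eigenvectors with indices at most `d`: for
such `p` the polynomial `T p + λ_d p` is `|x|²` times one of degree `d - 2`. -/
lemma hasEigenDecomp_of_isHomogeneous (hN : 2 ≤ N) (d : ℕ) :
    ∀ p : MvPolynomial (Fin N) ℝ, p.IsHomogeneous d → HasEigenDecomp (d + 1) p := by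
  induction d using Nat.strong_induction_on with
  | _ d ih =>
    intro p hp
    rcases Nat.eq_zero_or_pos d with rfl | hd
    · obtain ⟨a, rfl⟩ : ∃ a, p = C a := ⟨_, totalDegree_eq_zero_iff_eq_C.mp (by
        exact Nat.le_zero.mp hp.totalDegree_le)⟩
      refine ⟨fun l => if l = 0 then C a else 0, fun l => ?_, ⟨a, by simp⟩, by simp⟩
      dsimp only
      split_ifs with h
      · subst h
        simp [sphereLaplacian_apply, ← algebraMap_eq]
      · simp
    have hT : sphereLaplacian N p = normSqPoly N * polyLaplacian p - sphereEigenvalue N d • p := by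
      rw [sphereLaplacian_eq, eulerDeriv_of_isHomogeneous hp, Derivation.map_smul,
        eulerDeriv_of_isHomogeneous hp, smul_smul, smul_smul, sub_sub, ← add_smul]
      congr 2
      unfold sphereEigenvalue
      ring
    have hq : HasEigenDecomp d (normSqPoly N * polyLaplacian p) := by
      rcases Nat.lt_or_ge d 2 with h2 | h2
      · have : polyLaplacian p = 0 := by
          refine Finset.sum_eq_zero fun k _ => ?_
          have hk : (pderiv k p).totalDegree = 0 := by
            have := (hp.pderiv (i := k)).totalDegree_le
            omega
          rw [totalDegree_eq_zero_iff_eq_C.mp hk, pderiv_C]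
        rw [this, mul_zero]
        exact hasEigenDecomp_zero d
      · exact ((ih (d - 2) (by omega) _ (isHomogeneous_polyLaplacian hp)).mono
          (by omega)).normSqPoly_mul
    obtain ⟨c, h1, ⟨κ, h2⟩, h3⟩ := hq
    have hne : ∀ l < d, sphereEigenvalue N d - sphereEigenvalue N l ≠ 0 := fun l hl =>
      (sub_pos.mpr (sphereEigenvalue_lt hN hl)).ne'
    let b : ℕ → MvPolynomial (Fin N) ℝ := fun l =>
      (sphereEigenvalue N d - sphereEigenvalue N l)⁻¹ • c l
    have hb : ∀ l, sphereLaplacian N (b l) = -(sphereEigenvalue N l) • b l := fun l => by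
      simp only [b]
      rw [map_smul, h1, smul_comm]
    refine ⟨fun l => if l < d then b l else if l = d then p - ∑ l ∈ Finset.range d, b l else 0,
      fun l => ?_, ⟨(sphereEigenvalue N d - sphereEigenvalue N 0)⁻¹ * κ, fun v hv => ?_⟩, ?_⟩
    · dsimp only
      split_ifs with hl hl'
      · exact hb l
      · subst hl'
        have hc : ∑ j ∈ Finset.range l, c j
            = sphereEigenvalue N l • ∑ j ∈ Finset.range l, b j
              + ∑ j ∈ Finset.range l, -(sphereEigenvalue N j) • b j := by
          rw [Finset.smul_sum, ← Finset.sum_add_distrib]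
          refine Finset.sum_congr rfl fun j hj => ?_
          rw [← add_smul, ← sub_eq_add_neg, smul_inv_smul₀ (hne j (Finset.mem_range.mp hj))]
        rw [map_sub, map_sum, hT, h3, hc, Finset.sum_congr rfl fun j _ => hb j, smul_sub, neg_smul,
          neg_smul]
        abel
      · simp
    · simp only [hd, if_true, b, polyEval_smul, h2 v hv]
    · rw [Finset.sum_range_succ]
      simp only [lt_irrefl, if_false, if_true]
      rw [Finset.sum_congr rfl fun l hl => if_pos (Finset.mem_range.mp hl)]
      abel

lemma exists_hasEigenDecomp (hN : 2 ≤ N) (p : MvPolynomial (Fin N) ℝ) :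
    ∃ n, HasEigenDecomp n p := by
  refine ⟨p.totalDegree + 1, ?_⟩
  rw [← sum_homogeneousComponent p]
  have : ∀ s : Finset ℕ, s ⊆ Finset.range (p.totalDegree + 1) →
      HasEigenDecomp (p.totalDegree + 1) (∑ i ∈ s, homogeneousComponent i p) := by
    intro s
    induction s using Finset.induction_on with
    | empty => intro _; simpa using hasEigenDecomp_zero _
    | insert a s ha ih =>
      intro hs
      rw [Finset.sum_insert ha]
      refine HasEigenDecomp.add ?_ (ih fun x hx => hs (Finset.mem_insert_of_mem hx))
      have := Finset.mem_range.mp (hs (Finset.mem_insert_self a s))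
      exact (hasEigenDecomp_of_isHomogeneous hN a _
        (homogeneousComponent_isHomogeneous a p)).mono (by omega)
  rw [sum_homogeneousComponent]
  have h := this _ subset_rfl
  rwa [sum_homogeneousComponent] at h

/-- A finite sum of eigenvectors evolving under the heat flow of the spherical Laplacian. -/
def IsHeatFlow (u : ℝ → MvPolynomial (Fin N) ℝ) : Prop :=
  ∃ (n : ℕ) (c : ℕ → MvPolynomial (Fin N) ℝ),
    (∀ l, sphereLaplacian N (c l) = -(sphereEigenvalue N l) • c l) ∧
    ∀ t, u t = ∑ l ∈ Finset.range n, Real.exp (-sphereEigenvalue N l * t) • c l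

lemma IsHeatFlow.map {u : ℝ → MvPolynomial (Fin N) ℝ} (hu : IsHeatFlow u)
    (D : MvPolynomial (Fin N) ℝ →ₗ[ℝ] MvPolynomial (Fin N) ℝ)
    (hD : ∀ p, D (sphereLaplacian N p) = sphereLaplacian N (D p)) :
    IsHeatFlow fun t => D (u t) := by
  obtain ⟨n, c, h1, h2⟩ := hu
  refine ⟨n, fun l => D (c l), fun l => ?_, fun t => ?_⟩
  · rw [← hD, h1, map_smul]
  · simp only [h2, map_sum, map_smul]

lemma IsHeatFlow.rotDeriv {u : ℝ → MvPolynomial (Fin N) ℝ} (hu : IsHeatFlow u) (i j : Fin N) :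
    IsHeatFlow fun t => _root_.rotDeriv i j (u t) :=
  hu.map (_root_.rotDeriv i j).toLinearMap (rotDeriv_sphereLaplacian i j)

lemma IsHeatFlow.isomSubst {u : ℝ → MvPolynomial (Fin N) ℝ} (hu : IsHeatFlow u)
    (e : KacSpace N ≃ₗᵢ[ℝ] KacSpace N) : IsHeatFlow fun t => _root_.isomSubst e (u t) :=
  hu.map (_root_.isomSubst e).toLinearMap fun p => (sphereLaplacian_isomSubst e p).symm

lemma IsHeatFlow.continuous_map {u : ℝ → MvPolynomial (Fin N) ℝ} (hu : IsHeatFlow u)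
    (D : MvPolynomial (Fin N) ℝ →ₗ[ℝ] MvPolynomial (Fin N) ℝ) :
    Continuous fun p : ℝ × KacSpace N => polyEval (D (u p.1)) p.2 := by
  obtain ⟨n, c, h1, h2⟩ := hu
  simp only [h2, map_sum, map_smul, polyEval_sum, polyEval_smul]
  have := fun l => continuous_polyEval (D (c l))
  fun_prop

lemma IsHeatFlow.continuous {u : ℝ → MvPolynomial (Fin N) ℝ} (hu : IsHeatFlow u) :
    Continuous fun p : ℝ × KacSpace N => polyEval (u p.1) p.2 :=
  hu.continuous_map LinearMap.id

lemma IsHeatFlow.hasDerivAt {u : ℝ → MvPolynomial (Fin N) ℝ} (hu : IsHeatFlow u) (v : KacSpace N)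
    (t : ℝ) : HasDerivAt (fun t => polyEval (u t) v) (polyEval (sphereLaplacian N (u t)) v) t := by
  obtain ⟨n, c, h1, h2⟩ := hu
  simp only [h2, map_sum, map_smul, polyEval_sum, polyEval_smul, h1]
  refine HasDerivAt.fun_sum fun l _ => ?_
  have := (((hasDerivAt_id t).const_mul (-sphereEigenvalue N l)).exp).mul_const (polyEval (c l) v)
  simp only [id] at this
  exact this.congr_deriv (by ring)

/-- Every polynomial is the initial value of a heat flow, which tends to a constant on the
sphere. -/
lemma exists_isHeatFlow (hN : 2 ≤ N) (p : MvPolynomial (Fin N) ℝ) :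
    ∃ u : ℝ → MvPolynomial (Fin N) ℝ, IsHeatFlow u ∧ u 0 = p ∧
      ∃ κ : ℝ, ∀ v ∈ kacSphere N, Filter.Tendsto (fun t => polyEval (u t) v) Filter.atTop (nhds κ) := by
  obtain ⟨n, hp⟩ := exists_hasEigenDecomp hN p
  obtain ⟨c, h1, ⟨κ, h2⟩, h3⟩ := hp.mono n.le_succ
  refine ⟨_, ⟨n + 1, c, h1, fun t => rfl⟩, by simpa using h3.symm, κ, fun v hv => ?_⟩
  simp only [polyEval_sum, polyEval_smul]
  rw [show κ = ∑ l ∈ Finset.range (n + 1), if l = 0 then κ else 0 by simp]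
  refine tendsto_finsetSum _ fun l _ => ?_
  split_ifs with hl
  · subst hl
    simp [h2 v hv]
  · have hpos : 0 < sphereEigenvalue N l := by
      simpa using sphereEigenvalue_lt hN (Nat.pos_of_ne_zero hl)
    have : Filter.Tendsto (fun t => Real.exp (-sphereEigenvalue N l * t)) Filter.atTop (nhds 0) :=
      Real.tendsto_exp_atBot.comp
        (Filter.tendsto_id.const_mul_atTop_of_neg (neg_lt_zero.mpr hpos))
    simpa using this.mul_const (polyEval (c l) v)

end HeatFlow

/-! ### The minimum principle -/

section MaximumPrinciple
open MvPolynomial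
variable {N : ℕ}

/-- The second derivative test along the orbit of a rotation group, at a minimum over the sphere. -/
lemma polyEval_rotDeriv_rotDeriv_nonneg {i j : Fin N} (hij : i ≠ j) (p : MvPolynomial (Fin N) ℝ)
    {v : KacSpace N} (hv : v ∈ kacSphere N)
    (hmin : ∀ w ∈ kacSphere N, polyEval p v ≤ polyEval p w) :
    0 ≤ polyEval (rotDeriv i j (rotDeriv i j p)) v := by
  by_contra! hneg
  let g : ℝ → ℝ := fun θ => polyEval p (kacRotation i j θ v)
  have hg0 : g 0 = polyEval p v := by simp [g, kacRotation_zero]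
  have hg1 : deriv g = fun θ => polyEval (rotDeriv i j p) (kacRotation i j θ v) :=
    funext fun θ => ((hasRotDeriv_polyEval hij p).hasDerivAt hij hv θ).deriv
  have hg2 : deriv (deriv g) 0 = polyEval (rotDeriv i j (rotDeriv i j p)) v := by
    rw [hg1, ((hasRotDeriv_polyEval hij (rotDeriv i j p)).hasDerivAt hij hv 0).deriv,
      kacRotation_zero]
  have hge : ∀ θ, g 0 ≤ g θ := fun θ => hg0 ▸ hmin _ (kacRotation_mem hij θ hv)
  have hloc : IsLocalMin g 0 := Filter.Eventually.of_forall hge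
  have hmax : IsLocalMin (-g) 0 := by
    refine isLocalMin_of_deriv_deriv_pos ?_ ?_ ?_
    · rw [deriv.neg', deriv.fun_neg, hg2]
      linarith
    · rw [deriv.neg, hloc.deriv_eq_zero, neg_zero]
    · exact ((hasRotDeriv_polyEval hij p).hasDerivAt hij hv 0).continuousAt.neg
  have hconst : g =ᶠ[nhds 0] fun _ => g 0 := by
    filter_upwards [hmax] with θ hθ
    have : g θ ≤ g 0 := by simpa using hθ
    exact le_antisymm this (hge θ)
  have := hconst.deriv.deriv_eq
  rw [hg2] at this
  simp at this
  linarith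

/-- The minimum principle for the heat flow. -/
lemma IsHeatFlow.le_of_le {u : ℝ → MvPolynomial (Fin N) ℝ} (hu : IsHeatFlow u) {m : ℝ}
    (hm : ∀ v ∈ kacSphere N, m ≤ polyEval (u 0) v) {b : ℝ} (hb : 0 ≤ b) {v : KacSpace N}
    (hv : v ∈ kacSphere N) : m ≤ polyEval (u b) v := by
  suffices h : ∀ ε > 0, m ≤ polyEval (u b) v + ε * b by
    refine le_of_forall_pos_le_add fun δ hδ => ?_
    refine (h (δ / (b + 1)) (by positivity)).trans ?_
    have : δ / (b + 1) * b ≤ δ := by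
      rw [div_mul_eq_mul_div, div_le_iff₀ (by positivity)]
      nlinarith
    linarith
  intro ε hε
  have hcont : Continuous fun p : ℝ × KacSpace N => polyEval (u p.1) p.2 + ε * p.1 := by
    have := hu.continuous
    fun_prop
  -- a minimum of `u + ε t` over the space-time cylinder can only be attained at time `0`
  obtain ⟨⟨t, w⟩, ⟨ht, hw⟩, hmin⟩ := ((isCompact_Icc (a := (0 : ℝ)) (b := b)).prod
    (isCompact_kacSphere N)).exists_isMinOn ⟨(b, v), Set.mk_mem_prod (Set.right_mem_Icc.mpr hb) hv⟩ hcont.continuousOn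
  have hmin' : ∀ s ∈ Set.Icc 0 b, ∀ x ∈ kacSphere N,
      polyEval (u t) w + ε * t ≤ polyEval (u s) x + ε * s := fun s hs x hx =>
    isMinOn_iff.mp hmin (s, x) (Set.mk_mem_prod hs hx)
  refine le_trans ?_ (hmin' b (Set.right_mem_Icc.mpr hb) v hv)
  rcases eq_or_lt_of_le ht.1 with h0 | h0
  · subst h0
    simpa using hm w hw
  exfalso
  have hT : 0 ≤ polyEval (sphereLaplacian N (u t)) w := by
    rw [sphereLaplacian_apply, polyEval_sum]
    refine Finset.sum_nonneg fun A hA =>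
      polyEval_rotDeriv_rotDeriv_nonneg (ne_of_mem_kacPairs hA) _ hw fun x hx => ?_
    have := hmin' t ht x hx
    linarith
  have hd : HasDerivAt (fun s => polyEval (u s) w + ε * s)
      (polyEval (sphereLaplacian N (u t)) w + ε * 1) t :=
    (hu.hasDerivAt w t).fun_add ((hasDerivAt_id t).const_mul ε)
  have hd' := hd.hasDerivWithinAt (s := Set.Iio t)
  have hle : polyEval (sphereLaplacian N (u t)) w + ε * 1 ≤ 0 := by
    rw [hasDerivWithinAt_iff_tendsto_slope' (by simp)] at hd'
    refine le_of_tendsto hd' ?_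
    filter_upwards [Ioo_mem_nhdsLT h0] with s hs
    rw [slope_def_field]
    refine div_nonpos_of_nonneg_of_nonpos ?_ (by linarith [hs.2])
    linarith [hmin' s ⟨hs.1.le, hs.2.le.trans ht.2⟩ w hw]
  linarith

end MaximumPrinciple

/-! ### Evolution of integral functionals of two heat flows -/

section TwoVariables
open MvPolynomial
variable {N : ℕ}

lemma HasRotDeriv.congr {i j : Fin N} {φ φ' χ : KacSpace N → ℝ} (h : HasRotDeriv i j φ φ')
    (e : ∀ v, φ' v = χ v) : HasRotDeriv i j φ χ :=
  fun v hv => (h v hv).congr_deriv (e v)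

lemma HasRotDeriv.add {i j : Fin N} {φ φ' χ χ' : KacSpace N → ℝ} (h1 : HasRotDeriv i j φ φ')
    (h2 : HasRotDeriv i j χ χ') :
    HasRotDeriv i j (fun v => φ v + χ v) (fun v => φ' v + χ' v) :=
  fun v hv => (h1 v hv).fun_add (h2 v hv)

lemma HasRotDeriv.sub {i j : Fin N} {φ φ' χ χ' : KacSpace N → ℝ} (h1 : HasRotDeriv i j φ φ')
    (h2 : HasRotDeriv i j χ χ') :
    HasRotDeriv i j (fun v => φ v - χ v) (fun v => φ' v - χ' v) :=
  fun v hv => (h1 v hv).fun_sub (h2 v hv)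

lemma HasRotDeriv.mul {i j : Fin N} {φ φ' χ χ' : KacSpace N → ℝ} (h1 : HasRotDeriv i j φ φ')
    (h2 : HasRotDeriv i j χ χ') :
    HasRotDeriv i j (fun v => φ v * χ v) (fun v => φ' v * χ v + φ v * χ' v) := by
  intro v hv
  have := (h1 v hv).fun_mul (h2 v hv)
  simpa only [kacRotation_zero] using this

/-- `Ψ` is continuous on `U` and satisfies the chain rule there, with partial derivatives `Ψx` and
`Ψy`. -/
structure HasPartials (U : Set (ℝ × ℝ)) (Ψ Ψx Ψy : ℝ → ℝ → ℝ) : Prop where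
  continuousOn : ContinuousOn (Function.uncurry Ψ) U
  chain : ∀ (f g : ℝ → ℝ) (f' g' s : ℝ), (f s, g s) ∈ U → HasDerivAt f f' s → HasDerivAt g g' s →
    HasDerivAt (fun s => Ψ (f s) (g s)) (Ψx (f s) (g s) * f' + Ψy (f s) (g s) * g') s

lemma HasPartials.hasRotDeriv {U : Set (ℝ × ℝ)} {Ψ Ψx Ψy : ℝ → ℝ → ℝ} (h : HasPartials U Ψ Ψx Ψy)
    {i j : Fin N} {φ φ' χ χ' : KacSpace N → ℝ} (h1 : HasRotDeriv i j φ φ')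
    (h2 : HasRotDeriv i j χ χ') (hU : ∀ v ∈ kacSphere N, (φ v, χ v) ∈ U) :
    HasRotDeriv i j (fun v => Ψ (φ v) (χ v))
      (fun v => Ψx (φ v) (χ v) * φ' v + Ψy (φ v) (χ v) * χ' v) := by
  intro v hv
  have := h.chain _ _ _ _ 0 (by simpa only [kacRotation_zero] using hU v hv) (h1 v hv) (h2 v hv)
  simpa only [kacRotation_zero] using this

lemma ContinuousOn.comp_pair {X : Type*} [TopologicalSpace X] {s : Set X} {U : Set (ℝ × ℝ)}
    {Ψ : ℝ → ℝ → ℝ} (h : ContinuousOn (Function.uncurry Ψ) U) {f g : X → ℝ}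
    (hf : ContinuousOn f s) (hg : ContinuousOn g s) (hU : ∀ x ∈ s, (f x, g x) ∈ U) :
    ContinuousOn (fun x => Ψ (f x) (g x)) s :=
  h.comp (hf.prodMk hg) hU

/-- The functions `Ψx, …, Ψyy` are the partial derivatives up to second order of `Ψ` on `U`. -/
structure HasPartials₂ (U : Set (ℝ × ℝ)) (Ψ Ψx Ψy Ψxx Ψxy Ψyy : ℝ → ℝ → ℝ) : Prop where
  zero : HasPartials U Ψ Ψx Ψy
  x : HasPartials U Ψx Ψxx Ψxy
  y : HasPartials U Ψy Ψxy Ψyy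
  cxx : ContinuousOn (Function.uncurry Ψxx) U
  cxy : ContinuousOn (Function.uncurry Ψxy) U
  cyy : ContinuousOn (Function.uncurry Ψyy) U

/-- The sum over the rotation fields of a quadratic form with coefficients `a, b, c` at the
derivatives of `p` and `q`. -/
def rotHessian (a b c : ℝ) (p q : MvPolynomial (Fin N) ℝ) (v : KacSpace N) : ℝ :=
  ∑ A ∈ kacPairs N, (a * polyEval (rotDeriv A.1 A.2 p) v ^ 2
    + 2 * b * polyEval (rotDeriv A.1 A.2 p) v * polyEval (rotDeriv A.1 A.2 q) v
    + c * polyEval (rotDeriv A.1 A.2 q) v ^ 2)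

variable {U : Set (ℝ × ℝ)} {Ψ Ψx Ψy Ψxx Ψxy Ψyy : ℝ → ℝ → ℝ}

/-- Integration by parts of the first variation of `∫ W Ψ(p, q)` in the direction of the spherical
Laplacian. -/
lemma integral_variation_eq [Fact (2 ≤ N)] (h : HasPartials₂ U Ψ Ψx Ψy Ψxx Ψxy Ψyy)
    (p q W : MvPolynomial (Fin N) ℝ)
    (hU : ∀ v ∈ kacSphere N, (polyEval p v, polyEval q v) ∈ U) :
    ∫ v, polyEval W v * (Ψx (polyEval p v) (polyEval q v) * polyEval (sphereLaplacian N p) v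
        + Ψy (polyEval p v) (polyEval q v) * polyEval (sphereLaplacian N q) v) ∂kacSigma N
      = ∫ v, polyEval (sphereLaplacian N W) v * Ψ (polyEval p v) (polyEval q v) ∂kacSigma N
      - ∫ v, polyEval W v * rotHessian (Ψxx (polyEval p v) (polyEval q v))
        (Ψxy (polyEval p v) (polyEval q v)) (Ψyy (polyEval p v) (polyEval q v)) p q v
          ∂kacSigma N := by
  have cp : ∀ p : MvPolynomial (Fin N) ℝ, ContinuousOn (polyEval p) (kacSphere N) :=
    fun p => (continuous_polyEval p).continuousOn
  have c0 := h.zero.continuousOn.comp_pair (cp p) (cp q) hU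
  have cx := h.x.continuousOn.comp_pair (cp p) (cp q) hU
  have cy := h.y.continuousOn.comp_pair (cp p) (cp q) hU
  have cxx := h.cxx.comp_pair (cp p) (cp q) hU
  have cxy := h.cxy.comp_pair (cp p) (cp q) hU
  have cyy := h.cyy.comp_pair (cp p) (cp q) hU
  let F : Fin N × Fin N → KacSpace N → ℝ := fun A v =>
    polyEval W v * ((Ψxx (polyEval p v) (polyEval q v) * polyEval (rotDeriv A.1 A.2 p) v ^ 2
      + 2 * Ψxy (polyEval p v) (polyEval q v) * polyEval (rotDeriv A.1 A.2 p) v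
          * polyEval (rotDeriv A.1 A.2 q) v
      + Ψyy (polyEval p v) (polyEval q v) * polyEval (rotDeriv A.1 A.2 q) v ^ 2)
      + (Ψx (polyEval p v) (polyEval q v) * polyEval (rotDeriv A.1 A.2 (rotDeriv A.1 A.2 p)) v
        + Ψy (polyEval p v) (polyEval q v) * polyEval (rotDeriv A.1 A.2 (rotDeriv A.1 A.2 q)) v))
      - polyEval (rotDeriv A.1 A.2 (rotDeriv A.1 A.2 W)) v * Ψ (polyEval p v) (polyEval q v)
  have hFc : ∀ A, ContinuousOn (F A) (kacSphere N) := by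
    intro A
    have h1 := cp W
    have h2 := cp (rotDeriv A.1 A.2 p)
    have h3 := cp (rotDeriv A.1 A.2 q)
    have h4 := cp (rotDeriv A.1 A.2 (rotDeriv A.1 A.2 p))
    have h5 := cp (rotDeriv A.1 A.2 (rotDeriv A.1 A.2 q))
    have h6 := cp (rotDeriv A.1 A.2 (rotDeriv A.1 A.2 W))
    exact (h1.mul ((((cxx.mul (h2.pow 2)).add (((continuousOn_const.mul cxy).mul h2).mul h3)).add
      (cyy.mul (h3.pow 2))).add ((cx.mul h4).add (cy.mul h5)))).sub (h6.mul c0)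
  have hF0 : ∀ A ∈ kacPairs N, ∫ v, F A v ∂kacSigma N = 0 := by
    intro A hA
    have hij := ne_of_mem_kacPairs hA
    have d := fun p : MvPolynomial (Fin N) ℝ => hasRotDeriv_polyEval hij p
    have key := ((d W).mul (((h.x.hasRotDeriv (d p) (d q) hU).mul (d (rotDeriv A.1 A.2 p))).add
      ((h.y.hasRotDeriv (d p) (d q) hU).mul (d (rotDeriv A.1 A.2 q))))).sub
      ((d (rotDeriv A.1 A.2 W)).mul (h.zero.hasRotDeriv (d p) (d q) hU))
    refine (key.congr fun v => ?_).integral_eq_zero hij (hFc A)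
    simp only [F]
    ring
  have hsum : ∫ v, ∑ A ∈ kacPairs N, F A v ∂kacSigma N = 0 := by
    rw [integral_finsetSum _ fun A _ => integrable_of_continuousOn_kacSphere (hFc A)]
    exact Finset.sum_eq_zero hF0
  have i1 : Integrable (fun v => polyEval (sphereLaplacian N W) v
      * Ψ (polyEval p v) (polyEval q v)) (kacSigma N) :=
    integrable_of_continuousOn_kacSphere ((cp _).mul c0)
  have i2 : Integrable (fun v => polyEval W v * rotHessian (Ψxx (polyEval p v) (polyEval q v))
        (Ψxy (polyEval p v) (polyEval q v)) (Ψyy (polyEval p v) (polyEval q v)) p q v)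
      (kacSigma N) := by
    refine integrable_of_continuousOn_kacSphere ((cp W).mul ?_)
    unfold rotHessian
    refine continuousOn_finsetSum _ fun A _ => ?_
    have h2 := cp (rotDeriv A.1 A.2 p)
    have h3 := cp (rotDeriv A.1 A.2 q)
    exact ((cxx.mul (h2.pow 2)).add (((continuousOn_const.mul cxy).mul h2).mul h3)).add
      (cyy.mul (h3.pow 2))
  have i3 : Integrable (fun v => ∑ A ∈ kacPairs N, F A v) (kacSigma N) :=
    integrable_finsetSum _ fun A _ => integrable_of_continuousOn_kacSphere (hFc A)
  rw [← integral_sub i1 i2, ← add_zero (∫ v, _ - _ ∂kacSigma N), ← hsum]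
  refine Eq.trans ?_ (integral_add (i1.sub i2) i3)
  refine integral_congr_ae (Filter.Eventually.of_forall fun v => ?_)
  simp only [F, rotHessian, sphereLaplacian_apply, polyEval_sum, Finset.sum_sub_distrib,
    ← Finset.mul_sum, Finset.sum_add_distrib, ← Finset.sum_mul]
  ring

/-- The fundamental theorem of calculus for integrals over the sphere. -/
lemma integral_sub_integral_eq [Fact (2 ≤ N)] {G G' : ℝ → KacSpace N → ℝ} {a b : ℝ} (hab : a ≤ b)
    (hG : ∀ t ∈ Set.Icc a b, ∀ v ∈ kacSphere N, HasDerivAt (fun t => G t v) (G' t v) t)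
    (hG' : ContinuousOn (Function.uncurry G') (Set.Icc a b ×ˢ kacSphere N))
    (ha : ContinuousOn (G a) (kacSphere N)) (hb : ContinuousOn (G b) (kacSphere N)) :
    ∫ v, G b v ∂kacSigma N - ∫ v, G a v ∂kacSigma N
      = ∫ t in a..b, ∫ v, G' t v ∂kacSigma N := by
  have hFTC : ∀ v ∈ kacSphere N, G b v - G a v = ∫ t in a..b, G' t v := by
    intro v hv
    rw [intervalIntegral.integral_eq_sub_of_hasDerivAt]
    · intro t ht
      rw [Set.uIcc_of_le hab] at ht
      exact hG t ht v hv
    · refine ContinuousOn.intervalIntegrable ?_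
      rw [Set.uIcc_of_le hab]
      exact hG'.comp (by fun_prop : ContinuousOn (fun t => (t, v)) _)
        fun t ht => Set.mk_mem_prod ht hv
  rw [← integral_sub (integrable_of_continuousOn_kacSphere hb)
    (integrable_of_continuousOn_kacSphere ha), integral_congr_kacSphere hFTC,
    intervalIntegral_integral_swap hab hG']

/-- The evolution of `∫ W_t Ψ(u_t, q_t)` for two heat flows and a weight affine in time. -/
lemma integral_evolution_eq [Fact (2 ≤ N)] (h : HasPartials₂ U Ψ Ψx Ψy Ψxx Ψxy Ψyy)
    {u q : ℝ → MvPolynomial (Fin N) ℝ} (hu : IsHeatFlow u) (hq : IsHeatFlow q)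
    (W₀ W₁ : MvPolynomial (Fin N) ℝ) {a b : ℝ} (hab : a ≤ b)
    (hU : ∀ t ∈ Set.Icc a b, ∀ v ∈ kacSphere N, (polyEval (u t) v, polyEval (q t) v) ∈ U) :
    ∫ v, polyEval (W₀ + b • W₁) v * Ψ (polyEval (u b) v) (polyEval (q b) v) ∂kacSigma N
      - ∫ v, polyEval (W₀ + a • W₁) v * Ψ (polyEval (u a) v) (polyEval (q a) v) ∂kacSigma N
    = ∫ t in a..b, (∫ v, polyEval (W₁ + sphereLaplacian N (W₀ + t • W₁)) v
          * Ψ (polyEval (u t) v) (polyEval (q t) v) ∂kacSigma N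
        - ∫ v, polyEval (W₀ + t • W₁) v * rotHessian (Ψxx (polyEval (u t) v) (polyEval (q t) v))
        (Ψxy (polyEval (u t) v) (polyEval (q t) v)) (Ψyy (polyEval (u t) v) (polyEval (q t) v))
          (u t) (q t) v ∂kacSigma N) := by
  have cp : ∀ p : MvPolynomial (Fin N) ℝ, ContinuousOn (polyEval p) (kacSphere N) :=
    fun p => (continuous_polyEval p).continuousOn
  let G : ℝ → KacSpace N → ℝ := fun t v => polyEval (W₀ + t • W₁) v *
    Ψ (polyEval (u t) v) (polyEval (q t) v)
  let G' : ℝ → KacSpace N → ℝ := fun t v =>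
    polyEval W₁ v * Ψ (polyEval (u t) v) (polyEval (q t) v) +
    polyEval (W₀ + t • W₁) v * (Ψx (polyEval (u t) v) (polyEval (q t) v) *
      polyEval (sphereLaplacian N (u t)) v
        + Ψy (polyEval (u t) v) (polyEval (q t) v) * polyEval (sphereLaplacian N (q t)) v)
  have hG : ∀ t ∈ Set.Icc a b, ∀ v ∈ kacSphere N, HasDerivAt (fun t => G t v) (G' t v) t := by
    intro t ht v hv
    have hW : HasDerivAt (fun t => polyEval (W₀ + t • W₁) v) (polyEval W₁ v) t := by
      simp only [polyEval_add, polyEval_smul]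
      exact (((hasDerivAt_id t).mul_const _).const_add _).congr_deriv (by simp)
    exact hW.fun_mul (h.zero.chain _ _ _ _ t (hU t ht v hv) (hu.hasDerivAt v t) (hq.hasDerivAt v t))
  have hU' : ∀ x ∈ Set.Icc a b ×ˢ kacSphere N,
      (polyEval (u x.1) x.2, polyEval (q x.1) x.2) ∈ U := fun x hx => hU x.1 hx.1 x.2 hx.2
  have ku := hu.continuous.continuousOn (s := Set.Icc a b ×ˢ kacSphere N)
  have kq := hq.continuous.continuousOn (s := Set.Icc a b ×ˢ kacSphere N)
  have kTu := (hu.continuous_map (sphereLaplacian N)).continuousOn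
    (s := Set.Icc a b ×ˢ kacSphere N)
  have kTq := (hq.continuous_map (sphereLaplacian N)).continuousOn
    (s := Set.Icc a b ×ˢ kacSphere N)
  have k0 := h.zero.continuousOn.comp_pair ku kq hU'
  have kx := h.x.continuousOn.comp_pair ku kq hU'
  have ky := h.y.continuousOn.comp_pair ku kq hU'
  have hG'c : ContinuousOn (Function.uncurry G') (Set.Icc a b ×ˢ kacSphere N) := by
    have hW₁ : ContinuousOn (fun x : ℝ × KacSpace N => polyEval W₁ x.2)
        (Set.Icc a b ×ˢ kacSphere N) := by fun_prop
    have hW : ContinuousOn (fun x : ℝ × KacSpace N => polyEval (W₀ + x.1 • W₁) x.2)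
        (Set.Icc a b ×ˢ kacSphere N) := by
      simp only [polyEval_add, polyEval_smul]
      fun_prop
    exact (hW₁.mul k0).add (hW.mul ((kx.mul kTu).add (ky.mul kTq)))
  have hslice : ∀ t ∈ Set.Icc a b, ContinuousOn (G t) (kacSphere N) := fun t ht =>
    (cp _).mul (h.zero.continuousOn.comp_pair (cp _) (cp _) (hU t ht))
  refine (integral_sub_integral_eq hab hG hG'c (hslice a (Set.left_mem_Icc.mpr hab))
    (hslice b (Set.right_mem_Icc.mpr hab))).trans ?_
  refine intervalIntegral.integral_congr fun t ht => ?_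
  rw [Set.uIcc_of_le hab] at ht
  have c0 := h.zero.continuousOn.comp_pair (cp _) (cp _) (hU t ht)
  have cx := h.x.continuousOn.comp_pair (cp _) (cp _) (hU t ht)
  have cy := h.y.continuousOn.comp_pair (cp _) (cp _) (hU t ht)
  have hv := integral_variation_eq h (u t) (q t) (W₀ + t • W₁) (hU t ht)
  simp only [G', polyEval_add W₁ (sphereLaplacian N _), add_mul]
  have e1 := integral_add (integrable_of_continuousOn_kacSphere ((cp W₁).mul c0))
    (integrable_of_continuousOn_kacSphere ((cp (W₀ + t • W₁)).mul
      ((cx.mul (cp (sphereLaplacian N (u t)))).add (cy.mul (cp (sphereLaplacian N (q t)))))))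
  have e2 := integral_add (integrable_of_continuousOn_kacSphere ((cp W₁).mul c0))
    (integrable_of_continuousOn_kacSphere ((cp (sphereLaplacian N (W₀ + t • W₁))).mul c0))
  refine e1.trans (Eq.trans ?_ (congrArg (· - _) e2.symm))
  exact (congrArg (_ + ·) hv).trans (add_sub_assoc _ _ _).symm

end TwoVariables

/-! ### The curvature bound -/

section Curvature
open MvPolynomial
open scoped Matrix
variable {N : ℕ}

/-- The Lagrange identity. -/
lemma sum_wedge_mul_wedge (a b c d : Fin N → ℝ) :
    ∑ k, ∑ l, (a l * b k - a k * b l) * (c l * d k - c k * d l)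
      = 2 * ((a ⬝ᵥ c) * (b ⬝ᵥ d) - (a ⬝ᵥ d) * (b ⬝ᵥ c)) := by
  have e : ∀ k l, (a l * b k - a k * b l) * (c l * d k - c k * d l)
      = (b k * d k) * (a l * c l) - (b k * c k) * (a l * d l)
        - (a k * d k) * (b l * c l) + (a k * c k) * (b l * d l) := by
    intro k l; ring
  simp only [e, Finset.sum_add_distrib, Finset.sum_sub_distrib, ← Finset.mul_sum, ← Finset.sum_mul]
  simp only [dotProduct]
  ring

lemma sum_wedge_sq (a b : Fin N → ℝ) :
    ∑ k, ∑ l, (a l * b k - a k * b l) ^ 2 = 2 * ((a ⬝ᵥ a) * (b ⬝ᵥ b) - (a ⬝ᵥ b) ^ 2) := by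
  have := sum_wedge_mul_wedge a b a b
  simp only [← sq] at this
  rw [this, dotProduct_comm b a]
  ring

/-- The tangential part of a covector has at least the length of its component along the rotation
in the plane of `i` and `j`. -/
lemma wedge_sq_le {x : Fin N → ℝ} (hx : 0 < x ⬝ᵥ x) (p : Fin N → ℝ) {i j : Fin N} (hij : i ≠ j) :
    2 * (x ⬝ᵥ x) * (x j * p i - x i * p j) ^ 2
      ≤ (x i ^ 2 + x j ^ 2) * ∑ k, ∑ l, (x l * p k - x k * p l) ^ 2 := by
  set r := x ⬝ᵥ x with hr
  set s := x ⬝ᵥ p with hs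
  set z : Fin N → ℝ := fun k => r * p k - s * x k with hz
  have h1 : z ⬝ᵥ z = r * (r * (p ⬝ᵥ p) - s ^ 2) := by
    have : z = r • p - s • x := rfl
    rw [this]
    simp only [sub_dotProduct, dotProduct_sub, smul_dotProduct, dotProduct_smul, smul_eq_mul, ← hr,
      dotProduct_comm p x, ← hs]
    ring
  have h2 : z i ^ 2 + z j ^ 2 ≤ z ⬝ᵥ z := by
    have := Finset.sum_le_sum_of_subset_of_nonneg (Finset.subset_univ ({i, j} : Finset (Fin N)))
      (f := fun k => z k * z k) (fun k _ _ => mul_self_nonneg _)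
    rw [Finset.sum_pair hij] at this
    rw [sq, sq]
    exact this
  have h3 : (r * (x j * p i - x i * p j)) ^ 2 ≤ (x i ^ 2 + x j ^ 2) * (z i ^ 2 + z j ^ 2) := by
    have : r * (x j * p i - x i * p j) = x j * z i - x i * z j := by simp only [hz]; ring
    rw [this]
    nlinarith [sq_nonneg (x i * z i + x j * z j)]
  have h4 : (r * (x j * p i - x i * p j)) ^ 2
      ≤ (x i ^ 2 + x j ^ 2) * (r * (r * (p ⬝ᵥ p) - s ^ 2)) :=
    h3.trans (mul_le_mul_of_nonneg_left (h2.trans h1.le) (by positivity))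
  rw [sum_wedge_sq, ← hr, ← hs]
  have h5 : r * (r * (x j * p i - x i * p j) ^ 2)
      ≤ r * ((x i ^ 2 + x j ^ 2) * (r * (p ⬝ᵥ p) - s ^ 2)) := by
    linarith
  linarith [le_of_mul_le_mul_left h5 hx]

/-- The second derivatives along the rotation fields of a function with gradient `p` and Hessian `h`
at `x`. -/
def rotSecond (x p : Fin N → ℝ) (h : Fin N → Fin N → ℝ) (i j k l : Fin N) : ℝ :=
  x j * ((if i = l then 1 else 0) * p k - (if i = k then 1 else 0) * p l + x l * h i k - x k * h i l)
  - x i * ((if j = l then 1 else 0) * p k - (if j = k then 1 else 0) * p l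
    + x l * h j k - x k * h j l)

/-- The sum of squares of the second derivatives, in terms of scalar invariants of the gradient `p`
and the Hessian `h`. -/
lemma sum_rotSecond_sq (x p : Fin N → ℝ) (h : Fin N → Fin N → ℝ) (hh : ∀ i j, h i j = h j i) :
    ∑ k, ∑ l, ∑ i, ∑ j, rotSecond x p h i j k l ^ 2
      = 4 * ((x ⬝ᵥ x) * ((N - 1) * (p ⬝ᵥ p) + 2 * (p ⬝ᵥ fun i => h i ⬝ᵥ x)
          - 2 * (x ⬝ᵥ p) * (∑ i, h i i) + (x ⬝ᵥ x) * (∑ i, h i ⬝ᵥ h i)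
          - ((fun i => h i ⬝ᵥ x) ⬝ᵥ fun i => h i ⬝ᵥ x))
        - ((x ⬝ᵥ x) * ((p + fun i => h i ⬝ᵥ x) ⬝ᵥ (p + fun i => h i ⬝ᵥ x))
          - (x ⬝ᵥ (p + fun i => h i ⬝ᵥ x)) ^ 2)) := by
  set g : Fin N → ℝ := fun i => h i ⬝ᵥ x with hg
  let y : Fin N → Fin N → Fin N → ℝ := fun k l i =>
    (if i = l then 1 else 0) * p k - (if i = k then 1 else 0) * p l + x l * h i k - x k * h i l
  have h1 : ∀ k l, ∑ i, ∑ j, rotSecond x p h i j k l ^ 2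
      = 2 * ((x ⬝ᵥ x) * (y k l ⬝ᵥ y k l) - (x ⬝ᵥ y k l) ^ 2) := fun k l => by
    rw [← sum_wedge_sq]; rfl
  have h2 : ∀ k l, x ⬝ᵥ y k l = x l * (p + g) k - x k * (p + g) l := by
    intro k l
    have e : ∀ i, x i * y k l i = (if i = l then x i * p k else 0) - (if i = k then x i * p l else 0)
        + x l * (h k i * x i) - x k * (h l i * x i) := by
      intro i
      simp only [y]
      rw [hh k i, hh l i]
      split_ifs <;> ring
    simp only [dotProduct, e, Finset.sum_add_distrib, Finset.sum_sub_distrib, ← Finset.mul_sum,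
      Finset.sum_ite_eq', Finset.mem_univ, if_true, Pi.add_apply, hg]
    ring
  have h3 : ∑ k, ∑ l, y k l ⬝ᵥ y k l = 2 * ((N - 1) * (p ⬝ᵥ p) + 2 * (p ⬝ᵥ g)
          - 2 * (x ⬝ᵥ p) * (∑ i, h i i) + (x ⬝ᵥ x) * (∑ i, h i ⬝ᵥ h i) - g ⬝ᵥ g) := by
    have e : ∀ i, ∑ k, ∑ l, y k l i * y k l i
        = 2 * (p ⬝ᵥ p - p i * p i + 2 * (x i * (p ⬝ᵥ h i) - h i i * (x ⬝ᵥ p))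
          + ((x ⬝ᵥ x) * (h i ⬝ᵥ h i) - g i * g i)) := by
      intro i
      let ei : Fin N → ℝ := Pi.single i 1
      have e1 : ∀ k l, y k l i * y k l i
          = (ei l * p k - ei k * p l) * (ei l * p k - ei k * p l)
          + 2 * ((ei l * p k - ei k * p l) * (x l * h i k - x k * h i l))
          + (x l * h i k - x k * h i l) * (x l * h i k - x k * h i l) := by
        intro k l
        simp only [y, ei, Pi.single_apply, eq_comm (a := i)]
        ring
      simp only [e1, Finset.sum_add_distrib, ← Finset.mul_sum, sum_wedge_mul_wedge]
      simp only [ei, single_one_dotProduct, dotProduct_single_one, Pi.single_eq_same, hg,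
        dotProduct_comm x (h i), dotProduct_comm p x]
      ring
    simp only [dotProduct]
    rw [Finset.sum_congr rfl fun k _ => Finset.sum_comm, Finset.sum_comm]
    simp only [e]
    have e2 : ∑ i, x i * (p ⬝ᵥ h i) = p ⬝ᵥ g := by
      simp only [dotProduct, hg, Finset.mul_sum]
      rw [Finset.sum_comm]
      refine Finset.sum_congr rfl fun a _ => Finset.sum_congr rfl fun b _ => ?_
      rw [hh b a]; ring
    have e3 : ∀ i, p ⬝ᵥ p - p i * p i + 2 * (x i * (p ⬝ᵥ h i) - h i i * (x ⬝ᵥ p))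
          + ((x ⬝ᵥ x) * (h i ⬝ᵥ h i) - g i * g i) = p ⬝ᵥ p - p i * p i + 2 * (x i * (p ⬝ᵥ h i))
          - (2 * (x ⬝ᵥ p)) * h i i + (x ⬝ᵥ x) * (h i ⬝ᵥ h i) - g i * g i := fun i => by ring
    rw [← Finset.mul_sum]
    simp only [e3, Finset.sum_add_distrib, Finset.sum_sub_distrib, ← Finset.mul_sum, e2,
      Finset.sum_const, Finset.card_univ, Fintype.card_fin, nsmul_eq_mul]
    simp only [dotProduct]
    ring
  simp only [h1, h2, ← Finset.mul_sum, Finset.sum_sub_distrib, h3, sum_wedge_sq]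
  ring

/-- The curvature bound: in terms of the rotation fields, the Bochner formula and the Ricci
curvature of the sphere amount to an algebraic inequality, where the difference of the two sides is
the sum of the squares of the entries of `r PhP - s P`, for the projection `P` to the tangent space,
`r = |x|²` and `s = x · p`. -/
lemma curvature_bound {x : Fin N → ℝ} (hx : 0 < x ⬝ᵥ x) (p : Fin N → ℝ) (h : Fin N → Fin N → ℝ)
    (hh : ∀ i j, h i j = h j i) :
    2 * ((N : ℝ) - 2) * ∑ k, ∑ l, (x l * p k - x k * p l) ^ 2
      ≤ ∑ k, ∑ l, ∑ i, ∑ j, rotSecond x p h i j k l ^ 2 := by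
  rw [sum_rotSecond_sq x p h hh, sum_wedge_sq]
  set g : Fin N → ℝ := fun i => h i ⬝ᵥ x with hg
  set r := x ⬝ᵥ x with hr
  set s := x ⬝ᵥ p with hs
  set η := x ⬝ᵥ g with hη
  let c := (η + s) / r
  have hc : c * r = η + s := div_mul_cancel₀ _ hx.ne'
  let m : Fin N → Fin N → ℝ := fun i =>
    r • h i - x i • g + (c * x i - g i) • x - s • (Pi.single i 1 : Fin N → ℝ)
  have hm : ∀ i, m i ⬝ᵥ m i = r ^ 2 * (h i ⬝ᵥ h i) + (g ⬝ᵥ g) * (x i * x i)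
      + c ^ 2 * r * (x i * x i) - 2 * c * r * (x i * g i) + r * (g i * g i)
      + s ^ 2 - 2 * r * (x i * (h i ⬝ᵥ g)) + 2 * r * c * (x i * g i) - 2 * r * (g i * g i)
      - 2 * r * s * h i i - 2 * η * c * (x i * x i) + 2 * η * (x i * g i)
      + 2 * s * (x i * g i) - 2 * s * c * (x i * x i) + 2 * s * (x i * g i) := by
    intro i
    have e1 : h i ⬝ᵥ x = g i := rfl
    have e2 : x ⬝ᵥ h i = g i := dotProduct_comm _ _
    simp only [m, sub_dotProduct, add_dotProduct, dotProduct_sub, dotProduct_add, smul_dotProduct,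
      dotProduct_smul, smul_eq_mul, single_one_dotProduct, dotProduct_single_one,
      Pi.single_eq_same, Pi.sub_apply, Pi.add_apply, Pi.smul_apply, ← hr, dotProduct_comm g x, dotProduct_comm g (h i), ← hη, e1, e2]
    ring
  have e2 : ∑ i, x i * (h i ⬝ᵥ g) = g ⬝ᵥ g := by
    have e3 : ∀ i, x i * (h i ⬝ᵥ g) = ∑ j, g j * (h j i * x i) := fun i => by
      rw [dotProduct, Finset.mul_sum]
      exact Finset.sum_congr rfl fun j _ => by rw [hh i j]; ring
    rw [Finset.sum_congr rfl fun i _ => e3 i, Finset.sum_comm]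
    exact Finset.sum_congr rfl fun j _ => (Finset.mul_sum _ _ _).symm
  have hpos : 0 ≤ ∑ i, m i ⬝ᵥ m i :=
    Finset.sum_nonneg fun i _ => Finset.sum_nonneg fun j _ => mul_self_nonneg _
  simp only [hm, Finset.sum_add_distrib, Finset.sum_sub_distrib, ← Finset.mul_sum, e2,
    Finset.sum_const, Finset.card_univ, Fintype.card_fin, nsmul_eq_mul] at hpos
  have d1 : ∑ i, x i * x i = r := rfl
  have d2 : ∑ i, x i * g i = η := rfl
  have d3 : ∑ i, g i * g i = g ⬝ᵥ g := rfl
  rw [d1, d2, d3] at hpos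
  simp only [add_dotProduct, dotProduct_add, ← hs, ← hη, dotProduct_comm g p]
  have hc2 : c ^ 2 * r * r = (η + s) ^ 2 := by rw [← hc]; ring
  have hc3 : 2 * η * c * r = 2 * η * (η + s) := by rw [← hc]; ring
  have hc4 : 2 * s * c * r = 2 * s * (η + s) := by rw [← hc]; ring
  rw [hc2, hc3, hc4] at hpos
  linarith

end Curvature

/-! ### Entropy and Fisher information along the heat flow -/

section LogSobolev
open MvPolynomial
open scoped Matrix
variable {N : ℕ}

/-- The relative Fisher information `∑_{i<j} ∫ (L_ij f)² / f dσ` along the rotation fields. -/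
def fisherInfo (f : MvPolynomial (Fin N) ℝ) : ℝ :=
  ∫ v, ∑ A ∈ kacPairs N, polyEval (rotDeriv A.1 A.2 f) v ^ 2 / polyEval f v ∂kacSigma N

/-- The relative entropy of a polynomial density. -/
def polyEntropy (f : MvPolynomial (Fin N) ℝ) : ℝ :=
  ∫ v, polyEval f v * Real.log (polyEval f v) ∂kacSigma N

/-- `f` is positive on the sphere. -/
def PosOnSphere (f : MvPolynomial (Fin N) ℝ) : Prop := ∀ v ∈ kacSphere N, 0 < polyEval f v

lemma PosOnSphere.exists_le [Fact (2 ≤ N)] {f : MvPolynomial (Fin N) ℝ} (hf : PosOnSphere f) :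
    ∃ m > 0, ∀ v ∈ kacSphere N, m ≤ polyEval f v := by
  obtain ⟨w, hw, hmin⟩ := (isCompact_kacSphere N).exists_isMinOn kacSphere_nonempty
    (continuous_polyEval f).continuousOn
  exact ⟨_, hf w hw, fun v hv => isMinOn_iff.mp hmin v hv⟩

lemma IsHeatFlow.posOnSphere [Fact (2 ≤ N)] {u : ℝ → MvPolynomial (Fin N) ℝ} (hu : IsHeatFlow u)
    (h0 : PosOnSphere (u 0)) {t : ℝ} (ht : 0 ≤ t) : PosOnSphere (u t) := by
  obtain ⟨m, hm, h⟩ := h0.exists_le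
  exact fun v hv => hm.trans_le (hu.le_of_le h ht hv)

lemma continuousOn_comp_log {X : Type*} [TopologicalSpace X] {s : Set X} {f : X → ℝ}
    (hf : ContinuousOn f s) (h : ∀ x ∈ s, 0 < f x) :
    ContinuousOn (fun x => Real.log (f x)) s :=
  hf.log fun x hx => (h x hx).ne'

lemma hasPartials₂_mul_log : HasPartials₂ {z : ℝ × ℝ | 0 < z.1} (fun x _ => x * Real.log x)
    (fun x _ => Real.log x + 1) (fun _ _ => 0) (fun x _ => x⁻¹) (fun _ _ => 0) (fun _ _ => 0) := by
  have hl : ContinuousOn (fun z : ℝ × ℝ => Real.log z.1) {z : ℝ × ℝ | 0 < z.1} :=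
    continuousOn_fst.log fun z hz => (Set.mem_ofPred.mp hz).ne'
  refine ⟨⟨continuousOn_fst.mul hl, fun f g f' g' s hs hf hg => ?_⟩,
    ⟨hl.add continuousOn_const, fun f g f' g' s hs hf hg => ?_⟩,
    ⟨continuousOn_const, fun f g f' g' s hs hf hg => ?_⟩,
    continuousOn_fst.inv₀ fun z hz => (Set.mem_ofPred.mp hz).ne', continuousOn_const,
    continuousOn_const⟩
  · have hs' : f s ≠ 0 := (Set.mem_ofPred.mp hs).ne'
    exact (hf.fun_mul (hf.log hs')).congr_deriv (by field_simp; ring)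
  · have hs' : f s ≠ 0 := (Set.mem_ofPred.mp hs).ne'
    exact ((hf.log hs').add_const 1).congr_deriv (by field_simp; ring)
  · exact (hasDerivAt_const s (0 : ℝ)).congr_deriv (by ring)

lemma hasPartials₂_sq_div : HasPartials₂ {z : ℝ × ℝ | 0 < z.1} (fun x y => y ^ 2 / x)
    (fun x y => -(y ^ 2 / x ^ 2)) (fun x y => 2 * y / x) (fun x y => 2 * y ^ 2 / x ^ 3)
    (fun x y => -(2 * y / x ^ 2)) (fun x _ => 2 / x) := by
  have h0 : ∀ z ∈ {z : ℝ × ℝ | 0 < z.1}, z.1 ≠ 0 := fun z hz => (Set.mem_ofPred.mp hz).ne'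
  have c1 : ContinuousOn (fun z : ℝ × ℝ => z.1) {z : ℝ × ℝ | 0 < z.1} := continuousOn_fst
  have c2 : ContinuousOn (fun z : ℝ × ℝ => z.2) {z : ℝ × ℝ | 0 < z.1} := continuousOn_snd
  have hp : ∀ n : ℕ, ∀ z ∈ {z : ℝ × ℝ | 0 < z.1}, z.1 ^ n ≠ 0 := fun n z hz =>
    pow_ne_zero n (h0 z hz)
  refine ⟨⟨(c2.pow 2).div c1 h0, fun f g f' g' s hs hf hg => ?_⟩,
    ⟨((c2.pow 2).div (c1.pow 2) (hp 2)).neg, fun f g f' g' s hs hf hg => ?_⟩,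
    ⟨(continuousOn_const.mul c2).div c1 h0, fun f g f' g' s hs hf hg => ?_⟩,
    (continuousOn_const.mul (c2.pow 2)).div (c1.pow 3) (hp 3),
    ((continuousOn_const.mul c2).div (c1.pow 2) (hp 2)).neg,
    continuousOn_const.div c1 h0⟩
  · have hs' : f s ≠ 0 := (Set.mem_ofPred.mp hs).ne'
    exact ((hg.fun_pow 2).fun_div hf hs').congr_deriv (by field_simp; ring)
  · have hs' : f s ≠ 0 := (Set.mem_ofPred.mp hs).ne'
    exact ((hg.fun_pow 2).fun_div (hf.fun_pow 2) (pow_ne_zero 2 hs')).fun_neg.congr_deriv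
      (by field_simp; ring)
  · have hs' : f s ≠ 0 := (Set.mem_ofPred.mp hs).ne'
    exact ((hg.const_mul 2).fun_div hf hs').congr_deriv (by field_simp; ring)

lemma hasPartials₂_fst : HasPartials₂ Set.univ (fun x _ => x) (fun _ _ => 1) (fun _ _ => 0)
    (fun _ _ => 0) (fun _ _ => 0) (fun _ _ => 0) := by
  refine ⟨⟨continuousOn_fst, fun f g f' g' s hs hf hg => hf.congr_deriv (by ring)⟩,
    ⟨continuousOn_const, fun f g f' g' s hs hf hg =>
      (hasDerivAt_const s (1 : ℝ)).congr_deriv (by ring)⟩,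
    ⟨continuousOn_const, fun f g f' g' s hs hf hg =>
      (hasDerivAt_const s (0 : ℝ)).congr_deriv (by ring)⟩,
    continuousOn_const, continuousOn_const, continuousOn_const⟩

lemma sphereLaplacian_one : sphereLaplacian N (1 : MvPolynomial (Fin N) ℝ) = 0 := by
  simp [sphereLaplacian_apply]

section
variable {U : Set (ℝ × ℝ)} {Ψ Ψx Ψy Ψxx Ψxy Ψyy : ℝ → ℝ → ℝ}

lemma continuousOn_rotHessian (h : HasPartials₂ U Ψ Ψx Ψy Ψxx Ψxy Ψyy)
    {u q : ℝ → MvPolynomial (Fin N) ℝ} (hu : IsHeatFlow u) (hq : IsHeatFlow q) {s : Set ℝ}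
    (hU : ∀ t ∈ s, ∀ v ∈ kacSphere N, (polyEval (u t) v, polyEval (q t) v) ∈ U) :
    ContinuousOn (Function.uncurry fun t v => rotHessian (Ψxx (polyEval (u t) v) (polyEval (q t) v))
        (Ψxy (polyEval (u t) v) (polyEval (q t) v)) (Ψyy (polyEval (u t) v) (polyEval (q t) v))
          (u t) (q t) v) (s ×ˢ kacSphere N) := by
  have hU' : ∀ x ∈ s ×ˢ kacSphere N,
      (polyEval (u x.1) x.2, polyEval (q x.1) x.2) ∈ U := fun x hx => hU x.1 hx.1 x.2 hx.2
  have ku := hu.continuous.continuousOn (s := s ×ˢ kacSphere N)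
  have kq := hq.continuous.continuousOn (s := s ×ˢ kacSphere N)
  have cxx := h.cxx.comp_pair ku kq hU'
  have cxy := h.cxy.comp_pair ku kq hU'
  have cyy := h.cyy.comp_pair ku kq hU'
  unfold rotHessian
  refine continuousOn_finsetSum _ fun A _ => ?_
  have h2 := (hu.rotDeriv A.1 A.2).continuous.continuousOn (s := s ×ˢ kacSphere N)
  have h3 := (hq.rotDeriv A.1 A.2).continuous.continuousOn (s := s ×ˢ kacSphere N)
  exact ((cxx.mul (h2.pow 2)).add (((continuousOn_const.mul cxy).mul h2).mul h3)).add
      (cyy.mul (h3.pow 2))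

/-- The evolution of `∫ Ψ(u_t, q_t)`. -/
lemma integral_evolution_one [Fact (2 ≤ N)] (h : HasPartials₂ U Ψ Ψx Ψy Ψxx Ψxy Ψyy)
    {u q : ℝ → MvPolynomial (Fin N) ℝ} (hu : IsHeatFlow u) (hq : IsHeatFlow q) {a b : ℝ}
    (hab : a ≤ b)
    (hU : ∀ t ∈ Set.Icc a b, ∀ v ∈ kacSphere N, (polyEval (u t) v, polyEval (q t) v) ∈ U) :
    ∫ v, Ψ (polyEval (u b) v) (polyEval (q b) v) ∂kacSigma N
      - ∫ v, Ψ (polyEval (u a) v) (polyEval (q a) v) ∂kacSigma N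
    = -∫ t in a..b, ∫ v, rotHessian (Ψxx (polyEval (u t) v) (polyEval (q t) v))
        (Ψxy (polyEval (u t) v) (polyEval (q t) v)) (Ψyy (polyEval (u t) v) (polyEval (q t) v))
          (u t) (q t) v ∂kacSigma N := by
  have := integral_evolution_eq h hu hq 1 0 hab hU
  simpa only [smul_zero, add_zero, polyEval_one, one_mul, sphereLaplacian_one, polyEval_zero,
    zero_mul, integral_zero, zero_sub, intervalIntegral.integral_neg] using this

end

lemma continuousOn_fisher [Fact (2 ≤ N)] {u : ℝ → MvPolynomial (Fin N) ℝ} (hu : IsHeatFlow u)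
    {s : Set ℝ} (hpos : ∀ t ∈ s, PosOnSphere (u t)) :
    ContinuousOn (Function.uncurry fun t v => ∑ A ∈ kacPairs N,
      polyEval (rotDeriv A.1 A.2 (u t)) v ^ 2 / polyEval (u t) v) (s ×ˢ kacSphere N) := by
  refine continuousOn_finsetSum _ fun A _ => ?_
  exact ((hu.rotDeriv A.1 A.2).continuous.continuousOn.pow 2).div hu.continuous.continuousOn
    fun x hx => (hpos x.1 hx.1 x.2 hx.2).ne'

lemma continuousOn_fisherInfo [Fact (2 ≤ N)] {u : ℝ → MvPolynomial (Fin N) ℝ} (hu : IsHeatFlow u)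
    {a b : ℝ} (hpos : ∀ t ∈ Set.Icc a b, PosOnSphere (u t)) :
    ContinuousOn (fun t => fisherInfo (u t)) (Set.Icc a b) :=
  continuousOn_integral_kacSigma isCompact_Icc (continuousOn_fisher hu hpos)

lemma fisherInfo_nonneg {f : MvPolynomial (Fin N) ℝ} (hf : PosOnSphere f) : 0 ≤ fisherInfo f :=
  integral_nonneg_of_ae ((ae_mem_kacSphere N).mono fun v hv =>
    Finset.sum_nonneg fun _ _ => div_nonneg (sq_nonneg _) (hf v hv).le)

/-- The entropy dissipation identity. -/
lemma polyEntropy_sub_eq [Fact (2 ≤ N)] {u : ℝ → MvPolynomial (Fin N) ℝ} (hu : IsHeatFlow u)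
    {a b : ℝ} (hab : a ≤ b) (hpos : ∀ t ∈ Set.Icc a b, PosOnSphere (u t)) :
    polyEntropy (u a) - polyEntropy (u b) = ∫ t in a..b, fisherInfo (u t) := by
  have := integral_evolution_one hasPartials₂_mul_log hu hu hab hpos
  rw [← neg_sub, polyEntropy, polyEntropy, this, neg_neg]
  refine intervalIntegral.integral_congr fun t _ => ?_
  refine integral_congr_ae (Filter.Eventually.of_forall fun v => ?_)
  refine Finset.sum_congr rfl fun A _ => ?_
  ring

/-- Conservation of mass. -/
lemma integral_polyEval_eq [Fact (2 ≤ N)] {u : ℝ → MvPolynomial (Fin N) ℝ} (hu : IsHeatFlow u)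
    {a b : ℝ} (hab : a ≤ b) :
    ∫ v, polyEval (u b) v ∂kacSigma N = ∫ v, polyEval (u a) v ∂kacSigma N := by
  have := integral_evolution_one hasPartials₂_fst hu hu hab (fun _ _ _ _ => trivial)
  simp only [rotHessian, zero_mul, mul_zero, add_zero, Finset.sum_const_zero, integral_zero,
    intervalIntegral.integral_zero, neg_zero] at this
  linarith

lemma sum_kacPairs_real {f : Fin N → Fin N → ℝ} (hs : ∀ i j, f i j = f j i) (hd : ∀ i, f i i = 0) :
    ∑ i, ∑ j, f i j = 2 * ∑ A ∈ kacPairs N, f A.1 A.2 := by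
  rw [← sum_kacPairs hs hd, nsmul_eq_mul, Nat.cast_ofNat]

lemma dotProduct_self_of_mem {v : KacSpace N} (hv : v ∈ kacSphere N) :
    (fun k => v k) ⬝ᵥ (fun k => v k) = (N : ℝ) := by
  rw [← mem_kacSphere_iff.mp hv]
  simp [dotProduct, sq]

/-- The pointwise curvature inequality `Γ₂(log f) ≥ (N - 2) Γ(log f)` on the Kac sphere. -/
lemma sum_rotDeriv_log_sq_le (hN : 2 ≤ N) (f : MvPolynomial (Fin N) ℝ) {v : KacSpace N}
    (hv : v ∈ kacSphere N) (hf : polyEval f v ≠ 0) :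
    ((N : ℝ) - 2) * ∑ A ∈ kacPairs N, (polyEval (rotDeriv A.1 A.2 f) v / polyEval f v) ^ 2
      ≤ ∑ A ∈ kacPairs N, ∑ B ∈ kacPairs N,
        (polyEval (rotDeriv B.1 B.2 (rotDeriv A.1 A.2 f)) v / polyEval f v
          - polyEval (rotDeriv A.1 A.2 f) v * polyEval (rotDeriv B.1 B.2 f) v
            / polyEval f v ^ 2) ^ 2 := by
  let x : Fin N → ℝ := fun k => v k
  let p : Fin N → ℝ := fun i => polyEval (pderiv i f) v / polyEval f v
  let h : Fin N → Fin N → ℝ := fun i j => polyEval (pderiv i (pderiv j f)) v / polyEval f v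
    - p i * p j
  have hx : 0 < x ⬝ᵥ x := by
    rw [show x ⬝ᵥ x = N from dotProduct_self_of_mem hv]
    have : 0 < N := by omega
    exact_mod_cast this
  have key := curvature_bound hx p h fun i j => by simp only [h, pderiv_comm i j, mul_comm (p i)]
  have h1 : ∀ k l, polyEval (rotDeriv k l f) v / polyEval f v = x l * p k - x k * p l := by
    intro k l
    simp only [rotDeriv_apply, polyEval_sub, polyEval_mul, polyEval_X, x, p]
    ring
  have hδ : ∀ i l : Fin N, polyEval (pderiv i (X l)) v = if i = l then 1 else 0 := by
    intro i l
    rw [pderiv_X, Pi.single_apply]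
    simp only [eq_comm (a := l)]
    split_ifs <;> simp
  have h2 : ∀ k l i j, polyEval (rotDeriv i j (rotDeriv k l f)) v / polyEval f v
          - polyEval (rotDeriv k l f) v * polyEval (rotDeriv i j f) v / polyEval f v ^ 2
        = rotSecond x p h i j k l := by
    intro k l i j
    simp only [rotDeriv_apply, polyEval_sub, polyEval_add, polyEval_mul, polyEval_X, map_sub,
      Derivation.leibniz, smul_eq_mul, hδ, rotSecond, x, p, h]
    field_simp
    ring
  simp only [h1, h2]
  have s1 := sum_kacPairs_real (N := N) (f := fun k l => (x l * p k - x k * p l) ^ 2)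
    (fun k l => by ring) (fun k => by ring)
  have s2 : ∀ k l, ∑ i, ∑ j, rotSecond x p h i j k l ^ 2
      = 2 * ∑ B ∈ kacPairs N, rotSecond x p h B.1 B.2 k l ^ 2 := fun k l =>
    sum_kacPairs_real (f := fun i j => rotSecond x p h i j k l ^ 2)
      (fun i j => by simp only [rotSecond]; ring) (fun i => by simp only [rotSecond]; ring)
  have s3 := sum_kacPairs_real (N := N)
    (f := fun k l => 2 * ∑ B ∈ kacPairs N, rotSecond x p h B.1 B.2 k l ^ 2)
    (fun k l => by
      congr 1
      exact Finset.sum_congr rfl fun B _ => by simp only [rotSecond]; ring)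
    (fun k => by
      rw [Finset.sum_eq_zero, mul_zero]
      intro B _
      simp only [rotSecond]; ring)
  simp only [s2] at key
  rw [s1, s3, ← Finset.mul_sum] at key
  linarith

/-- The exponential decay of the Fisher information, in integrated form. -/
lemma fisherInfo_decay [Fact (2 ≤ N)] {u : ℝ → MvPolynomial (Fin N) ℝ} (hu : IsHeatFlow u)
    {a b : ℝ} (hab : a ≤ b) (hpos : ∀ t ∈ Set.Icc a b, PosOnSphere (u t)) :
    2 * ((N : ℝ) - 2) * ∫ t in a..b, fisherInfo (u t) ≤ fisherInfo (u a) - fisherInfo (u b) := by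
  have hN : 2 ≤ N := Fact.out
  let K : Fin N × Fin N → ℝ → KacSpace N → ℝ := fun A t v =>
    rotHessian (2 * polyEval (rotDeriv A.1 A.2 (u t)) v ^ 2 / polyEval (u t) v ^ 3)
      (-(2 * polyEval (rotDeriv A.1 A.2 (u t)) v / polyEval (u t) v ^ 2))
      (2 / polyEval (u t) v) (u t) (rotDeriv A.1 A.2 (u t)) v
  have hK : ∀ A, ContinuousOn (Function.uncurry (K A)) (Set.Icc a b ×ˢ kacSphere N) := fun A =>
    continuousOn_rotHessian hasPartials₂_sq_div hu (hu.rotDeriv A.1 A.2) hpos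
  have hslice : ∀ t ∈ Set.Icc a b, ∀ A, ContinuousOn (K A t) (kacSphere N) := fun t ht A =>
    (hK A).uncurry_left t ht
  have hev : ∀ A, ∫ v, polyEval (rotDeriv A.1 A.2 (u b)) v ^ 2 / polyEval (u b) v ∂kacSigma N
      - ∫ v, polyEval (rotDeriv A.1 A.2 (u a)) v ^ 2 / polyEval (u a) v ∂kacSigma N
      = -∫ t in a..b, ∫ v, K A t v ∂kacSigma N := fun A =>
    integral_evolution_one hasPartials₂_sq_div hu (hu.rotDeriv A.1 A.2) hab hpos
  have hfi : ∀ t ∈ Set.Icc a b, fisherInfo (u t) = ∑ A ∈ kacPairs N,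
      ∫ v, polyEval (rotDeriv A.1 A.2 (u t)) v ^ 2 / polyEval (u t) v ∂kacSigma N := by
    intro t ht
    refine integral_finsetSum _ fun A _ => integrable_of_continuousOn_kacSphere ?_
    exact ((continuous_polyEval _).continuousOn.pow 2).div (continuous_polyEval _).continuousOn
      fun v hv => (hpos t ht v hv).ne'
  have hint : ∀ A, IntervalIntegrable (fun t => ∫ v, K A t v ∂kacSigma N) volume a b := by
    intro A
    refine ContinuousOn.intervalIntegrable ?_
    rw [Set.uIcc_of_le hab]
    exact continuousOn_integral_kacSigma isCompact_Icc (hK A)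
  rw [hfi b (Set.right_mem_Icc.mpr hab), hfi a (Set.left_mem_Icc.mpr hab), ← Finset.sum_sub_distrib,
    Finset.sum_congr rfl fun A _ => show _ = ∫ t in a..b, ∫ v, K A t v ∂kacSigma N by
      rw [← neg_sub, hev A, neg_neg],
    ← intervalIntegral.integral_finsetSum fun A _ => hint A, ← intervalIntegral.integral_const_mul]
  refine intervalIntegral.integral_mono_on hab ?_ ?_ fun t ht => ?_
  · refine ContinuousOn.intervalIntegrable ?_
    rw [Set.uIcc_of_le hab]
    exact continuousOn_const.mul (continuousOn_fisherInfo hu hpos)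
  · have := IntervalIntegrable.sum (kacPairs N) fun A _ => hint A
    simpa only [Finset.sum_fn] using this
  rw [← integral_finsetSum _ fun A _ => integrable_of_continuousOn_kacSphere (hslice t ht A),
    fisherInfo, ← integral_const_mul]
  refine integral_mono_kacSphere (continuousOn_const.mul ?_) ?_ fun v hv => ?_
  · exact (continuousOn_fisher hu hpos).uncurry_left t ht
  · exact continuousOn_finsetSum _ fun A _ => hslice t ht A
  have hp := hpos t ht v hv
  have hkey := mul_le_mul_of_nonneg_left (sum_rotDeriv_log_sq_le hN (u t) hv hp.ne')
    (by positivity : 0 ≤ 2 * polyEval (u t) v)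
  have e1 : ∑ A ∈ kacPairs N, polyEval (rotDeriv A.1 A.2 (u t)) v ^ 2 / polyEval (u t) v
      = polyEval (u t) v * ∑ A ∈ kacPairs N,
        (polyEval (rotDeriv A.1 A.2 (u t)) v / polyEval (u t) v) ^ 2 := by
    rw [Finset.mul_sum]
    refine Finset.sum_congr rfl fun A _ => ?_
    field_simp
  have e2 : ∀ A, K A t v = 2 * polyEval (u t) v * ∑ B ∈ kacPairs N,
        (polyEval (rotDeriv B.1 B.2 (rotDeriv A.1 A.2 (u t))) v / polyEval (u t) v
          - polyEval (rotDeriv A.1 A.2 (u t)) v * polyEval (rotDeriv B.1 B.2 (u t)) v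
            / polyEval (u t) v ^ 2) ^ 2 := by
    intro A
    simp only [K, rotHessian, Finset.mul_sum]
    refine Finset.sum_congr rfl fun B _ => ?_
    field_simp
    ring
  simp only [e2]
  rw [e1, ← Finset.mul_sum]
  linarith

lemma IsHeatFlow.neg {u : ℝ → MvPolynomial (Fin N) ℝ} (hu : IsHeatFlow u) :
    IsHeatFlow fun t => -u t :=
  hu.map (-LinearMap.id) (by simp)

/-- The entropy of a positive heat flow of mass one has an arbitrarily small upper bound at large
times. -/
lemma exists_polyEntropy_lt [Fact (2 ≤ N)] {u : ℝ → MvPolynomial (Fin N) ℝ} (hu : IsHeatFlow u)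
    (h0 : PosOnSphere (u 0)) (h1 : ∫ v, polyEval (u 0) v ∂kacSigma N = 1) {κ : ℝ}
    (hlim : ∀ v ∈ kacSphere N, Filter.Tendsto (fun t => polyEval (u t) v) Filter.atTop (nhds κ))
    (a : ℝ) {ε : ℝ} (hε : 0 < ε) : ∃ b, a ≤ b ∧ polyEntropy (u b) < ε := by
  obtain ⟨w, hw, hmax⟩ := (isCompact_kacSphere N).exists_isMaxOn kacSphere_nonempty
    (continuous_polyEval (u 0)).continuousOn
  set M := polyEval (u 0) w
  have hup : ∀ t, 0 ≤ t → ∀ v ∈ kacSphere N, polyEval (u t) v ≤ M := by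
    intro t ht v hv
    have := hu.neg.le_of_le (m := -M) (fun v hv => by
      simpa using isMaxOn_iff.mp hmax v hv) ht hv
    simpa using this
  have hlo : ∀ t, 0 ≤ t → ∀ v ∈ kacSphere N, 0 < polyEval (u t) v := fun t ht v hv =>
    hu.posOnSphere h0 ht v hv
  have hM : 0 ≤ M := (h0 w hw).le
  have hT1 : Filter.Tendsto (fun t => ∫ v, polyEval (u t) v ∂kacSigma N) Filter.atTop
      (nhds (∫ _, κ ∂kacSigma N)) := by
    refine tendsto_integral_filter_of_dominated_convergence (fun _ => M)
      (Filter.Eventually.of_forall fun t => (continuous_polyEval _).aestronglyMeasurable) ?_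
      (integrable_const _) ((ae_mem_kacSphere N).mono hlim)
    filter_upwards [Filter.eventually_ge_atTop 0] with t ht
    filter_upwards [ae_mem_kacSphere N] with v hv
    rw [Real.norm_eq_abs, abs_of_pos (hlo t ht v hv)]
    exact hup t ht v hv
  have hκ : κ = 1 := by
    have h2 : ∀ᶠ t in Filter.atTop, ∫ v, polyEval (u t) v ∂kacSigma N = 1 := by
      filter_upwards [Filter.eventually_ge_atTop 0] with t ht
      rw [integral_polyEval_eq hu ht, h1]
    have h3 := tendsto_nhds_unique (Filter.Tendsto.congr' h2 hT1) tendsto_const_nhds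
    simpa using h3
  subst hκ
  have hT2 : Filter.Tendsto (fun t => ∫ v, (polyEval (u t) v * (polyEval (u t) v - 1)) ∂kacSigma N)
      Filter.atTop (nhds (∫ _, (1 * (1 - 1) : ℝ) ∂kacSigma N)) := by
    refine tendsto_integral_filter_of_dominated_convergence (fun _ => M * (M + 1))
      (Filter.Eventually.of_forall fun t => ?_) ?_
      (integrable_const _) ((ae_mem_kacSphere N).mono fun v hv =>
        (hlim v hv).mul ((hlim v hv).sub_const 1))
    · have := continuous_polyEval (u t)
      exact (this.mul (this.sub continuous_const)).aestronglyMeasurable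
    filter_upwards [Filter.eventually_ge_atTop 0] with t ht
    filter_upwards [ae_mem_kacSphere N] with v hv
    have := hlo t ht v hv
    have := hup t ht v hv
    rw [norm_mul, Real.norm_eq_abs, Real.norm_eq_abs, abs_of_pos (hlo t ht v hv)]
    refine mul_le_mul (hup t ht v hv) ?_ (abs_nonneg _) hM
    rw [abs_le]
    constructor <;> linarith
  simp only [sub_self, mul_zero, integral_zero] at hT2
  obtain ⟨b, hb⟩ := ((hT2.eventually_lt_const hε).and
    (Filter.eventually_ge_atTop (max a 0))).exists
  refine ⟨b, (le_max_left _ _).trans hb.2, lt_of_le_of_lt ?_ hb.1⟩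
  have hb0 : 0 ≤ b := (le_max_right _ _).trans hb.2
  have hc := (continuous_polyEval (u b)).continuousOn (s := kacSphere N)
  refine integral_mono_kacSphere (hc.mul (continuousOn_comp_log hc (hlo b hb0)))
    (hc.mul (hc.sub continuousOn_const)) fun v hv => ?_
  exact mul_le_mul_of_nonneg_left (Real.log_le_sub_one_of_pos (hlo b hb0 v hv))
    (hlo b hb0 v hv).le

/-- The logarithmic Sobolev inequality at time `1/(4N)`, combined with the monotonicity of the
Fisher information: its integral up to that time controls the initial entropy. -/
lemma polyEntropy_le_integral_fisherInfo [Fact (2 ≤ N)] (hN : 3 ≤ N)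
    {u : ℝ → MvPolynomial (Fin N) ℝ} (hu : IsHeatFlow u)
    (h0 : PosOnSphere (u 0)) (h1 : ∫ v, polyEval (u 0) v ∂kacSigma N = 1) {κ : ℝ}
    (hlim : ∀ v ∈ kacSphere N, Filter.Tendsto (fun t => polyEval (u t) v) Filter.atTop (nhds κ)) :
    ((N : ℝ) - 2) * polyEntropy (u 0)
      ≤ (3 * N - 2) * ∫ t in (0 : ℝ)..1 / (4 * N), fisherInfo (u t) := by
  have hN' : (3 : ℝ) ≤ N := by exact_mod_cast hN
  set T : ℝ := 1 / (4 * N) with hT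
  have hT0 : 0 ≤ T := by positivity
  have hpos : ∀ t, 0 ≤ t → PosOnSphere (u t) := fun t ht => hu.posOnSphere h0 ht
  set J := ∫ t in (0 : ℝ)..T, fisherInfo (u t)
  have hd := polyEntropy_sub_eq hu hT0 fun t ht => hpos t ht.1
  -- the logarithmic Sobolev inequality at time `T`
  have hLS : 2 * ((N : ℝ) - 2) * polyEntropy (u T) ≤ fisherInfo (u T) := by
    refine le_of_forall_pos_le_add fun ε hε => ?_
    obtain ⟨b, hb, hlt⟩ := exists_polyEntropy_lt hu h0 h1 hlim T
      (show 0 < ε / (2 * ((N : ℝ) - 2)) by apply div_pos hε; linarith)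
    have e1 := polyEntropy_sub_eq hu hb fun t ht => hpos t (hT0.trans ht.1)
    have e2 := fisherInfo_decay hu hb fun t ht => hpos t (hT0.trans ht.1)
    have e3 := fisherInfo_nonneg (hpos b (hT0.trans hb))
    rw [← e1] at e2
    rw [lt_div_iff₀ (by linarith)] at hlt
    linarith
  have hmono : T * fisherInfo (u T) ≤ J := by
    have : ∫ _ in (0 : ℝ)..T, fisherInfo (u T) = T * fisherInfo (u T) := by simp
    rw [← this]
    refine intervalIntegral.integral_mono_on hT0 (by simp) ?_ fun t ht => ?_
    · refine ContinuousOn.intervalIntegrable ?_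
      rw [Set.uIcc_of_le hT0]
      exact continuousOn_fisherInfo hu fun t ht => hpos t ht.1
    · have e2 := fisherInfo_decay hu ht.2 fun s hs => hpos s (ht.1.trans hs.1)
      have e3 : 0 ≤ ∫ s in t..T, fisherInfo (u s) :=
        intervalIntegral.integral_nonneg ht.2 fun s hs =>
          fisherInfo_nonneg (hpos s (ht.1.trans hs.1))
      have : 0 ≤ 2 * ((N : ℝ) - 2) * ∫ s in t..T, fisherInfo (u s) :=
        mul_nonneg (by linarith) e3
      linarith
  have hJ : fisherInfo (u T) ≤ 4 * N * J := by
    rw [hT, div_mul_eq_mul_div, one_mul, div_le_iff₀ (by positivity)] at hmono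
    linarith
  have : polyEntropy (u 0) = J + polyEntropy (u T) := by linarith
  rw [this]
  linarith

end LogSobolev

/-! ### Dissipation of the entropy production along the heat flow -/

section PolynomialProduction
open MvPolynomial
open scoped Matrix
variable {N : ℕ}

/-- `ψ(x, y) = (x - y) log (x / y)` for positive `x` and `y`. -/
def realPsi (x y : ℝ) : ℝ := (x - y) * (Real.log x - Real.log y)

lemma realPsi_nonneg {x y : ℝ} (hx : 0 < x) (hy : 0 < y) : 0 ≤ realPsi x y := by
  unfold realPsi
  rcases le_total x y with h | h
  · exact mul_nonneg_of_nonpos_of_nonpos (sub_nonpos.mpr h)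
      (sub_nonpos.mpr (Real.log_le_log hx h))
  · exact mul_nonneg (sub_nonneg.mpr h) (sub_nonneg.mpr (Real.log_le_log hy h))

lemma hasPartials₂_realPsi : HasPartials₂ {z : ℝ × ℝ | 0 < z.1 ∧ 0 < z.2} realPsi
    (fun x y => Real.log x - Real.log y + (x - y) / x)
    (fun x y => -(Real.log x - Real.log y) - (x - y) / y)
    (fun x y => (x + y) / x ^ 2) (fun x y => -((x + y) / (x * y))) (fun x y => (x + y) / y ^ 2) := by
  set U := {z : ℝ × ℝ | 0 < z.1 ∧ 0 < z.2} with hU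
  have h1 : ∀ z ∈ U, z.1 ≠ 0 := fun z hz => (Set.mem_ofPred.mp hz).1.ne'
  have h2 : ∀ z ∈ U, z.2 ≠ 0 := fun z hz => (Set.mem_ofPred.mp hz).2.ne'
  have c1 : ContinuousOn (fun z : ℝ × ℝ => z.1) U := continuousOn_fst
  have c2 : ContinuousOn (fun z : ℝ × ℝ => z.2) U := continuousOn_snd
  have l1 := c1.log h1
  have l2 := c2.log h2
  have dl : ∀ (f g : ℝ → ℝ) (f' g' s : ℝ), f s ≠ 0 → g s ≠ 0 → HasDerivAt f f' s →
      HasDerivAt g g' s → HasDerivAt (fun s => Real.log (f s) - Real.log (g s))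
        (f' / f s - g' / g s) s := fun f g f' g' s hf0 hg0 hf hg =>
    (hf.log hf0).fun_sub (hg.log hg0)
  refine ⟨⟨(c1.sub c2).mul (l1.sub l2), fun f g f' g' s hs hf hg => ?_⟩,
    ⟨(l1.sub l2).add ((c1.sub c2).div c1 h1), fun f g f' g' s hs hf hg => ?_⟩,
    ⟨(l1.sub l2).neg.sub ((c1.sub c2).div c2 h2), fun f g f' g' s hs hf hg => ?_⟩,
    (c1.add c2).div (c1.pow 2) fun z hz => pow_ne_zero 2 (h1 z hz),
    ((c1.add c2).div (c1.mul c2) fun z hz => mul_ne_zero (h1 z hz) (h2 z hz)).neg,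
    (c1.add c2).div (c2.pow 2) fun z hz => pow_ne_zero 2 (h2 z hz)⟩
  all_goals
    have hf0 : f s ≠ 0 := h1 _ hs
    have hg0 : g s ≠ 0 := h2 _ hs
  · exact ((hf.fun_sub hg).fun_mul (dl f g f' g' s hf0 hg0 hf hg)).congr_deriv
      (by field_simp; ring)
  · exact ((dl f g f' g' s hf0 hg0 hf hg).fun_add ((hf.fun_sub hg).fun_div hf hf0)).congr_deriv
      (by field_simp; ring)
  · exact ((dl f g f' g' s hf0 hg0 hf hg).fun_neg.fun_sub
      ((hf.fun_sub hg).fun_div hg hg0)).congr_deriv (by field_simp; ring)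

lemma polyEval_rotDeriv_isomSubst {i j : Fin N} (hij : i ≠ j) (θ : ℝ) (f : MvPolynomial (Fin N) ℝ)
    {v : KacSpace N} (hv : v ∈ kacSphere N) :
    polyEval (rotDeriv i j (isomSubst (kacRotIsom hij θ) f)) v
      = polyEval (rotDeriv i j f) (kacRotation i j θ v) := by
  have h1 := hasRotDeriv_polyEval hij (isomSubst (kacRotIsom hij θ) f) v hv
  have h2 := (hasRotDeriv_polyEval hij f).comp_kacRotation hij θ v hv
  simp only [polyEval_isomSubst, kacRotIsom_apply] at h1
  exact h1.unique h2

/-- The derivative of `log f` along the rotations in the plane of `i` and `j`. -/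
def rotLog (i j : Fin N) (f : MvPolynomial (Fin N) ℝ) (v : KacSpace N) : ℝ :=
  polyEval (rotDeriv i j f) v / polyEval f v

/-- The polynomial `v_i² + v_j²`. -/
def planeSq (i j : Fin N) : MvPolynomial (Fin N) ℝ := X i ^ 2 + X j ^ 2

@[simp] lemma polyEval_planeSq (i j : Fin N) (v : KacSpace N) :
    polyEval (planeSq i j) v = v i ^ 2 + v j ^ 2 := by simp [planeSq]

lemma sphereLaplacian_X_sq (i : Fin N) :
    sphereLaplacian N (X i ^ 2) = 2 * normSqPoly N - (2 * (N : ℝ)) • X i ^ 2 := by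
  have h1 : polyLaplacian (X i ^ 2 : MvPolynomial (Fin N) ℝ) = 2 := by
    have : polyLaplacian (X i : MvPolynomial (Fin N) ℝ) = 0 := by
      refine Finset.sum_eq_zero fun k _ => ?_
      rw [pderiv_X, Pi.single_apply]
      split_ifs <;> simp
    rw [sq, polyLaplacian_X_mul, this, pderiv_X_self]
    ring
  have h2 : eulerDeriv N (X i ^ 2) = (2 : ℝ) • X i ^ 2 := by
    rw [sq, Derivation.leibniz, eulerDeriv_X, smul_eq_mul, two_smul]
  rw [sphereLaplacian_eq, h1, h2, Derivation.map_smul, h2, smul_smul, smul_smul, sub_sub, ← add_smul,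
    mul_comm]
  congr 2
  ring

lemma polyEval_sphereLaplacian_planeSq (i j : Fin N) {v : KacSpace N} (hv : v ∈ kacSphere N) :
    polyEval (sphereLaplacian N (planeSq i j)) v = 4 * N - 2 * N * (v i ^ 2 + v j ^ 2) := by
  rw [planeSq, map_add, sphereLaplacian_X_sq, sphereLaplacian_X_sq]
  have h2 : ∀ p : MvPolynomial (Fin N) ℝ, polyEval (2 * p) v = 2 * polyEval p v := by
    intro p
    rw [two_mul, polyEval_add, two_mul]
  simp only [polyEval_add, polyEval_sub, polyEval_smul, h2, polyEval_normSqPoly hv, polyEval_pow,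
    polyEval_X]
  ring

lemma rotHessian_realPsi_eq (f g : MvPolynomial (Fin N) ℝ) {v : KacSpace N}
    (hf : 0 < polyEval f v) (hg : 0 < polyEval g v) :
    rotHessian ((polyEval f v + polyEval g v) / polyEval f v ^ 2)
        (-((polyEval f v + polyEval g v) / (polyEval f v * polyEval g v)))
        ((polyEval f v + polyEval g v) / polyEval g v ^ 2) f g v
      = (polyEval f v + polyEval g v) * ∑ A ∈ kacPairs N,
        (rotLog A.1 A.2 f v - rotLog A.1 A.2 g v) ^ 2 := by
  simp only [rotHessian, Finset.mul_sum, rotLog]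
  refine Finset.sum_congr rfl fun A _ => ?_
  field_simp
  ring

/-- The lower bound for the Hessian term in the dissipation of `∫ W ψ(f, g)`: the gradient of
`log f - log g` is bounded below by its component along one rotation field. -/
lemma le_rotHessian_realPsi (hN : 2 ≤ N) {i j : Fin N} (hij : i ≠ j) (f g : MvPolynomial (Fin N) ℝ)
    {v : KacSpace N} (hv : v ∈ kacSphere N) (hf : 0 < polyEval f v) (hg : 0 < polyEval g v) :
    (N : ℝ) * ((polyEval f v + polyEval g v) * (rotLog i j f v - rotLog i j g v) ^ 2)
      ≤ (v i ^ 2 + v j ^ 2) * rotHessian ((polyEval f v + polyEval g v) / polyEval f v ^ 2)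
        (-((polyEval f v + polyEval g v) / (polyEval f v * polyEval g v)))
        ((polyEval f v + polyEval g v) / polyEval g v ^ 2) f g v := by
  let x : Fin N → ℝ := fun k => v k
  let p : Fin N → ℝ := fun i => polyEval (pderiv i f) v / polyEval f v
    - polyEval (pderiv i g) v / polyEval g v
  have hxN : x ⬝ᵥ x = N := dotProduct_self_of_mem hv
  have hx : 0 < x ⬝ᵥ x := by
    rw [hxN]
    have : 0 < N := by omega
    exact_mod_cast this
  have h1 : ∀ k l, rotLog k l f v - rotLog k l g v = x l * p k - x k * p l := by
    intro k l
    simp only [rotLog, rotDeriv_apply, polyEval_sub, polyEval_mul, polyEval_X, x, p]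
    ring
  have h3 := wedge_sq_le hx p hij
  rw [sum_kacPairs_real (f := fun k l => (x l * p k - x k * p l) ^ 2)
    (fun k l => by ring) (fun k => by ring), hxN] at h3
  rw [rotHessian_realPsi_eq f g hf hg]
  simp only [h1]
  have h4 : (N : ℝ) * (x j * p i - x i * p j) ^ 2 ≤ (x i ^ 2 + x j ^ 2)
      * ∑ A ∈ kacPairs N, (x A.2 * p A.1 - x A.1 * p A.2) ^ 2 := by linarith
  have := mul_le_mul_of_nonneg_left h4 (add_pos hf hg).le
  calc _ = (polyEval f v + polyEval g v) * ((N : ℝ) * (x j * p i - x i * p j) ^ 2) := by ring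
    _ ≤ _ := this
    _ = _ := by simp only [x]; ring

/-- The integral of `ψ` against the weight `1 + v_i² + v_j²`, for one angle. -/
def psiIntegral (i j : Fin N) (f : MvPolynomial (Fin N) ℝ) (θ : ℝ) : ℝ :=
  ∫ v, (1 + (v i ^ 2 + v j ^ 2)) * realPsi (polyEval f v) (polyEval f (kacRotation i j θ v))
    ∂kacSigma N

/-- The lower bound for the dissipation of `psiIntegral`, up to the factor `N`. -/
def pairDissipation (i j : Fin N) (f : MvPolynomial (Fin N) ℝ) (θ : ℝ) : ℝ :=
  ∫ v, (polyEval f v + polyEval f (kacRotation i j θ v))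
    * (rotLog i j f v - rotLog i j f (kacRotation i j θ v)) ^ 2 ∂kacSigma N

lemma continuousOn_rotLog {i j : Fin N} {u : ℝ → MvPolynomial (Fin N) ℝ} (hu : IsHeatFlow u)
    {s : Set ℝ} (hpos : ∀ t ∈ s, PosOnSphere (u t)) :
    ContinuousOn (fun x : ℝ × KacSpace N => rotLog i j (u x.1) x.2) (s ×ˢ kacSphere N) :=
  (hu.rotDeriv i j).continuous.continuousOn.div hu.continuous.continuousOn
    fun x hx => (hpos x.1 hx.1 x.2 hx.2).ne'

lemma continuousOn_pairDissipation_integrand {i j : Fin N} (hij : i ≠ j)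
    {u : ℝ → MvPolynomial (Fin N) ℝ} (hu : IsHeatFlow u)
    {s : Set ℝ} (hpos : ∀ t ∈ s, PosOnSphere (u t)) (s' : Set ℝ) :
    ContinuousOn (Function.uncurry fun (x : ℝ × ℝ) v =>
      (polyEval (u x.2) v + polyEval (u x.2) (kacRotation i j x.1 v))
      * (rotLog i j (u x.2) v - rotLog i j (u x.2) (kacRotation i j x.1 v)) ^ 2)
      ((s' ×ˢ s) ×ˢ kacSphere N) := by
  have m1 : Continuous fun y : (ℝ × ℝ) × KacSpace N => (y.1.2, y.2) := by fun_prop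
  have m2 : Continuous fun y : (ℝ × ℝ) × KacSpace N => (y.1.2, kacRotation i j y.1.1 y.2) :=
    (by fun_prop : Continuous fun y : (ℝ × ℝ) × KacSpace N => y.1.2).prodMk
      ((continuous_kacRotation i j).comp
        (by fun_prop : Continuous fun y : (ℝ × ℝ) × KacSpace N => (y.1.1, y.2)))
  have k1 : Set.MapsTo (fun y : (ℝ × ℝ) × KacSpace N => (y.1.2, y.2)) ((s' ×ˢ s) ×ˢ kacSphere N)
      (s ×ˢ kacSphere N) := fun y hy => ⟨hy.1.2, hy.2⟩
  have k2 : Set.MapsTo (fun y : (ℝ × ℝ) × KacSpace N => (y.1.2, kacRotation i j y.1.1 y.2))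
      ((s' ×ˢ s) ×ˢ kacSphere N) (s ×ˢ kacSphere N) :=
    fun y hy => ⟨hy.1.2, kacRotation_mem hij _ hy.2⟩
  have c := continuousOn_rotLog (i := i) (j := j) hu hpos
  have c' := hu.continuous
  exact ((c'.comp m1).add (c'.comp m2)).continuousOn.mul
    (((c.comp m1.continuousOn k1).sub (c.comp m2.continuousOn k2)).pow 2)

lemma continuousOn_pairDissipation [Fact (2 ≤ N)] {i j : Fin N} (hij : i ≠ j)
    {u : ℝ → MvPolynomial (Fin N) ℝ} (hu : IsHeatFlow u)
    {s : Set ℝ} (hs : IsCompact s) (hpos : ∀ t ∈ s, PosOnSphere (u t)) {s' : Set ℝ}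
    (hs' : IsCompact s') :
    ContinuousOn (Function.uncurry fun θ t => pairDissipation i j (u t) θ) (s' ×ˢ s) :=
  continuousOn_integral_kacSigma (hs'.prod hs)
    (continuousOn_pairDissipation_integrand hij hu hpos s')

/-- Villani's estimate for one pair and one angle: with the weight `1 + v_i² + v_j² - 4Nt`, which
is a supersolution of the backward heat equation and bounded below by `v_i² + v_j²` for
`t ≤ 1/(4N)`, the integral of `ψ` along the heat flow decreases at least at the rate
`N * pairDissipation`. -/
lemma integral_pairDissipation_le [Fact (2 ≤ N)] {i j : Fin N} (hij : i ≠ j)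
    {u : ℝ → MvPolynomial (Fin N) ℝ} (hu : IsHeatFlow u) (h0 : PosOnSphere (u 0)) (θ : ℝ) :
    N * ∫ t in (0 : ℝ)..1 / (4 * N), pairDissipation i j (u t) θ ≤ psiIntegral i j (u 0) θ := by
  have hN : 2 ≤ N := Fact.out
  have hN0 : (0 : ℝ) < N := by
    have : 0 < N := by omega
    exact_mod_cast this
  set T : ℝ := 1 / (4 * N) with hT
  have hT0 : 0 ≤ T := by positivity
  have hpos : ∀ t ∈ Set.Icc 0 T, PosOnSphere (u t) := fun t ht => hu.posOnSphere h0 ht.1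
  have hq := hu.isomSubst (kacRotIsom hij θ)
  have hU : ∀ t ∈ Set.Icc 0 T, ∀ v ∈ kacSphere N, (polyEval (u t) v,
      polyEval (isomSubst (kacRotIsom hij θ) (u t)) v) ∈ {z : ℝ × ℝ | 0 < z.1 ∧ 0 < z.2} := by
    intro t ht v hv
    refine ⟨hpos t ht v hv, ?_⟩
    simp only [polyEval_isomSubst]
    exact hpos t ht _ (kacRotation_mem hij θ hv)
  have hev := integral_evolution_eq hasPartials₂_realPsi hu hq (1 + planeSq i j) (C (-(4 * (N : ℝ)))) hT0 hU
  have hH := continuousOn_rotHessian hasPartials₂_realPsi hu hq hU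
  have hw : ∀ (t : ℝ) (v : KacSpace N), polyEval (1 + planeSq i j + t • C (-(4 * (N : ℝ)))) v
      = 1 + (v i ^ 2 + v j ^ 2) - 4 * N * t := by
    intro t v
    simp only [polyEval_add, polyEval_one, polyEval_planeSq, polyEval_smul, polyEval_C]
    ring
  have hTw : ∀ t : ℝ, ∀ v ∈ kacSphere N,
      polyEval (C (-(4 * (N : ℝ))) + sphereLaplacian N (1 + planeSq i j + t • C (-(4 * (N : ℝ))))) v
      = - (2 * N * (v i ^ 2 + v j ^ 2)) := by
    intro t v hv
    have hC : sphereLaplacian N (C (-(4 * (N : ℝ)))) = 0 := by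
      simp [sphereLaplacian_apply, ← algebraMap_eq]
    rw [map_add, map_add, map_smul, hC, sphereLaplacian_one, smul_zero, add_zero, zero_add,
      polyEval_add, polyEval_C, polyEval_sphereLaplacian_planeSq i j hv]
    ring
  have hψ : ∀ t ∈ Set.Icc 0 T, ∀ v ∈ kacSphere N,
      0 ≤ realPsi (polyEval (u t) v) (polyEval (isomSubst (kacRotIsom hij θ) (u t)) v) :=
    fun t ht v hv => realPsi_nonneg (hU t ht v hv).1 (hU t ht v hv).2
  have hend : 0 ≤ ∫ v, polyEval (1 + planeSq i j + T • C (-(4 * (N : ℝ)))) v *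
      realPsi (polyEval (u T) v) (polyEval (isomSubst (kacRotIsom hij θ) (u T)) v)
        ∂kacSigma N := by
    refine integral_nonneg_of_ae ((ae_mem_kacSphere N).mono fun v hv => mul_nonneg ?_
      (hψ T (Set.right_mem_Icc.mpr hT0) v hv))
    rw [hw, hT]
    have : 4 * (N : ℝ) * (1 / (4 * N)) = 1 := by field_simp
    rw [this]
    nlinarith [sq_nonneg (v i), sq_nonneg (v j)]
  have hstart : ∫ v, polyEval (1 + planeSq i j + (0 : ℝ) • C (-(4 * (N : ℝ)))) v *
      realPsi (polyEval (u 0) v) (polyEval (isomSubst (kacRotIsom hij θ) (u 0)) v)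
        ∂kacSigma N = psiIntegral i j (u 0) θ := by
    simp only [hw, polyEval_isomSubst, kacRotIsom_apply, mul_zero, sub_zero]
    rfl
  let R₁ : ℝ → ℝ := fun t => ∫ v, 2 * N * (v i ^ 2 + v j ^ 2) *
    realPsi (polyEval (u t) v) (polyEval (isomSubst (kacRotIsom hij θ) (u t)) v) ∂kacSigma N
  let K : ℝ → KacSpace N → ℝ := fun t v =>
    rotHessian ((polyEval (u t) v + polyEval (isomSubst (kacRotIsom hij θ) (u t)) v)
        / polyEval (u t) v ^ 2)
      (-((polyEval (u t) v + polyEval (isomSubst (kacRotIsom hij θ) (u t)) v)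
        / (polyEval (u t) v * polyEval (isomSubst (kacRotIsom hij θ) (u t)) v)))
      ((polyEval (u t) v + polyEval (isomSubst (kacRotIsom hij θ) (u t)) v)
        / polyEval (isomSubst (kacRotIsom hij θ) (u t)) v ^ 2)
      (u t) (isomSubst (kacRotIsom hij θ) (u t)) v
  let R₂ : ℝ → ℝ := fun t => ∫ v, (1 + (v i ^ 2 + v j ^ 2) - 4 * N * t) * K t v ∂kacSigma N
  have hev' : ∫ t in (0 : ℝ)..T, (R₁ t + R₂ t) ≤ psiIntegral i j (u 0) θ := by
    have e : ∫ t in (0 : ℝ)..T, (R₁ t + R₂ t) = -∫ t in (0 : ℝ)..T, -(R₁ t + R₂ t) := by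
      rw [intervalIntegral.integral_neg, neg_neg]
    rw [e, ← hstart]
    refine (neg_le_of_neg_le ?_)
    refine le_trans (by linarith) hev.le |>.trans_eq ?_
    refine intervalIntegral.integral_congr fun t _ => ?_
    have e1 : ∫ v, polyEval (C (-(4 * (N : ℝ))) + sphereLaplacian N (1 + planeSq i j
          + t • C (-(4 * (N : ℝ))))) v *
        realPsi (polyEval (u t) v) (polyEval (isomSubst (kacRotIsom hij θ) (u t)) v) ∂kacSigma N
        = -R₁ t := by
      simp only [R₁]
      rw [← integral_neg]
      exact integral_congr_kacSphere fun v hv => by rw [hTw t v hv, neg_mul]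
    simp only [e1, hw]
    rw [neg_add, sub_eq_add_neg]
  have hψc : ContinuousOn (Function.uncurry fun t v =>
      realPsi (polyEval (u t) v) (polyEval (isomSubst (kacRotIsom hij θ) (u t)) v))
      (Set.Icc 0 T ×ˢ kacSphere N) :=
    hasPartials₂_realPsi.zero.continuousOn.comp_pair hu.continuous.continuousOn
      hq.continuous.continuousOn fun x hx => hU x.1 hx.1 x.2 hx.2
  have hR₁ : ContinuousOn R₁ (Set.Icc 0 T) := by
    refine continuousOn_integral_kacSigma isCompact_Icc ?_
    have : Continuous fun x : ℝ × KacSpace N => 2 * N * (x.2 i ^ 2 + x.2 j ^ 2) := by fun_prop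
    exact this.continuousOn.mul hψc
  have hwK : ContinuousOn (Function.uncurry fun t (v : KacSpace N) =>
      (1 + (v i ^ 2 + v j ^ 2) - 4 * N * t) * K t v) (Set.Icc 0 T ×ˢ kacSphere N) := by
    have : Continuous fun x : ℝ × KacSpace N =>
      1 + (x.2 i ^ 2 + x.2 j ^ 2) - 4 * N * x.1 := by fun_prop
    exact this.continuousOn.mul hH
  have hR₂ : ContinuousOn R₂ (Set.Icc 0 T) := continuousOn_integral_kacSigma isCompact_Icc hwK
  refine le_trans ?_ hev'
  rw [← intervalIntegral.integral_const_mul]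
  have hD : ContinuousOn (fun t => pairDissipation i j (u t) θ) (Set.Icc 0 T) :=
    ContinuousOn.uncurry_left (f := fun θ t => pairDissipation i j (u t) θ) θ
      (Set.mem_singleton θ) (continuousOn_pairDissipation hij hu isCompact_Icc hpos
      isCompact_singleton)
  refine intervalIntegral.integral_mono_on hT0 ?_ ?_ fun t ht => ?_
  · refine ContinuousOn.intervalIntegrable ?_
    rw [Set.uIcc_of_le hT0]
    exact continuousOn_const.mul hD
  · refine ContinuousOn.intervalIntegrable ?_
    rw [Set.uIcc_of_le hT0]
    exact hR₁.add hR₂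
  have hR₁0 : 0 ≤ R₁ t := integral_nonneg_of_ae ((ae_mem_kacSphere N).mono fun v hv =>
    mul_nonneg (by positivity) (hψ t ht v hv))
  refine le_trans ?_ (le_add_of_nonneg_left hR₁0)
  rw [pairDissipation, ← integral_const_mul]
  have hDc := (continuousOn_pairDissipation_integrand hij hu hpos {θ}).uncurry_left (θ, t)
    (Set.mk_mem_prod (Set.mem_singleton θ) ht)
  refine integral_mono_kacSphere (continuousOn_const.mul hDc) (hwK.uncurry_left t ht)
    fun v hv => ?_
  have hf := (hU t ht v hv).1
  have hg := (hU t ht v hv).2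
  have e1 : rotLog i j (isomSubst (kacRotIsom hij θ) (u t)) v
      = rotLog i j (u t) (kacRotation i j θ v) := by
    rw [rotLog, rotLog, polyEval_rotDeriv_isomSubst hij θ _ hv, polyEval_isomSubst,
      kacRotIsom_apply]
  have key := le_rotHessian_realPsi hN hij (u t) (isomSubst (kacRotIsom hij θ) (u t)) hv hf hg
  rw [e1] at key
  have hK0 : 0 ≤ K t v := by
    simp only [K]
    rw [rotHessian_realPsi_eq _ _ hf hg]
    exact mul_nonneg (add_pos hf hg).le (Finset.sum_nonneg fun A _ => sq_nonneg _)
  have ht1 : 4 * N * t ≤ 1 := by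
    have := ht.2
    rw [hT, le_div_iff₀ (by positivity)] at this
    linarith
  simp only [polyEval_isomSubst, kacRotIsom_apply] at key ⊢
  refine key.trans ?_
  have : (v i ^ 2 + v j ^ 2) * K t v ≤ (1 + (v i ^ 2 + v j ^ 2) - 4 * N * t) * K t v :=
    mul_le_mul_of_nonneg_right (by linarith) hK0
  simpa only [K, polyEval_isomSubst, kacRotIsom_apply] using this

end PolynomialProduction

/-! ### Averaging over the angle of rotation -/

section Averaging
open MvPolynomial
variable {N : ℕ}

lemma hasRotDeriv_log {i j : Fin N} (hij : i ≠ j) {f : MvPolynomial (Fin N) ℝ}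
    (hf : PosOnSphere f) :
    HasRotDeriv i j (fun v => Real.log (polyEval f v)) (rotLog i j f) := by
  intro v hv
  have h := hasRotDeriv_polyEval hij f v hv
  have := h.log (by simpa only [kacRotation_zero] using (hf v hv).ne')
  simpa only [kacRotation_zero, rotLog] using this

lemma continuousOn_rotLog_slice {i j : Fin N} {f : MvPolynomial (Fin N) ℝ} (hf : PosOnSphere f) :
    ContinuousOn (rotLog i j f) (kacSphere N) :=
  (continuous_polyEval _).continuousOn.div (continuous_polyEval _).continuousOn
    fun v hv => (hf v hv).ne'

/-- The integral over all angles of `(a - ℓ(R_θ v))²` is at least `2π a²` when `ℓ` has mean zero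
over the orbit. -/
lemma two_pi_mul_sq_le {ℓ : ℝ → ℝ} (hc : Continuous ℓ)
    (h0 : ∫ θ in (0 : ℝ)..2 * Real.pi, ℓ θ = 0) (a : ℝ) :
    2 * Real.pi * a ^ 2 ≤ ∫ θ in (0 : ℝ)..2 * Real.pi, (a - ℓ θ) ^ 2 := by
  have hpi := Real.two_pi_pos
  have h1 : ∫ θ in (0 : ℝ)..2 * Real.pi, (a ^ 2 - 2 * a * ℓ θ) = 2 * Real.pi * a ^ 2 := by
    rw [intervalIntegral.integral_sub (continuous_const.intervalIntegrable _ _)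
      ((hc.intervalIntegrable _ _).const_mul _), intervalIntegral.integral_const_mul, h0]
    simp
  rw [← h1]
  refine intervalIntegral.integral_mono_on hpi.le ?_ ?_ fun θ _ => ?_
  · exact (continuous_const.sub (continuous_const.mul hc)).intervalIntegrable _ _
  · exact ((continuous_const.sub hc).pow 2).intervalIntegrable _ _
  · nlinarith [sq_nonneg (ℓ θ)]

lemma intervalIntegral_neg_orbit {i j : Fin N} (hij : i ≠ j) {φ φ' : KacSpace N → ℝ}
    (h : HasRotDeriv i j φ φ') (hc : ContinuousOn φ' (kacSphere N))
    {v : KacSpace N} (hv : v ∈ kacSphere N) :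
    ∫ θ in (0 : ℝ)..2 * Real.pi, φ' (kacRotation i j (-θ) v) = 0 := by
  have hper : ∀ θ, kacRotation i j (-θ) v = kacRotation i j (2 * Real.pi - θ) v := fun θ => by
    rw [← kacRotation_two_pi i j (-θ), neg_add_eq_sub]
  simp only [hper]
  rw [intervalIntegral.integral_comp_sub_left (fun θ => φ' (kacRotation i j θ v)), sub_self,
    sub_zero]
  exact h.intervalIntegral_eq_zero hij hc hv

lemma continuous_orbit {i j : Fin N} (hij : i ≠ j) {φ : KacSpace N → ℝ}
    (hc : ContinuousOn φ (kacSphere N)) {v : KacSpace N} (hv : v ∈ kacSphere N) :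
    Continuous fun θ => φ (kacRotation i j θ v) := by
  rw [← continuousOn_univ]
  exact ContinuousOn.uncurry_right (f := fun θ v => φ (kacRotation i j θ v)) v hv
    (continuousOn_comp_kacRotation hij hc Set.univ)

/-- Averaging over the angle: the derivatives of `log f` at rotated points have mean zero, so that
both halves of `pairDissipation` dominate the Fisher information in the plane of `i` and `j`. -/
lemma four_pi_mul_le_integral_pairDissipation [Fact (2 ≤ N)] {i j : Fin N} (hij : i ≠ j)
    {f : MvPolynomial (Fin N) ℝ} (hf : PosOnSphere f) :
    4 * Real.pi * ∫ v, polyEval (rotDeriv i j f) v ^ 2 / polyEval f v ∂kacSigma N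
      ≤ ∫ θ in (0 : ℝ)..2 * Real.pi, pairDissipation i j f θ := by
  have hpi := Real.two_pi_pos
  have cf := (continuous_polyEval f).continuousOn (s := kacSphere N)
  have cl := continuousOn_rotLog_slice (i := i) (j := j) hf
  have hR := hasRotDeriv_log hij hf
  have cneg : ∀ {φ : KacSpace N → ℝ}, ContinuousOn φ (kacSphere N) → ∀ s : Set ℝ,
      ContinuousOn (Function.uncurry fun θ v => φ (kacRotation i j (-θ) v)) (s ×ˢ kacSphere N) := by
    intro φ hφ s
    have : Continuous fun x : ℝ × KacSpace N => kacRotation i j (-x.1) x.2 :=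
      (continuous_kacRotation i j).comp
        (by fun_prop : Continuous fun x : ℝ × KacSpace N => (-x.1, x.2))
    exact hφ.comp this.continuousOn fun x hx => kacRotation_mem hij _ hx.2
  -- both halves are integrals of `f (ℓ - ℓ ∘ R_{±θ})²`
  let J : ℝ → ℝ → ℝ := fun σ θ => ∫ v, polyEval f v
    * (rotLog i j f v - rotLog i j f (kacRotation i j (σ * θ) v)) ^ 2 ∂kacSigma N
  have cJ : ∀ σ : ℝ, ContinuousOn (Function.uncurry fun θ v => polyEval f v
      * (rotLog i j f v - rotLog i j f (kacRotation i j (σ * θ) v)) ^ 2)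
      (Set.Icc 0 (2 * Real.pi) ×ˢ kacSphere N) := by
    intro σ
    have h1 : Continuous fun x : ℝ × KacSpace N => kacRotation i j (σ * x.1) x.2 :=
      (continuous_kacRotation i j).comp
        (by fun_prop : Continuous fun x : ℝ × KacSpace N => (σ * x.1, x.2))
    have h2 : ContinuousOn (fun x : ℝ × KacSpace N => rotLog i j f (kacRotation i j (σ * x.1) x.2))
        (Set.Icc 0 (2 * Real.pi) ×ˢ kacSphere N) :=
      cl.comp h1.continuousOn fun x hx => kacRotation_mem hij _ hx.2
    have h3 : ContinuousOn (fun x : ℝ × KacSpace N => rotLog i j f x.2)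
        (Set.Icc 0 (2 * Real.pi) ×ˢ kacSphere N) := cl.comp continuousOn_snd fun x hx => hx.2
    have h4 : ContinuousOn (fun x : ℝ × KacSpace N => polyEval f x.2)
        (Set.Icc 0 (2 * Real.pi) ×ˢ kacSphere N) := cf.comp continuousOn_snd fun x hx => hx.2
    exact h4.mul ((h3.sub h2).pow 2)
  have hJ : ∀ σ : ℝ, (∀ v ∈ kacSphere N,
      ∫ θ in (0 : ℝ)..2 * Real.pi, rotLog i j f (kacRotation i j (σ * θ) v) = 0) →
      2 * Real.pi * ∫ v, polyEval (rotDeriv i j f) v ^ 2 / polyEval f v ∂kacSigma N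
      ≤ ∫ θ in (0 : ℝ)..2 * Real.pi, J σ θ := by
    intro σ hσ
    rw [intervalIntegral_integral_swap hpi.le (cJ σ), ← integral_const_mul]
    refine integral_mono_ae ?_ ?_ ((ae_mem_kacSphere N).mono fun v hv => ?_)
    · exact integrable_of_continuousOn_kacSphere (continuousOn_const.mul
        (((continuous_polyEval _).continuousOn.pow 2).div cf fun v hv => (hf v hv).ne'))
    · have hint := (cJ σ).integrableOn_compact (μ := (volume : Measure ℝ).prod (kacSigma N))
        (isCompact_Icc.prod (isCompact_kacSphere N))
      rw [IntegrableOn, ← Measure.prod_restrict, restrict_kacSphere] at hint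
      simp only [intervalIntegral.integral_of_le hpi.le, ← integral_Icc_eq_integral_Ioc]
      exact hint.integral_prod_right
    · have hfv := hf v hv
      have hc : Continuous fun θ => rotLog i j f (kacRotation i j (σ * θ) v) :=
        (continuous_orbit hij cl hv).comp (continuous_const.mul continuous_id)
      have := mul_le_mul_of_nonneg_left (two_pi_mul_sq_le hc (hσ v hv) (rotLog i j f v)) hfv.le
      rw [← intervalIntegral.integral_const_mul] at this
      refine le_trans (le_of_eq ?_) this
      simp only [rotLog]
      field_simp
  have h1 := hJ 1 fun v hv => by
    simpa only [one_mul] using hR.intervalIntegral_eq_zero hij cl hv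
  have h2 := hJ (-1) fun v hv => by
    simpa only [neg_one_mul] using intervalIntegral_neg_orbit hij hR cl hv
  have hsplit : ∀ θ, pairDissipation i j f θ = J 1 θ + J (-1) θ := by
    intro θ
    have e : J (-1) θ = ∫ v, polyEval f (kacRotation i j θ v)
        * (rotLog i j f v - rotLog i j f (kacRotation i j θ v)) ^ 2 ∂kacSigma N := by
      simp only [J, neg_one_mul]
      rw [← integral_comp_kacRotation hij θ]
      refine integral_congr_ae (Filter.Eventually.of_forall fun v => ?_)
      simp only
      rw [← kacRotation_add hij, neg_add_cancel, kacRotation_zero]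
      ring
    have c1 : ContinuousOn (fun v => polyEval f (kacRotation i j θ v)) (kacSphere N) :=
      ContinuousOn.uncurry_left (f := fun θ v => polyEval f (kacRotation i j θ v)) θ
        (Set.mem_univ θ) (continuousOn_comp_kacRotation hij cf Set.univ)
    have c2 : ContinuousOn (fun v => rotLog i j f (kacRotation i j θ v)) (kacSphere N) :=
      ContinuousOn.uncurry_left (f := fun θ v => rotLog i j f (kacRotation i j θ v)) θ
        (Set.mem_univ θ) (continuousOn_comp_kacRotation hij cl Set.univ)
    rw [e]
    simp only [J, one_mul]
    rw [← integral_add]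
    · refine integral_congr_ae (Filter.Eventually.of_forall fun v => ?_)
      simp only
      ring
    · exact integrable_of_continuousOn_kacSphere (cf.mul ((cl.sub c2).pow 2))
    · exact integrable_of_continuousOn_kacSphere (c1.mul ((cl.sub c2).pow 2))
  have hJc : ∀ σ, IntervalIntegrable (J σ) volume 0 (2 * Real.pi) := by
    intro σ
    refine ContinuousOn.intervalIntegrable ?_
    rw [Set.uIcc_of_le hpi.le]
    exact continuousOn_integral_kacSigma isCompact_Icc (cJ σ)
  simp only [hsplit]
  rw [intervalIntegral.integral_add (hJc 1) (hJc (-1))]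
  linarith

end Averaging

/-! ### Villani's estimate for polynomial densities -/

section PolynomialVillani
open MvPolynomial
variable {N : ℕ}

lemma mul_log_sub_le_realPsi {x y : ℝ} (hx : 0 < x) (hy : 0 < y) :
    x * Real.log x - x * y + y ≤ realPsi x y := by
  have h1 := mul_le_mul_of_nonneg_left (Real.log_le_sub_one_of_pos hy) hx.le
  have h2 := mul_le_mul_of_nonneg_left (Real.log_le_sub_one_of_pos (div_pos hx hy)) hy.le
  rw [Real.log_div hx.ne' hy.ne', mul_sub, mul_sub, mul_div_cancel₀ _ hy.ne'] at h2
  unfold realPsi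
  nlinarith

lemma polyEntropy_nonneg [Fact (2 ≤ N)] {f : MvPolynomial (Fin N) ℝ} (hf : PosOnSphere f)
    (h1 : ∫ v, polyEval f v ∂kacSigma N = 1) : 0 ≤ polyEntropy f := by
  have cf := (continuous_polyEval f).continuousOn (s := kacSphere N)
  have e : ∫ v, (polyEval f v - 1) ∂kacSigma N = 0 := by
    rw [integral_sub (integrable_of_continuousOn_kacSphere cf) (integrable_const _), h1]
    simp
  rw [← e]
  refine integral_mono_kacSphere (cf.sub continuousOn_const)
    (cf.mul (continuousOn_comp_log cf hf)) fun v hv => ?_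
  have hx := hf v hv
  have := mul_le_mul_of_nonneg_left (Real.one_sub_inv_le_log_of_pos hx) hx.le
  rwa [mul_sub, mul_inv_cancel₀ hx.ne', mul_one] at this

lemma continuousOn_realPsi_kacRotation {i j : Fin N} (hij : i ≠ j)
    {f : MvPolynomial (Fin N) ℝ} (hf : PosOnSphere f) (s : Set ℝ) :
    ContinuousOn (Function.uncurry fun θ v =>
      realPsi (polyEval f v) (polyEval f (kacRotation i j θ v))) (s ×ˢ kacSphere N) := by
  have cf := (continuous_polyEval f).continuousOn (s := kacSphere N)
  have c1 : ContinuousOn (fun x : ℝ × KacSpace N => polyEval f x.2) (s ×ˢ kacSphere N) :=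
    cf.comp continuousOn_snd fun x hx => hx.2
  have c2 := continuousOn_comp_kacRotation hij cf s
  exact (c1.sub c2).mul ((c1.log fun x hx => (hf _ hx.2).ne').sub
    (c2.log fun x hx => (hf _ (kacRotation_mem hij _ hx.2)).ne'))

lemma continuousOn_psiIntegral [Fact (2 ≤ N)] {i j : Fin N} (hij : i ≠ j)
    {f : MvPolynomial (Fin N) ℝ} (hf : PosOnSphere f) {s : Set ℝ} (hs : IsCompact s) :
    ContinuousOn (psiIntegral i j f) s := by
  refine continuousOn_integral_kacSigma hs ?_
  have : Continuous fun x : ℝ × KacSpace N => 1 + (x.2 i ^ 2 + x.2 j ^ 2) := by fun_prop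
  exact this.continuousOn.mul (continuousOn_realPsi_kacRotation hij hf s)

/-- On the circle, averaging over all rotations gives the mean value. -/
lemma exists_intervalIntegral_orbit_eq (f : MvPolynomial (Fin 2) ℝ) :
    ∃ κ : ℝ, ∀ v ∈ kacSphere 2,
      ∫ θ in (0 : ℝ)..2 * Real.pi, polyEval f (kacRotation 0 1 θ v) = κ := by
  obtain ⟨n, c, h1, ⟨κ, h2⟩, h3⟩ := exists_hasEigenDecomp le_rfl f
  have hne : (0 : Fin 2) ≠ 1 := by decide
  have hT : ∀ p, sphereLaplacian 2 p = rotDeriv 0 1 (rotDeriv 0 1 p) := by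
    intro p
    rw [sphereLaplacian_apply, show kacPairs 2 = {(0, 1)} by decide, Finset.sum_singleton]
  refine ⟨∑ l ∈ Finset.range n, if l = 0 then 2 * Real.pi * κ else 0, fun v hv => ?_⟩
  have ci : ∀ l, Continuous fun θ => polyEval (c l) (kacRotation 0 1 θ v) := fun l =>
    continuous_orbit hne (continuous_polyEval _).continuousOn hv
  simp only [h3, polyEval_sum]
  rw [intervalIntegral.integral_finsetSum fun l _ => (ci l).intervalIntegrable _ _]
  refine Finset.sum_congr rfl fun l _ => ?_
  split_ifs with hl
  · subst hl
    simp [h2 _ (kacRotation_mem hne _ hv)]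
  · have hpos : 0 < sphereEigenvalue 2 l := by
      simpa using sphereEigenvalue_lt le_rfl (Nat.pos_of_ne_zero hl)
    have e : c l = -(sphereEigenvalue 2 l)⁻¹ • rotDeriv 0 1 (rotDeriv 0 1 (c l)) := by
      rw [← hT, h1, smul_smul, neg_mul_neg, inv_mul_cancel₀ hpos.ne', one_smul]
    have h := (hasRotDeriv_polyEval hne (rotDeriv 0 1 (c l))).intervalIntegral_eq_zero hne
      (continuous_polyEval _).continuousOn hv
    rw [e]
    simp only [polyEval_smul, intervalIntegral.integral_const_mul, h, mul_zero]

lemma two_pi_mul_polyEntropy_le (f : MvPolynomial (Fin 2) ℝ) (hf : PosOnSphere f)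
    (h1 : ∫ v, polyEval f v ∂kacSigma 2 = 1) :
    2 * Real.pi * polyEntropy f ≤ ∫ θ in (0 : ℝ)..2 * Real.pi, psiIntegral 0 1 f θ := by
  have : Fact (2 ≤ 2) := ⟨le_rfl⟩
  have hpi := Real.two_pi_pos
  have hne : (0 : Fin 2) ≠ 1 := by decide
  obtain ⟨κ, hκ⟩ := exists_intervalIntegral_orbit_eq f
  have cf := (continuous_polyEval f).continuousOn (s := kacSphere 2)
  have cl := cf.mul (continuousOn_comp_log cf hf)
  have crot := continuousOn_comp_kacRotation hne cf (Set.Icc 0 (2 * Real.pi))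
  have hκ1 : κ = 2 * Real.pi := by
    have h := intervalIntegral_integral_swap hpi.le crot
    rw [integral_congr_kacSphere hκ] at h
    simp only [integral_comp_kacRotation hne, h1] at h
    simpa using h.symm
  have c1 : ContinuousOn (fun x : ℝ × KacSpace 2 => polyEval f x.2 * Real.log (polyEval f x.2))
      (Set.Icc 0 (2 * Real.pi) ×ˢ kacSphere 2) := cl.comp continuousOn_snd fun x hx => hx.2
  have c2 : ContinuousOn (fun x : ℝ × KacSpace 2 => polyEval f x.2)
      (Set.Icc 0 (2 * Real.pi) ×ˢ kacSphere 2) := cf.comp continuousOn_snd fun x hx => hx.2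
  have cint : ContinuousOn (Function.uncurry fun θ v => polyEval f v * Real.log (polyEval f v)
      - polyEval f v * polyEval f (kacRotation 0 1 θ v) + polyEval f (kacRotation 0 1 θ v))
      (Set.Icc 0 (2 * Real.pi) ×ˢ kacSphere 2) := (c1.sub (c2.mul crot)).add crot
  have e : ∫ θ in (0 : ℝ)..2 * Real.pi, ∫ v, (polyEval f v * Real.log (polyEval f v)
      - polyEval f v * polyEval f (kacRotation 0 1 θ v) + polyEval f (kacRotation 0 1 θ v))
      ∂kacSigma 2 = 2 * Real.pi * polyEntropy f := by
    rw [intervalIntegral_integral_swap hpi.le cint]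
    have hv : ∀ v ∈ kacSphere 2, ∫ θ in (0 : ℝ)..2 * Real.pi,
        (polyEval f v * Real.log (polyEval f v)
        - polyEval f v * polyEval f (kacRotation 0 1 θ v) + polyEval f (kacRotation 0 1 θ v))
        = 2 * Real.pi * (polyEval f v * Real.log (polyEval f v) - polyEval f v + 1) := by
      intro v hv
      have ci := (continuous_orbit hne cf hv).intervalIntegrable (μ := volume) 0 (2 * Real.pi)
      rw [intervalIntegral.integral_add ((continuous_const.intervalIntegrable _ _).sub
        (ci.const_mul _)) ci, intervalIntegral.integral_sub
        (continuous_const.intervalIntegrable _ _) (ci.const_mul _),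
        intervalIntegral.integral_const, intervalIntegral.integral_const_mul, hκ v hv, hκ1]
      simp
      ring
    rw [integral_congr_kacSphere hv, integral_const_mul, integral_add, integral_sub, h1]
    · simp [polyEntropy]
    · exact integrable_of_continuousOn_kacSphere cl
    · exact integrable_of_continuousOn_kacSphere cf
    · exact (integrable_of_continuousOn_kacSphere cl).sub (integrable_of_continuousOn_kacSphere cf)
    · exact integrable_const _
  rw [← e]
  refine intervalIntegral.integral_mono_on hpi.le ?_ ?_ fun θ hθ => ?_
  · refine ContinuousOn.intervalIntegrable ?_
    rw [Set.uIcc_of_le hpi.le]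
    exact continuousOn_integral_kacSigma isCompact_Icc cint
  · refine ContinuousOn.intervalIntegrable ?_
    exact continuousOn_psiIntegral hne hf isCompact_uIcc
  · have cψ := continuousOn_realPsi_kacRotation hne hf (Set.Icc 0 (2 * Real.pi))
    refine integral_mono_kacSphere (cint.uncurry_left θ hθ) ?_ fun v hv => ?_
    · have : Continuous fun v : KacSpace 2 => 1 + (v 0 ^ 2 + v 1 ^ 2) := by fun_prop
      exact this.continuousOn.mul (cψ.uncurry_left θ hθ)
    · have hx := hf v hv
      have hy := hf _ (kacRotation_mem hne θ hv)
      have := realPsi_nonneg hx hy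
      refine (mul_log_sub_le_realPsi hx hy).trans ?_
      nlinarith [mul_nonneg (add_nonneg (sq_nonneg (v 0)) (sq_nonneg (v 1))) this]

/-- Villani's entropy production estimate for positive polynomial densities. -/
theorem polyEntropy_le_sum_psiIntegral [Fact (2 ≤ N)] {f : MvPolynomial (Fin N) ℝ}
    (hf : PosOnSphere f) (h1 : ∫ v, polyEval f v ∂kacSigma N = 1) :
    2 * Real.pi * (((N : ℝ) - 1) / 3) * polyEntropy f
      ≤ ∑ A ∈ kacPairs N, ∫ θ in (0 : ℝ)..2 * Real.pi, psiIntegral A.1 A.2 f θ := by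
  have hN : 2 ≤ N := Fact.out
  have hpi := Real.two_pi_pos
  have hH := polyEntropy_nonneg hf h1
  rcases hN.eq_or_lt with rfl | hN3
  · rw [show kacPairs 2 = {(0, 1)} by decide, Finset.sum_singleton]
    refine le_trans ?_ (two_pi_mul_polyEntropy_le f hf h1)
    push_cast
    nlinarith [mul_nonneg hpi.le hH]
  obtain ⟨u, hu, rfl, κ, hlim⟩ := exists_isHeatFlow hN f
  have hN' : (3 : ℝ) ≤ N := by exact_mod_cast hN3
  set T : ℝ := 1 / (4 * N) with hT
  have hT0 : 0 ≤ T := by positivity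
  have hpos : ∀ t ∈ Set.Icc 0 T, PosOnSphere (u t) := fun t ht => hu.posOnSphere hf ht.1
  have hJ := polyEntropy_le_integral_fisherInfo hN3 hu hf h1 hlim
  rw [← hT] at hJ
  set J := ∫ t in (0 : ℝ)..T, fisherInfo (u t)
  let I : Fin N × Fin N → ℝ → ℝ := fun A t =>
    ∫ v, polyEval (rotDeriv A.1 A.2 (u t)) v ^ 2 / polyEval (u t) v ∂kacSigma N
  have hIc : ∀ A, ContinuousOn (I A) (Set.Icc 0 T) := fun A =>
    continuousOn_integral_kacSigma isCompact_Icc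
      (((hu.rotDeriv A.1 A.2).continuous.continuousOn.pow 2).div hu.continuous.continuousOn
        fun x hx => (hpos x.1 hx.1 x.2 hx.2).ne')
  have hIi : ∀ A, IntervalIntegrable (I A) volume 0 T := fun A => by
    refine ContinuousOn.intervalIntegrable ?_
    rw [Set.uIcc_of_le hT0]
    exact hIc A
  have hJI : J = ∑ A ∈ kacPairs N, ∫ t in (0 : ℝ)..T, I A t := by
    rw [← intervalIntegral.integral_finsetSum fun A _ => hIi A]
    refine intervalIntegral.integral_congr fun t ht => ?_
    rw [Set.uIcc_of_le hT0] at ht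
    refine integral_finsetSum _ fun A _ => integrable_of_continuousOn_kacSphere ?_
    exact ((continuous_polyEval _).continuousOn.pow 2).div (continuous_polyEval _).continuousOn
      fun v hv => (hpos t ht v hv).ne'
  have hpair : ∀ A ∈ kacPairs N, 4 * Real.pi * N * ∫ t in (0 : ℝ)..T, I A t
      ≤ ∫ θ in (0 : ℝ)..2 * Real.pi, psiIntegral A.1 A.2 (u 0) θ := by
    intro A hA
    have hne := ne_of_mem_kacPairs hA
    have hD := continuousOn_pairDissipation hne hu isCompact_Icc hpos
      (isCompact_Icc (a := (0 : ℝ)) (b := 2 * Real.pi))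
    have hswap : ∫ θ in (0 : ℝ)..2 * Real.pi, ∫ t in (0 : ℝ)..T, pairDissipation A.1 A.2 (u t) θ
        = ∫ t in (0 : ℝ)..T, ∫ θ in (0 : ℝ)..2 * Real.pi, pairDissipation A.1 A.2 (u t) θ := by
      simp only [intervalIntegral.integral_of_le hpi.le, intervalIntegral.integral_of_le hT0,
        ← integral_Icc_eq_integral_Ioc]
      exact integral_swap_of_continuousOn isCompact_Icc isCompact_Icc hD
    have hint := hD.integrableOn_compact (μ := (volume : Measure ℝ).prod (volume : Measure ℝ))
      (isCompact_Icc.prod isCompact_Icc)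
    rw [IntegrableOn, ← Measure.prod_restrict] at hint
    have step1 : ∫ t in (0 : ℝ)..T, 4 * Real.pi * I A t
        ≤ ∫ t in (0 : ℝ)..T, ∫ θ in (0 : ℝ)..2 * Real.pi, pairDissipation A.1 A.2 (u t) θ := by
      refine intervalIntegral.integral_mono_on hT0 ((hIi A).const_mul _) ?_ fun t ht =>
        four_pi_mul_le_integral_pairDissipation hne (hpos t ht)
      rw [intervalIntegrable_iff_integrableOn_Icc_of_le hT0]
      simp only [intervalIntegral.integral_of_le hpi.le, ← integral_Icc_eq_integral_Ioc]
      exact hint.integral_prod_right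
    have step2 : ∫ θ in (0 : ℝ)..2 * Real.pi,
        N * ∫ t in (0 : ℝ)..T, pairDissipation A.1 A.2 (u t) θ
        ≤ ∫ θ in (0 : ℝ)..2 * Real.pi, psiIntegral A.1 A.2 (u 0) θ := by
      refine intervalIntegral.integral_mono_on hpi.le (IntervalIntegrable.const_mul ?_ _) ?_
        fun θ _ => integral_pairDissipation_le hne hu hf θ
      · rw [intervalIntegrable_iff_integrableOn_Icc_of_le hpi.le]
        simp only [intervalIntegral.integral_of_le hT0, ← integral_Icc_eq_integral_Ioc]
        exact hint.integral_prod_left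
      · exact (continuousOn_psiIntegral hne hf isCompact_uIcc).intervalIntegrable
    rw [intervalIntegral.integral_const_mul] at step1 step2
    rw [hswap] at step2
    have := mul_le_mul_of_nonneg_left step1 (Nat.cast_nonneg (α := ℝ) N)
    linarith
  refine le_trans ?_ (Finset.sum_le_sum hpair)
  rw [← Finset.mul_sum, ← hJI]
  -- `4πN (N - 2) / (3N - 2) ≥ 2π (N - 1) / 3`
  have h2 : (3 * (N : ℝ) - 2) * (2 * Real.pi * (((N : ℝ) - 1) / 3) * polyEntropy (u 0))
      ≤ (3 * (N : ℝ) - 2) * (4 * Real.pi * N * J) := by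
    have a1 : (3 * (N : ℝ) - 2) * (4 * Real.pi * N * J) =
      4 * Real.pi * N * ((3 * N - 2) * J) := by ring
    rw [a1]
    refine le_trans ?_ (mul_le_mul_of_nonneg_left hJ (by positivity))
    have a2 : 0 ≤ (3 * (N : ℝ) ^ 2 - 7 * N - 2) * (Real.pi * polyEntropy (u 0)) :=
      mul_nonneg (by nlinarith) (mul_nonneg Real.pi_pos.le hH)
    nlinarith
  exact le_of_mul_le_mul_left h2 (by linarith)

end PolynomialVillani

/-! ### A rotation invariant polynomial kernel -/

section Kernel
variable {N : ℕ}

/-- The affine function `1 + ⟨v, y⟩ / (2N)`, with values in `[1/2, 3/2]` on the sphere, whose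
powers concentrate on the diagonal. -/
def kernelBase (v y : KacSpace N) : ℝ := 1 + inner ℝ v y / (2 * N)

/-- The normalization of the `m`-th power of `kernelBase`. The inner integral does not depend
on `v`. -/
def kernelMass (N m : ℕ) : ℝ := ∫ v, ∫ y, kernelBase v y ^ m ∂kacSigma N ∂kacSigma N

/-- A rotation invariant Markov kernel on the sphere with polynomial density. -/
def kacKernel (m : ℕ) (v y : KacSpace N) : ℝ := kernelBase v y ^ m / kernelMass N m

lemma continuous_kernelBase :
    Continuous fun x : KacSpace N × KacSpace N => kernelBase x.1 x.2 := by
  unfold kernelBase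
  fun_prop

lemma kernelBase_comm (v y : KacSpace N) : kernelBase v y = kernelBase y v := by
  rw [kernelBase, kernelBase, real_inner_comm]

lemma kernelBase_map (e : KacSpace N ≃ₗᵢ[ℝ] KacSpace N) (v y : KacSpace N) :
    kernelBase (e v) (e y) = kernelBase v y := by
  rw [kernelBase, kernelBase, e.inner_map_map]

lemma kernelBase_eq [Fact (2 ≤ N)] {v y : KacSpace N} (hv : v ∈ kacSphere N)
    (hy : y ∈ kacSphere N) : kernelBase v y = 3 / 2 - dist v y ^ 2 / (4 * N) := by
  have hN : (0 : ℝ) < N := by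
    have : 2 ≤ N := Fact.out
    positivity
  have h1 := mem_kacSphere_iff_inner.mp hv
  have h2 := mem_kacSphere_iff_inner.mp hy
  rw [real_inner_self_eq_norm_sq] at h1 h2
  rw [kernelBase, dist_eq_norm, norm_sub_sq_real, h1, h2]
  field_simp
  ring

lemma half_le_kernelBase [Fact (2 ≤ N)] {v y : KacSpace N} (hv : v ∈ kacSphere N)
    (hy : y ∈ kacSphere N) : 1 / 2 ≤ kernelBase v y := by
  have hN : (0 : ℝ) < N := by
    have : 2 ≤ N := Fact.out
    positivity
  have h1 := mem_kacSphere_iff_inner.mp hv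
  have h2 := mem_kacSphere_iff_inner.mp hy
  have h3 := real_inner_self_nonneg (x := v + y)
  rw [real_inner_add_add_self, h1, h2] at h3
  rw [kernelBase]
  have : -(1 / 2) ≤ inner ℝ v y / (2 * (N : ℝ)) := by
    rw [le_div_iff₀ (by positivity)]
    linarith
  linarith

lemma exists_isometry_map {v w : KacSpace N} (hv : v ∈ kacSphere N) (hw : w ∈ kacSphere N) :
    ∃ e : KacSpace N ≃ₗᵢ[ℝ] KacSpace N, e v = w :=
  ⟨_, Submodule.reflection_sub (by
    rw [mem_sphere_zero_iff_norm.mp hv, mem_sphere_zero_iff_norm.mp hw])⟩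

lemma integral_comp_isometry (e : KacSpace N ≃ₗᵢ[ℝ] KacSpace N) (f : KacSpace N → ℝ) :
    ∫ v, f (e v) ∂kacSigma N = ∫ v, f v ∂kacSigma N :=
  (measurePreserving_kacSigma e).integral_comp e.toHomeomorph.measurableEmbedding f

lemma integral_kernelBase_pow [Fact (2 ≤ N)] (m : ℕ) {v : KacSpace N} (hv : v ∈ kacSphere N) :
    ∫ y, kernelBase v y ^ m ∂kacSigma N = kernelMass N m := by
  have h : ∀ w ∈ kacSphere N, ∫ y, kernelBase w y ^ m ∂kacSigma N
      = ∫ y, kernelBase v y ^ m ∂kacSigma N := by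
    intro w hw
    obtain ⟨e, rfl⟩ := exists_isometry_map hv hw
    rw [← integral_comp_isometry e]
    simp only [kernelBase_map]
  rw [kernelMass, integral_congr_kacSphere h]
  simp

lemma continuous_kernelBase_pow (m : ℕ) (v : KacSpace N) :
    Continuous fun y => kernelBase v y ^ m :=
  (continuous_kernelBase.comp (by fun_prop : Continuous fun y => (v, y))).pow m

lemma kernelMass_pos [Fact (2 ≤ N)] (m : ℕ) : 0 < kernelMass N m := by
  obtain ⟨v, hv⟩ := kacSphere_nonempty (N := N)
  rw [← integral_kernelBase_pow m hv]
  have h : ∫ _, ((1 : ℝ) / 2) ^ m ∂kacSigma N ≤ ∫ y, kernelBase v y ^ m ∂kacSigma N :=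
    integral_mono_kacSphere continuousOn_const (continuous_kernelBase_pow m v).continuousOn
      fun y hy => pow_le_pow_left₀ (by norm_num) (half_le_kernelBase hv hy) m
  refine lt_of_lt_of_le ?_ h
  simp

lemma continuous_kacKernel (m : ℕ) :
    Continuous fun x : KacSpace N × KacSpace N => kacKernel m x.1 x.2 :=
  (continuous_kernelBase.pow m).div_const _

lemma continuous_kacKernel_left (m : ℕ) (v : KacSpace N) : Continuous (kacKernel m v) :=
  (continuous_kernelBase_pow m v).div_const _

lemma kacKernel_comm (m : ℕ) (v y : KacSpace N) : kacKernel m v y = kacKernel m y v := by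
  rw [kacKernel, kacKernel, kernelBase_comm]

lemma kacKernel_map (m : ℕ) (e : KacSpace N ≃ₗᵢ[ℝ] KacSpace N) (v y : KacSpace N) :
    kacKernel m (e v) (e y) = kacKernel m v y := by
  rw [kacKernel, kacKernel, kernelBase_map]

lemma le_kacKernel [Fact (2 ≤ N)] (m : ℕ) {v y : KacSpace N} (hv : v ∈ kacSphere N)
    (hy : y ∈ kacSphere N) : (1 / 2) ^ m / kernelMass N m ≤ kacKernel m v y :=
  div_le_div_of_nonneg_right
    (pow_le_pow_left₀ (by norm_num) (half_le_kernelBase hv hy) m) (kernelMass_pos m).le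

lemma kacKernel_pos [Fact (2 ≤ N)] (m : ℕ) {v y : KacSpace N} (hv : v ∈ kacSphere N)
    (hy : y ∈ kacSphere N) : 0 < kacKernel m v y :=
  lt_of_lt_of_le (div_pos (by positivity) (kernelMass_pos m)) (le_kacKernel m hv hy)

lemma integral_kacKernel [Fact (2 ≤ N)] (m : ℕ) {v : KacSpace N} (hv : v ∈ kacSphere N) :
    ∫ y, kacKernel m v y ∂kacSigma N = 1 := by
  simp only [kacKernel]
  rw [integral_div, integral_kernelBase_pow m hv, div_self (kernelMass_pos m).ne']

/-- Off the diagonal the kernel tends to zero uniformly: it is at most `3/2 - δ²/4N` to the power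
`m`, while the normalization is at least `3/2 - δ²/16N` to that power times the measure of a ball of
radius `δ / 2`. -/
lemma exists_kacKernel_le [Fact (2 ≤ N)] {δ : ℝ} (hδ : 0 < δ) {ε : ℝ} (hε : 0 < ε) :
    ∀ᶠ m in Filter.atTop, ∀ v ∈ kacSphere N, ∀ y ∈ kacSphere N, δ ≤ dist v y →
      kacKernel m v y ≤ ε := by
  wlog hδ1 : δ ≤ 1 generalizing δ
  · filter_upwards [this one_pos le_rfl] with m hm v hv y hy h
    exact hm v hv y hy ((not_le.mp hδ1).le.trans h)
  have hN : (2 : ℝ) ≤ N := by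
    have : 2 ≤ N := Fact.out
    exact_mod_cast this
  obtain ⟨w, hw⟩ := kacSphere_nonempty (N := N)
  have hc : 0 < (kacSigma N).real (Metric.ball w (δ / 2)) :=
    ENNReal.toReal_pos (kacSigma_ball_pos hw (by positivity)).ne' (measure_ne_top _ _)
  set c := (kacSigma N).real (Metric.ball w (δ / 2))
  set a : ℝ := 3 / 2 - δ ^ 2 / (4 * N) with ha
  set b : ℝ := 3 / 2 - (δ / 2) ^ 2 / (4 * N) with hb
  have ha0 : 0 < a := by
    have : δ ^ 2 / (4 * N) ≤ 1 := by
      rw [div_le_one (by positivity)]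
      nlinarith
    linarith
  have hab : a < b := by
    have : (δ / 2) ^ 2 / (4 * N) < δ ^ 2 / (4 * N) :=
      div_lt_div_of_pos_right (by nlinarith) (by positivity)
    linarith
  have hb0 := ha0.trans hab
  have hmass : ∀ m, c * b ^ m ≤ kernelMass N m := by
    intro m
    rw [← integral_kernelBase_pow m hw]
    have h1 : ∫ y in Metric.ball w (δ / 2), b ^ m ∂kacSigma N = c * b ^ m := by
      simp [c]
    rw [← h1]
    have hi := integrable_of_continuousOn_kacSphere
      (continuous_kernelBase_pow m w).continuousOn (N := N)
    refine (setIntegral_mono_on_ae (integrable_const _).integrableOn hi.integrableOn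
      measurableSet_ball ?_).trans (setIntegral_le_integral hi ?_)
    · filter_upwards [ae_mem_kacSphere N] with y hy hyb
      refine pow_le_pow_left₀ hb0.le ?_ m
      rw [kernelBase_eq hw hy, hb]
      have : dist w y ≤ δ / 2 := by
        rw [dist_comm]
        exact (Metric.mem_ball.mp hyb).le
      gcongr
    · filter_upwards [ae_mem_kacSphere N] with y hy
      exact pow_nonneg ((by norm_num : (0 : ℝ) ≤ 1 / 2).trans (half_le_kernelBase hw hy)) m
  have hlim : Filter.Tendsto (fun m : ℕ => (a / b) ^ m / c) Filter.atTop (nhds 0) := by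
    have := (tendsto_pow_atTop_nhds_zero_of_lt_one (div_pos ha0 hb0).le
      ((div_lt_one hb0).mpr hab)).div_const c
    simpa using this
  filter_upwards [hlim.eventually (gt_mem_nhds hε)] with m hm v hv y hy hvy
  refine le_trans ?_ hm.le
  have h1 : kernelBase v y ^ m ≤ a ^ m := by
    refine pow_le_pow_left₀ ((by norm_num : (0 : ℝ) ≤ 1 / 2).trans (half_le_kernelBase hv hy)) ?_ m
    rw [kernelBase_eq hv hy, ha]
    gcongr
  rw [kacKernel, div_pow, div_div, mul_comm (b ^ m)]
  exact div_le_div₀ (by positivity) h1 (by positivity) (hmass m)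

/-- The Markov operator with kernel `kacKernel m`. -/
def kacSmooth (m : ℕ) (F : KacSpace N → ℝ) (v : KacSpace N) : ℝ :=
  ∫ y, kacKernel m v y * F y ∂kacSigma N

lemma integrable_continuousOn_mul {F g : KacSpace N → ℝ} (hF : Integrable F (kacSigma N))
    (hg : ContinuousOn g (kacSphere N)) : Integrable (fun v => g v * F v) (kacSigma N) := by
  have h := IntegrableOn.continuousOn_mul hg (hF.integrableOn (s := kacSphere N))
    (isCompact_kacSphere N)
  rwa [IntegrableOn, restrict_kacSphere] at h

lemma integrable_kacKernel_mul {F : KacSpace N → ℝ} (hF : Integrable F (kacSigma N)) (m : ℕ)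
    (v : KacSpace N) : Integrable (fun y => kacKernel m v y * F y) (kacSigma N) :=
  integrable_continuousOn_mul hF (continuous_kacKernel_left m v).continuousOn

/-- `kacSmooth m g` tends to `g` uniformly on the sphere if `g` is continuous there. -/
lemma eventually_abs_kacSmooth_sub_le [Fact (2 ≤ N)] {g : KacSpace N → ℝ}
    (hg : ContinuousOn g (kacSphere N)) {ε : ℝ} (hε : 0 < ε) :
    ∀ᶠ m in Filter.atTop, ∀ v ∈ kacSphere N, |kacSmooth m g v - g v| ≤ ε := by
  have hu := (isCompact_kacSphere N).uniformContinuousOn_of_continuous hg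
  obtain ⟨δ, hδ, hδ'⟩ := Metric.uniformContinuousOn_iff.mp hu (ε / 2) (by positivity)
  obtain ⟨B, hB⟩ := (isCompact_kacSphere N).exists_bound_of_continuousOn hg
  obtain ⟨w, hw⟩ := kacSphere_nonempty (N := N)
  have hB0 : 0 ≤ B := (norm_nonneg _).trans (hB w hw)
  filter_upwards [exists_kacKernel_le (N := N) hδ
    (show 0 < ε / 2 / (2 * B + 1) by positivity)] with m hm v hv
  have hgi := integrable_of_continuousOn_kacSphere hg
  have hk := integrable_of_continuousOn_kacSphere (N := N)
    (continuous_kacKernel_left m v).continuousOn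
  have e : kacSmooth m g v - g v = ∫ y, kacKernel m v y * (g y - g v) ∂kacSigma N := by
    simp only [mul_sub]
    rw [integral_sub (integrable_kacKernel_mul hgi m v) (hk.mul_const _), integral_mul_const,
      integral_kacKernel m hv, one_mul, kacSmooth]
  rw [e]
  refine (abs_integral_le_integral_abs).trans ?_
  have hbound : ∫ y, (kacKernel m v y * (ε / 2) + ε / 2) ∂kacSigma N = ε := by
    rw [integral_add (hk.mul_const _) (integrable_const _), integral_mul_const,
      integral_kacKernel m hv]
    simp
  rw [← hbound]
  refine integral_mono_of_nonneg (Filter.Eventually.of_forall fun y => abs_nonneg _)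
    ((hk.mul_const _).add (integrable_const _)) ?_
  filter_upwards [ae_mem_kacSphere N] with y hy
  have hk0 := kacKernel_pos m hv hy
  rw [abs_mul, abs_of_pos hk0]
  rcases lt_or_ge (dist v y) δ with h | h
  · have h1 : |g y - g v| ≤ ε / 2 := by
      have := hδ' y hy v hv (by rwa [dist_comm])
      rw [Real.dist_eq] at this
      exact this.le
    have := mul_le_mul_of_nonneg_left h1 hk0.le
    linarith
  · have h1 : |g y - g v| ≤ 2 * B := by
      have := norm_sub_le_of_le (hB y hy) (hB v hv)
      rw [Real.norm_eq_abs] at this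
      linarith
    have h2 := hm v hv y hy h
    have h3 : kacKernel m v y * |g y - g v| ≤ ε / 2 / (2 * B + 1) * (2 * B + 1) :=
      mul_le_mul h2 (by linarith) (abs_nonneg _) (by positivity)
    rw [div_mul_cancel₀ _ (by positivity)] at h3
    have : 0 ≤ kacKernel m v y * (ε / 2) := by positivity
    linarith

end Kernel

/-! ### Approximation by polynomial densities -/

section Smoothing
variable {N : ℕ}

lemma exists_polyEval_eq_integral {F : KacSpace N → ℝ} (hF : Integrable F (kacSigma N)) (m : ℕ) :
    ∃ p : MvPolynomial (Fin N) ℝ, ∀ v, polyEval p v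
      = ∫ y, kernelBase v y ^ m * F y ∂kacSigma N := by
  induction m generalizing F with
  | zero =>
    refine ⟨MvPolynomial.C (∫ y, F y ∂kacSigma N), fun v => ?_⟩
    simp
  | succ m ih =>
    have hk : ∀ k : Fin N, Integrable (fun y => y k * F y) (kacSigma N) := fun k =>
      integrable_continuousOn_mul hF (by fun_prop)
    obtain ⟨p, hp⟩ := ih hF
    choose q hq using fun k => ih (hk k)
    refine ⟨p + ∑ k, MvPolynomial.C (1 / (2 * (N : ℝ))) * (MvPolynomial.X k * q k), fun v => ?_⟩
    have hi : ∀ {G : KacSpace N → ℝ}, Integrable G (kacSigma N) →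
        Integrable (fun y => kernelBase v y ^ m * G y) (kacSigma N) := fun hG =>
      integrable_continuousOn_mul hG (continuous_kernelBase_pow m v).continuousOn
    have e : ∀ y, kernelBase v y ^ (m + 1) * F y = kernelBase v y ^ m * F y
        + ∑ k, 1 / (2 * (N : ℝ)) * (v k * (kernelBase v y ^ m * (y k * F y))) := by
      intro y
      have : kernelBase v y = 1 + ∑ k, 1 / (2 * (N : ℝ)) * (v k * y k) := by
        rw [kernelBase, PiLp.inner_apply, ← Finset.mul_sum, one_div_mul_eq_div]
        simp [mul_comm]
      rw [pow_succ]
      nth_rw 2 [this]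
      rw [mul_add, mul_one, add_mul, Finset.mul_sum, Finset.sum_mul]
      congr 1
      exact Finset.sum_congr rfl fun k _ => by ring
    simp only [e]
    rw [integral_add (hi hF) (integrable_finsetSum _ fun k _ =>
      ((hi (hk k)).const_mul _).const_mul _), integral_finsetSum _ fun k _ =>
      ((hi (hk k)).const_mul _).const_mul _]
    simp only [integral_const_mul, polyEval_add, polyEval_sum, polyEval_mul, polyEval_C,
      polyEval_X, hp, hq]

lemma exists_polyEval_eq_kacSmooth {F : KacSpace N → ℝ} (hF : Integrable F (kacSigma N)) (m : ℕ) :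
    ∃ p : MvPolynomial (Fin N) ℝ, ∀ v, polyEval p v = kacSmooth m F v := by
  obtain ⟨p, hp⟩ := exists_polyEval_eq_integral hF m
  refine ⟨MvPolynomial.C (kernelMass N m)⁻¹ * p, fun v => ?_⟩
  rw [polyEval_mul, polyEval_C, hp, kacSmooth, ← integral_const_mul]
  refine integral_congr_ae (Filter.Eventually.of_forall fun y => ?_)
  simp only [kacKernel]
  ring

lemma continuous_kacSmooth {F : KacSpace N → ℝ} (hF : Integrable F (kacSigma N)) (m : ℕ) :
    Continuous (kacSmooth m F) := by
  obtain ⟨p, hp⟩ := exists_polyEval_eq_kacSmooth hF m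
  exact (continuous_polyEval p).congr hp

lemma kacSmooth_pos [Fact (2 ≤ N)] {F : KacSpace N → ℝ} (hF : Integrable F (kacSigma N))
    (h0 : ∀ v, 0 ≤ F v) (h1 : 0 < ∫ v, F v ∂kacSigma N) (m : ℕ) {v : KacSpace N}
    (hv : v ∈ kacSphere N) : 0 < kacSmooth m F v := by
  have hc : 0 < (1 / 2 : ℝ) ^ m / kernelMass N m := div_pos (by positivity) (kernelMass_pos m)
  refine lt_of_lt_of_le (mul_pos hc h1) ?_
  rw [← integral_const_mul]
  refine integral_mono_ae (hF.const_mul _) (integrable_kacKernel_mul hF m v) ?_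
  filter_upwards [ae_mem_kacSphere N] with y hy
  exact mul_le_mul_of_nonneg_right (le_kacKernel m hv hy) (h0 y)

lemma kacSmooth_comp (m : ℕ) (e : KacSpace N ≃ₗᵢ[ℝ] KacSpace N) (F : KacSpace N → ℝ)
    (v : KacSpace N) : kacSmooth m (fun y => F (e y)) v = kacSmooth m F (e v) := by
  rw [kacSmooth, kacSmooth, ← integral_comp_isometry e fun y => kacKernel m (e v) y * F y]
  simp only [kacKernel_map]

lemma integrable_kacKernel_mul_prod [Fact (2 ≤ N)] {F : KacSpace N → ℝ}
    (hF : Integrable F (kacSigma N)) (m : ℕ) :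
    Integrable (fun x : KacSpace N × KacSpace N => kacKernel m x.1 x.2 * F x.2)
      ((kacSigma N).prod (kacSigma N)) := by
  have h := IntegrableOn.continuousOn_mul (continuous_kacKernel m).continuousOn
    ((hF.comp_snd (kacSigma N)).integrableOn (s := kacSphere N ×ˢ kacSphere N))
    ((isCompact_kacSphere N).prod (isCompact_kacSphere N))
  rwa [IntegrableOn, ← Measure.prod_restrict, restrict_kacSphere] at h

lemma integral_kacSmooth [Fact (2 ≤ N)] {F : KacSpace N → ℝ} (hF : Integrable F (kacSigma N))
    (m : ℕ) : ∫ v, kacSmooth m F v ∂kacSigma N = ∫ v, F v ∂kacSigma N := by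
  simp only [kacSmooth]
  rw [integral_integral_swap (integrable_kacKernel_mul_prod hF m)]
  simp only [integral_mul_const]
  refine integral_congr_kacSphere fun y hy => ?_
  simp only [kacKernel_comm m _ y]
  rw [integral_kacKernel m hy, one_mul]

lemma integrable_kacSmooth [Fact (2 ≤ N)] {F : KacSpace N → ℝ} (hF : Integrable F (kacSigma N))
    (m : ℕ) : Integrable (kacSmooth m F) (kacSigma N) :=
  integrable_of_continuousOn_kacSphere (continuous_kacSmooth hF m).continuousOn

/-- Markov operators are contractions in `L¹`. -/
lemma integral_abs_kacSmooth_le [Fact (2 ≤ N)] {F : KacSpace N → ℝ}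
    (hF : Integrable F (kacSigma N)) (m : ℕ) :
    ∫ v, |kacSmooth m F v| ∂kacSigma N ≤ ∫ v, |F v| ∂kacSigma N := by
  rw [← integral_kacSmooth hF.abs m]
  refine integral_mono_ae (integrable_kacSmooth hF m).abs (integrable_kacSmooth hF.abs m) ?_
  filter_upwards [ae_mem_kacSphere N] with v hv
  refine abs_integral_le_integral_abs.trans (le_of_eq ?_)
  refine integral_congr_kacSphere fun y hy => ?_
  rw [abs_mul, abs_of_pos (kacKernel_pos m hv hy)]

lemma kacSmooth_sub {F G : KacSpace N → ℝ} (hF : Integrable F (kacSigma N))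
    (hG : Integrable G (kacSigma N)) (m : ℕ) (v : KacSpace N) :
    kacSmooth m (fun y => F y - G y) v = kacSmooth m F v - kacSmooth m G v := by
  simp only [kacSmooth, mul_sub]
  exact integral_sub (integrable_kacKernel_mul hF m v) (integrable_kacKernel_mul hG m v)

/-- `kacSmooth m F` tends to `F` in `L¹`. -/
lemma eventually_integral_abs_kacSmooth_sub_le [Fact (2 ≤ N)] {F : KacSpace N → ℝ}
    (hF : Integrable F (kacSigma N)) {ε : ℝ} (hε : 0 < ε) :
    ∀ᶠ m in Filter.atTop, ∫ v, |kacSmooth m F v - F v| ∂kacSigma N ≤ ε := by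
  obtain ⟨g, hg, hgi⟩ := hF.exists_boundedContinuous_integral_sub_le
    (show 0 < ε / 3 by positivity)
  simp only [Real.norm_eq_abs] at hg
  filter_upwards [eventually_abs_kacSmooth_sub_le g.continuous.continuousOn (N := N)
    (show 0 < ε / 3 by positivity)] with m hm
  have hd : Integrable (fun v => F v - g v) (kacSigma N) := hF.sub hgi
  have i1 : Integrable (fun v => |kacSmooth m (fun y => F y - g y) v|) (kacSigma N) :=
    (integrable_kacSmooth hd m).abs
  have i2 : Integrable (fun v => |kacSmooth m (fun y => F y - g y) v| + ε / 3) (kacSigma N) :=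
    i1.add (integrable_const _)
  have h1 := integral_abs_kacSmooth_le hd m
  have key : ∫ v, |kacSmooth m F v - F v| ∂kacSigma N
      ≤ ∫ v, (|kacSmooth m (fun y => F y - g y) v| + ε / 3 + |F v - g v|) ∂kacSigma N := by
    refine integral_mono_ae ((integrable_kacSmooth hF m).sub hF).abs
      (i2.add hd.abs) ?_
    filter_upwards [ae_mem_kacSphere N] with v hv
    have := hm v hv
    rw [kacSmooth_sub hF hgi]
    have e : kacSmooth m F v - F v = (kacSmooth m F v - kacSmooth m g v)
      + (kacSmooth m g v - g v) - (F v - g v) := by ring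
    rw [e]
    refine (abs_sub _ _).trans (add_le_add_left ((abs_add_le _ _).trans ?_) _)
    linarith
  refine key.trans ?_
  rw [integral_add i2 hd.abs, integral_add i1 (integrable_const _)]
  simp only [integral_const, probReal_univ, one_smul]
  linarith

lemma one_add_mul_log_nonneg {x : ℝ} (hx : 0 ≤ x) : 0 ≤ 1 + x * Real.log x := by
  rcases hx.eq_or_lt with rfl | hx
  · simp
  · have := mul_le_mul_of_nonneg_left (Real.one_sub_inv_le_log_of_pos hx) hx.le
    rw [mul_sub, mul_inv_cancel₀ hx.ne', mul_one] at this
    linarith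

/-- Lower semicontinuity of the entropy along the approximations: `F log F ≥ -1` and an almost
everywhere convergent subsequence allow Fatou's lemma. -/
lemma kacEntropy_le_of_eventually_le [Fact (2 ≤ N)] {F : KacSpace N → ℝ}
    (hF : Integrable F (kacSigma N)) (h0 : ∀ v, 0 ≤ F v) (h1 : 0 < ∫ v, F v ∂kacSigma N) {B : ℝ}
    (hB : ∀ᶠ m in Filter.atTop,
      ∫ v, kacSmooth m F v * Real.log (kacSmooth m F v) ∂kacSigma N ≤ B) :
    kacEntropy F ≤ ENNReal.ofReal B := by
  have hme : TendstoInMeasure (kacSigma N) (fun m => kacSmooth m F) Filter.atTop F := by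
    refine tendstoInMeasure_of_tendsto_eLpNorm one_ne_zero
      (fun m => (integrable_kacSmooth hF m).aestronglyMeasurable) hF.aestronglyMeasurable ?_
    rw [ENNReal.tendsto_nhds_zero]
    intro ε hε
    rcases eq_or_ne ε ⊤ with rfl | hεt
    · simp
    filter_upwards [eventually_integral_abs_kacSmooth_sub_le hF
      (ENNReal.toReal_pos hε.ne' hεt)] with m hm
    rw [eLpNorm_one_eq_lintegral_enorm, ← ofReal_integral_norm_eq_lintegral_enorm
      ((integrable_kacSmooth hF m).sub hF)]
    exact ENNReal.ofReal_le_of_le_toReal hm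
  obtain ⟨ns, hns, hae⟩ := hme.exists_seq_tendsto_ae
  have cφ : Continuous fun x : ℝ => 1 + x * Real.log x :=
    continuous_const.add Real.continuous_mul_log
  have cφm : ∀ m, Integrable (fun v => 1 + kacSmooth m F v * Real.log (kacSmooth m F v))
      (kacSigma N) := fun m =>
    integrable_of_continuousOn_kacSphere (cφ.comp (continuous_kacSmooth hF m)).continuousOn
  have hsi : ∀ m, Integrable (fun v => kacSmooth m F v * Real.log (kacSmooth m F v))
      (kacSigma N) := fun m => integrable_of_continuousOn_kacSphere
    (Real.continuous_mul_log.comp (continuous_kacSmooth hF m)).continuousOn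
  have hsm : ∀ m, ∀ᵐ v ∂kacSigma N, 0 ≤ 1 + kacSmooth m F v * Real.log (kacSmooth m F v) :=
    fun m => (ae_mem_kacSphere N).mono fun v hv =>
      one_add_mul_log_nonneg (kacSmooth_pos hF h0 h1 m hv).le
  have hB' : ∀ᶠ k in Filter.atTop, ∫⁻ v, ENNReal.ofReal
      (1 + kacSmooth (ns k) F v * Real.log (kacSmooth (ns k) F v)) ∂kacSigma N
      ≤ ENNReal.ofReal (1 + B) := by
    filter_upwards [hns.tendsto_atTop.eventually hB] with k hk
    rw [← ofReal_integral_eq_lintegral_ofReal (cφm _) (hsm _)]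
    refine ENNReal.ofReal_le_ofReal ?_
    rw [integral_add (integrable_const _) (hsi _)]
    simpa using hk
  have hlim : ∫⁻ v, ENNReal.ofReal (1 + F v * Real.log (F v)) ∂kacSigma N
      ≤ ENNReal.ofReal (1 + B) := by
    calc ∫⁻ v, ENNReal.ofReal (1 + F v * Real.log (F v)) ∂kacSigma N
        = ∫⁻ v, Filter.liminf (fun k => ENNReal.ofReal
          (1 + kacSmooth (ns k) F v * Real.log (kacSmooth (ns k) F v))) Filter.atTop
            ∂kacSigma N := by
          refine lintegral_congr_ae ?_
          filter_upwards [hae] with v hv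
          exact (((ENNReal.continuous_ofReal.comp cφ).tendsto _).comp hv).liminf_eq.symm
      _ ≤ Filter.liminf (fun k => ∫⁻ v, ENNReal.ofReal
          (1 + kacSmooth (ns k) F v * Real.log (kacSmooth (ns k) F v)) ∂kacSigma N)
            Filter.atTop :=
          lintegral_liminf_le' fun k => (cφm _).aemeasurable.ennreal_ofReal
      _ ≤ Filter.liminf (fun _ : ℕ => ENNReal.ofReal (1 + B)) Filter.atTop :=
          Filter.liminf_le_liminf hB'
      _ = ENNReal.ofReal (1 + B) := Filter.liminf_const _
  have hφi : Integrable (fun v => 1 + F v * Real.log (F v)) (kacSigma N) := by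
    refine ⟨(cφ.measurable.comp_aemeasurable hF.aemeasurable).aestronglyMeasurable, ?_⟩
    rw [hasFiniteIntegral_iff_ofReal
      (Filter.Eventually.of_forall fun v => one_add_mul_log_nonneg (h0 v))]
    exact hlim.trans_lt ENNReal.ofReal_lt_top
  have hi : Integrable (fun v => F v * Real.log (F v)) (kacSigma N) :=
    (hφi.sub (integrable_const (1 : ℝ))).congr (Filter.Eventually.of_forall fun v => by simp)
  rw [kacEntropy, if_pos hi]
  refine ENNReal.ofReal_le_ofReal ?_
  rw [← ofReal_integral_eq_lintegral_ofReal hφi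
    (Filter.Eventually.of_forall fun v => one_add_mul_log_nonneg (h0 v)),
    integral_add (integrable_const _) hi] at hlim
  simp only [integral_const, probReal_univ, one_smul] at hlim
  by_contra! hlt
  -- `1 + B` is nonnegative, as it bounds the integrals of nonnegative functions
  have h2 : 0 ≤ 1 + B := by
    obtain ⟨m, hm⟩ := hB.exists
    have h3 := integral_nonneg_of_ae (hsm m)
    rw [integral_add (integrable_const _) (hsi _)] at h3
    simp only [integral_const, probReal_univ, one_smul] at h3
    linarith
  have := (ENNReal.ofReal_le_ofReal_iff h2).mp hlim
  linarith

end Smoothing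

/-! ### Villani's estimate for general densities -/

section Villani
variable {N : ℕ}

lemma measurable_kacPsi : Measurable (Function.uncurry kacPsi) := by
  unfold kacPsi Function.uncurry
  refine Measurable.ite (measurableSet_eq_fun measurable_fst measurable_snd) measurable_const
    (Measurable.ite ?_ measurable_const ?_)
  · exact (measurableSet_eq_fun measurable_fst measurable_const).union
      (measurableSet_eq_fun measurable_snd measurable_const)
  · fun_prop

lemma kacPsi_of_pos {x y : ℝ} (hx : 0 < x) (hy : 0 < y) :
    kacPsi x y = ENNReal.ofReal (realPsi x y) := by
  rw [kacPsi, realPsi]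
  split_ifs with h1 h2
  · simp [h1]
  · rcases h2 with h2 | h2
    · exact absurd h2 hx.ne'
    · exact absurd h2 hy.ne'
  · rw [Real.log_div hx.ne' hy.ne']

/-- The supporting hyperplane at `(x₀, y₀)` of the convex, positively homogeneous function `ψ`. -/
lemma ofReal_tangent_le_kacPsi {x₀ y₀ x y : ℝ} (hx₀ : 0 < x₀) (hy₀ : 0 < y₀) (hx : 0 ≤ x)
    (hy : 0 ≤ y) :
    ENNReal.ofReal ((Real.log x₀ - Real.log y₀ + 1 - y₀ / x₀) * x
      + (-(Real.log x₀ - Real.log y₀) + 1 - x₀ / y₀) * y) ≤ kacPsi x y := by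
  set r := y₀ / x₀ with hr
  have hr0 : 0 < r := div_pos hy₀ hx₀
  have hr' : x₀ / y₀ = r⁻¹ := (inv_div _ _).symm
  have hL : Real.log x₀ - Real.log y₀ = -Real.log r := by
    rw [hr, Real.log_div hy₀.ne' hx₀.ne']
    ring
  rw [hr', hL]
  rcases eq_or_ne x y with rfl | hxy
  · rw [ENNReal.ofReal_eq_zero.mpr]
    · exact zero_le
    have : 2 - r - r⁻¹ ≤ 0 := by
      have : r * r⁻¹ = 1 := mul_inv_cancel₀ hr0.ne'
      nlinarith [sq_nonneg (r - 1), inv_pos.mpr hr0]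
    nlinarith [mul_nonneg hx (neg_nonneg.mpr this)]
  by_cases h : x = 0 ∨ y = 0
  · rw [kacPsi, if_neg hxy, if_pos h]
    exact le_top
  push Not at h
  have hx' := hx.lt_of_ne' h.1
  have hy' := hy.lt_of_ne' h.2
  rw [kacPsi_of_pos hx' hy']
  refine ENNReal.ofReal_le_ofReal ?_
  have h1 := mul_le_mul_of_nonneg_left
    (Real.log_le_sub_one_of_pos (div_pos (mul_pos hr0 hx') hy')) hy
  have h2 := mul_le_mul_of_nonneg_left
    (Real.log_le_sub_one_of_pos (div_pos hy' (mul_pos hr0 hx'))) hx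
  rw [Real.log_div (mul_pos hr0 hx').ne' hy'.ne', Real.log_mul hr0.ne' hx'.ne'] at h1
  rw [Real.log_div hy'.ne' (mul_pos hr0 hx').ne', Real.log_mul hr0.ne' hx'.ne'] at h2
  have e1 : y * (r * x / y - 1) = r * x - y := by field_simp
  have e2 : x * (y / (r * x) - 1) = r⁻¹ * y - x := by field_simp
  rw [e1] at h1
  rw [e2] at h2
  unfold realPsi
  nlinarith

lemma ofReal_integral_le_lintegral_ofReal {α : Type*} [MeasurableSpace α] {μ : Measure α}
    {f : α → ℝ} (hf : Integrable f μ) :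
    ENNReal.ofReal (∫ x, f x ∂μ) ≤ ∫⁻ x, ENNReal.ofReal (f x) ∂μ := by
  have h := ofReal_integral_eq_lintegral_ofReal hf.pos_part
    (Filter.Eventually.of_forall fun x => le_max_right _ _)
  simp only [ENNReal.ofReal_max, ENNReal.ofReal_zero, max_zero] at h
  rw [← h]
  exact ENNReal.ofReal_le_ofReal
    (integral_mono hf hf.pos_part fun x => le_max_left _ _)

/-- Jensen's inequality for `ψ` and the Markov operator `kacSmooth m`. -/
lemma kacPsi_kacSmooth_le [Fact (2 ≤ N)] {F G : KacSpace N → ℝ} (hF : Integrable F (kacSigma N))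
    (hG : Integrable G (kacSigma N)) (hF0 : ∀ v, 0 ≤ F v) (hG0 : ∀ v, 0 ≤ G v) (m : ℕ)
    {v : KacSpace N} (hv : v ∈ kacSphere N) (hFv : 0 < kacSmooth m F v)
    (hGv : 0 < kacSmooth m G v) :
    ENNReal.ofReal (realPsi (kacSmooth m F v) (kacSmooth m G v))
      ≤ ∫⁻ y, ENNReal.ofReal (kacKernel m v y) * kacPsi (F y) (G y) ∂kacSigma N := by
  set x₀ := kacSmooth m F v with hx₀
  set y₀ := kacSmooth m G v with hy₀
  set a := Real.log x₀ - Real.log y₀ + 1 - y₀ / x₀ with ha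
  set b := -(Real.log x₀ - Real.log y₀) + 1 - x₀ / y₀ with hb
  have i1 := (integrable_kacKernel_mul hF m v).const_mul a
  have i2 := (integrable_kacKernel_mul hG m v).const_mul b
  have e : realPsi x₀ y₀ = ∫ y, (a * (kacKernel m v y * F y) + b * (kacKernel m v y * G y))
      ∂kacSigma N := by
    rw [integral_add i1 i2, integral_const_mul, integral_const_mul]
    change realPsi x₀ y₀ = a * x₀ + b * y₀
    rw [realPsi, ha, hb]
    field_simp
    ring
  rw [e]
  refine (ofReal_integral_le_lintegral_ofReal (i1.add i2)).trans ?_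
  refine lintegral_mono_ae ?_
  filter_upwards [ae_mem_kacSphere N] with y hy
  have e2 : a * (kacKernel m v y * F y) + b * (kacKernel m v y * G y)
      = kacKernel m v y * (a * F y + b * G y) := by ring
  simp only [Pi.add_apply]
  rw [e2, ENNReal.ofReal_mul (kacKernel_pos m hv hy).le]
  exact mul_le_mul_right (ofReal_tangent_le_kacPsi hFv hGv (hF0 y) (hG0 y)) _

/-- The integral of `ψ(F, F ∘ R)` with weight `(1 + v_i² + v_j²)^γ`, for one pair and one angle. -/
def kacPairIntegral (γ : ℝ) (F : KacSpace N → ℝ) (i j : Fin N) (θ : ℝ) : ℝ≥0∞ :=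
  ∫⁻ v, ENNReal.ofReal ((1 + (v i ^ 2 + v j ^ 2)) ^ γ) * kacPsi (F v) (F (kacRotation i j θ v))
    ∂kacSigma N

lemma lintegral_kacKernel_mul [Fact (2 ≤ N)] {g : KacSpace N → ℝ}
    (hg : Continuous g) (hg0 : ∀ v, 0 ≤ g v) (m : ℕ) {y : KacSpace N} (hy : y ∈ kacSphere N) :
    ∫⁻ v, ENNReal.ofReal (g v) * ENNReal.ofReal (kacKernel m v y) ∂kacSigma N
      = ENNReal.ofReal (kacSmooth m g y) := by
  have hi := integrable_of_continuousOn_kacSphere (N := N) hg.continuousOn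
  rw [kacSmooth, ofReal_integral_eq_lintegral_ofReal (integrable_kacKernel_mul hi m y)]
  · refine lintegral_congr fun v => ?_
    rw [← ENNReal.ofReal_mul (hg0 v), mul_comm, kacKernel_comm]
  · filter_upwards [ae_mem_kacSphere N] with v hv
    exact mul_nonneg (kacKernel_pos m hy hv).le (hg0 v)

/-- Smoothing decreases the weighted integral of `ψ`, up to a factor that tends to one. -/
lemma psi_kacSmooth_le [Fact (2 ≤ N)] {F : KacSpace N → ℝ} (hFm : Measurable F)
    (hF : Integrable F (kacSigma N)) (h0 : ∀ v, 0 ≤ F v) (h1 : 0 < ∫ v, F v ∂kacSigma N)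
    {i j : Fin N} (hij : i ≠ j) {m : ℕ} {δ : ℝ} (hδ : 0 ≤ δ)
    (hm : ∀ v ∈ kacSphere N, |kacSmooth m (fun v => 1 + (v i ^ 2 + v j ^ 2)) v
      - (1 + (v i ^ 2 + v j ^ 2))| ≤ δ) (θ : ℝ) :
    ∫⁻ v, ENNReal.ofReal (1 + (v i ^ 2 + v j ^ 2)) *
      ENNReal.ofReal (realPsi (kacSmooth m F v) (kacSmooth m F (kacRotation i j θ v))) ∂kacSigma N
      ≤ ENNReal.ofReal (1 + δ) * kacPairIntegral 1 F i j θ := by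
  set w : KacSpace N → ℝ := fun v => 1 + (v i ^ 2 + v j ^ 2) with hw
  have hwc : Continuous w := by fun_prop
  have hw1 : ∀ v, 1 ≤ w v := fun v => by simp only [hw]; nlinarith [sq_nonneg (v i), sq_nonneg (v j)]
  have hw0 : ∀ v, 0 ≤ w v := fun v => zero_le_one.trans (hw1 v)
  have hrc : Continuous (kacRotation i j θ) := (kacRotIsom hij θ).continuous
  let G : KacSpace N → ℝ := fun v => F (kacRotation i j θ v)
  have hG : Integrable G (kacSigma N) :=
    (measurePreserving_kacRotation hij θ).integrable_comp_of_integrable hF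
  have hGm : Measurable G := hFm.comp hrc.measurable
  have hψm : Measurable fun y => kacPsi (F y) (G y) := measurable_kacPsi.comp (hFm.prodMk hGm)
  have hGs : ∀ v, kacSmooth m F (kacRotation i j θ v) = kacSmooth m G v := fun v =>
    (kacSmooth_comp m (kacRotIsom hij θ) F v).symm
  have hkm : Measurable fun x : KacSpace N × KacSpace N => ENNReal.ofReal (kacKernel m x.1 x.2) :=
    (continuous_kacKernel m).measurable.ennreal_ofReal
  calc _ ≤ ∫⁻ v, ∫⁻ y, ENNReal.ofReal (w v) * (ENNReal.ofReal (kacKernel m v y)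
        * kacPsi (F y) (G y)) ∂kacSigma N ∂kacSigma N := by
        refine lintegral_mono_ae ?_
        filter_upwards [ae_mem_kacSphere N] with v hv
        rw [lintegral_const_mul' _ _ ENNReal.ofReal_ne_top]
        refine mul_le_mul_right ?_ _
        rw [hGs]
        refine kacPsi_kacSmooth_le hF hG h0 (fun v => h0 _) m hv (kacSmooth_pos hF h0 h1 m hv) ?_
        rw [← hGs]
        exact kacSmooth_pos hF h0 h1 m (kacRotation_mem hij θ hv)
    _ = ∫⁻ y, ∫⁻ v, ENNReal.ofReal (w v) * (ENNReal.ofReal (kacKernel m v y)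
        * kacPsi (F y) (G y)) ∂kacSigma N ∂kacSigma N := by
        refine lintegral_lintegral_swap (Measurable.aemeasurable ?_)
        exact (hwc.measurable.comp measurable_fst).ennreal_ofReal.mul
          (hkm.mul (hψm.comp measurable_snd))
    _ = ∫⁻ y, ENNReal.ofReal (kacSmooth m w y) * kacPsi (F y) (G y) ∂kacSigma N := by
        refine lintegral_congr_ae ?_
        filter_upwards [ae_mem_kacSphere N] with y hy
        have hk : Measurable fun v => ENNReal.ofReal (kacKernel m v y) := by
          simp only [kacKernel_comm m _ y]
          exact (continuous_kacKernel_left m y).measurable.ennreal_ofReal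
        have hwk : Measurable fun v => ENNReal.ofReal (w v) * ENNReal.ofReal (kacKernel m v y) :=
          hwc.measurable.ennreal_ofReal.mul hk
        rw [← lintegral_kacKernel_mul hwc hw0 m hy, ← lintegral_mul_const _ hwk]
        simp only [mul_assoc]
    _ ≤ ∫⁻ y, ENNReal.ofReal (1 + δ) * (ENNReal.ofReal (w y ^ (1 : ℝ)) * kacPsi (F y) (G y))
        ∂kacSigma N := by
        refine lintegral_mono_ae ?_
        filter_upwards [ae_mem_kacSphere N] with y hy
        rw [← mul_assoc, ← ENNReal.ofReal_mul (by linarith), Real.rpow_one]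
        refine mul_le_mul_left (ENNReal.ofReal_le_ofReal ?_) _
        have := (abs_le.mp (hm y hy)).2
        nlinarith [mul_le_mul_of_nonneg_left (hw1 y) hδ]
    _ = ENNReal.ofReal (1 + δ) * kacPairIntegral 1 F i j θ := by
        rw [lintegral_const_mul' _ _ ENNReal.ofReal_ne_top, kacPairIntegral]

/-- Villani's estimate for a nonnegative measurable density. -/
lemma kacEntropy_le_of_measurable [Fact (2 ≤ N)] {F : KacSpace N → ℝ} (hFm : Measurable F)
    (hF : Integrable F (kacSigma N)) (h0 : ∀ v, 0 ≤ F v) (h1 : ∫ v, F v ∂kacSigma N = 1) :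
    ENNReal.ofReal (2 * Real.pi * (((N : ℝ) - 1) / 3)) * kacEntropy F
      ≤ ∑ A ∈ kacPairs N, ∫⁻ θ in Set.Ioc 0 (2 * Real.pi), kacPairIntegral 1 F A.1 A.2 θ := by
  have hN : (2 : ℝ) ≤ N := by
    have : 2 ≤ N := Fact.out
    exact_mod_cast this
  have hpi := Real.two_pi_pos
  set P := ∑ A ∈ kacPairs N, ∫⁻ θ in Set.Ioc 0 (2 * Real.pi), kacPairIntegral 1 F A.1 A.2 θ
    with hP
  rcases eq_or_ne P ⊤ with hPt | hPt
  · rw [hPt]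
    exact le_top
  have hpos1 : 0 < ∫ v, F v ∂kacSigma N := by rw [h1]; exact one_pos
  set c := 2 * Real.pi * (((N : ℝ) - 1) / 3) with hc
  have hc0 : 0 < c := by
    have : 0 < (N : ℝ) - 1 := by linarith
    positivity
  have key : ∀ δ > 0, kacEntropy F ≤ ENNReal.ofReal ((1 + δ) * P.toReal / c) := by
    intro δ hδ
    refine kacEntropy_le_of_eventually_le hF h0 hpos1 ?_
    have hev : ∀ᶠ m in Filter.atTop, ∀ A ∈ kacPairs N, ∀ v ∈ kacSphere N,
        |kacSmooth m (fun v => 1 + (v A.1 ^ 2 + v A.2 ^ 2)) v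
          - (1 + (v A.1 ^ 2 + v A.2 ^ 2))| ≤ δ :=
      (Filter.eventually_all_finset _).mpr fun A _ => eventually_abs_kacSmooth_sub_le (N := N)
        (g := fun v => 1 + (v A.1 ^ 2 + v A.2 ^ 2)) (by fun_prop) hδ
    filter_upwards [hev] with m hm
    obtain ⟨p, hp⟩ := exists_polyEval_eq_kacSmooth hF m
    have hppos : PosOnSphere p := fun v hv => by
      rw [hp]
      exact kacSmooth_pos hF h0 hpos1 m hv
    have hpm : ∫ v, polyEval p v ∂kacSigma N = 1 := by
      simp only [hp]
      rw [integral_kacSmooth hF, h1]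
    have hV := polyEntropy_le_sum_psiIntegral hppos hpm
    rw [le_div_iff₀ hc0, mul_comm]
    have hent : polyEntropy p
        = ∫ v, kacSmooth m F v * Real.log (kacSmooth m F v) ∂kacSigma N := by
      simp only [polyEntropy, hp]
    rw [hent] at hV
    refine hV.trans ?_
    have hψ0 : ∀ A ∈ kacPairs N, ∀ θ, 0 ≤ psiIntegral A.1 A.2 p θ := by
      intro A hA θ
      refine integral_nonneg_of_ae ((ae_mem_kacSphere N).mono fun v hv => mul_nonneg ?_
        (realPsi_nonneg (hppos v hv) (hppos _ (kacRotation_mem (ne_of_mem_kacPairs hA) θ hv))))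
      positivity
    have hle : ∀ A ∈ kacPairs N,
        ENNReal.ofReal (∫ θ in (0 : ℝ)..2 * Real.pi, psiIntegral A.1 A.2 p θ)
        ≤ ENNReal.ofReal (1 + δ)
          * ∫⁻ θ in Set.Ioc 0 (2 * Real.pi), kacPairIntegral 1 F A.1 A.2 θ := by
      intro A hA
      have hne := ne_of_mem_kacPairs hA
      rw [intervalIntegral.integral_of_le hpi.le, ofReal_integral_eq_lintegral_ofReal
        ((continuousOn_psiIntegral hne hppos isCompact_Icc).integrableOn_compact
          isCompact_Icc |>.mono_set Set.Ioc_subset_Icc_self)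
        (Filter.Eventually.of_forall fun θ => hψ0 A hA θ),
        ← lintegral_const_mul' _ _ ENNReal.ofReal_ne_top]
      refine lintegral_mono fun θ => ?_
      refine le_trans (le_of_eq ?_) (psi_kacSmooth_le hFm hF h0 hpos1 hne hδ.le (hm A hA) θ)
      rw [psiIntegral, ofReal_integral_eq_lintegral_ofReal]
      · refine lintegral_congr fun v => ?_
        rw [ENNReal.ofReal_mul (by positivity), hp, hp]
      · refine integrable_of_continuousOn_kacSphere (ContinuousOn.mul (by fun_prop) ?_)
        exact (continuousOn_realPsi_kacRotation hne hppos Set.univ).uncurry_left θ (Set.mem_univ θ)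
      · exact (ae_mem_kacSphere N).mono fun v hv => mul_nonneg (by positivity)
          (realPsi_nonneg (hppos v hv) (hppos _ (kacRotation_mem hne θ hv)))
    have hsum : ENNReal.ofReal (∑ A ∈ kacPairs N, ∫ θ in (0 : ℝ)..2 * Real.pi,
        psiIntegral A.1 A.2 p θ) ≤ ENNReal.ofReal ((1 + δ) * P.toReal) := by
      rw [ENNReal.ofReal_sum_of_nonneg fun A hA =>
        intervalIntegral.integral_nonneg hpi.le fun θ _ => hψ0 A hA θ,
        ENNReal.ofReal_mul (by linarith), ENNReal.ofReal_toReal hPt, hP, Finset.mul_sum]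
      exact Finset.sum_le_sum hle
    exact (ENNReal.ofReal_le_ofReal_iff
      (mul_nonneg (by linarith) ENNReal.toReal_nonneg)).mp hsum
  have hlim : kacEntropy F ≤ ENNReal.ofReal (P.toReal / c) := by
    have ht : Filter.Tendsto (fun δ : ℝ => ENNReal.ofReal ((1 + δ) * P.toReal / c))
        (nhdsWithin 0 (Set.Ioi 0)) (nhds (ENNReal.ofReal (P.toReal / c))) := by
      have : Continuous fun δ : ℝ => ENNReal.ofReal ((1 + δ) * P.toReal / c) :=
        ENNReal.continuous_ofReal.comp (by fun_prop)
      have h := this.tendsto 0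
      simp only [add_zero, one_mul] at h
      exact h.mono_left nhdsWithin_le_nhds
    exact ge_of_tendsto ht (Filter.eventually_of_mem self_mem_nhdsWithin fun δ hδ => key δ hδ)
  refine (mul_le_mul_right hlim _).trans (le_of_eq ?_)
  rw [← ENNReal.ofReal_mul hc0.le, mul_div_cancel₀ _ hc0.ne', ENNReal.ofReal_toReal hPt]

lemma kacProduction_eq (γ : ℝ) (F : KacSpace N → ℝ) :
    kacProduction γ F = ENNReal.ofReal (1 / (4 * Real.pi) * ((N : ℝ) / (N.choose 2 : ℝ))) *
      ∑ A ∈ kacPairs N, ∫⁻ θ in Set.Ioc 0 (2 * Real.pi), kacPairIntegral γ F A.1 A.2 θ := rfl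

lemma kacPairIntegral_congr {F G : KacSpace N → ℝ} (h : F =ᵐ[kacSigma N] G) (γ : ℝ) {i j : Fin N}
    (hij : i ≠ j) (θ : ℝ) : kacPairIntegral γ F i j θ = kacPairIntegral γ G i j θ := by
  refine lintegral_congr_ae ?_
  filter_upwards [h, (measurePreserving_kacRotation hij θ).quasiMeasurePreserving.ae h]
    with v h1 h2
  rw [h1, h2]

lemma kacProduction_congr {F G : KacSpace N → ℝ} (h : F =ᵐ[kacSigma N] G) (γ : ℝ) :
    kacProduction γ F = kacProduction γ G := by
  rw [kacProduction_eq, kacProduction_eq]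
  congr 1
  refine Finset.sum_congr rfl fun A hA => lintegral_congr fun θ => ?_
  exact kacPairIntegral_congr h γ (ne_of_mem_kacPairs hA) θ

lemma kacEntropy_congr {F G : KacSpace N → ℝ} (h : F =ᵐ[kacSigma N] G) :
    kacEntropy F = kacEntropy G := by
  have h' : (fun v => F v * Real.log (F v)) =ᵐ[kacSigma N] fun v => G v * Real.log (G v) :=
    h.mono fun v hv => by simp only [hv]
  rw [kacEntropy, kacEntropy, integrable_congr h', integral_congr_ae h']

/-- Every density has a measurable representative that is nonnegative everywhere. -/
lemma IsKacDensity.exists_measurable {F : KacSpace N → ℝ} (hF : IsKacDensity F) :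
    ∃ G : KacSpace N → ℝ, Measurable G ∧ (∀ v, 0 ≤ G v) ∧ F =ᵐ[kacSigma N] G := by
  refine ⟨fun v => max (hF.aemeasurable.mk F v) 0, hF.aemeasurable.measurable_mk.max measurable_const,
    fun v => le_max_right _ _, ?_⟩
  filter_upwards [hF.aemeasurable.ae_eq_mk, hF.nonneg] with v h1 h2
  rw [← h1, max_eq_left h2]

lemma IsKacDensity.congr {F G : KacSpace N → ℝ} (hF : IsKacDensity F) (h : F =ᵐ[kacSigma N] G) :
    IsKacDensity G where
  aemeasurable := hF.aemeasurable.congr h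
  nonneg := by
    filter_upwards [h, hF.nonneg] with v h1 h2
    rwa [← h1]
  mass_one := by
    rw [← hF.mass_one]
    exact lintegral_congr_ae (h.mono fun v hv => by simp only [hv])

lemma IsKacDensity.integrable {F : KacSpace N → ℝ} (hF : IsKacDensity F) :
    Integrable F (kacSigma N) := by
  refine ⟨hF.aemeasurable.aestronglyMeasurable, ?_⟩
  rw [hasFiniteIntegral_iff_ofReal hF.nonneg, hF.mass_one]
  exact ENNReal.one_lt_top

lemma IsKacDensity.integral_eq_one {F : KacSpace N → ℝ} (hF : IsKacDensity F) :
    ∫ v, F v ∂kacSigma N = 1 := by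
  rw [integral_eq_lintegral_of_nonneg_ae hF.nonneg hF.aemeasurable.aestronglyMeasurable,
    hF.mass_one, ENNReal.toReal_one]

/-- Villani's entropy production estimate `H_N(F) ≤ 3 D_{N,1}(F)` for all densities. -/
theorem kacEntropy_le_three_mul_kacProduction_one (hN : 2 ≤ N) {F : KacSpace N → ℝ}
    (hF : IsKacDensity F) : kacEntropy F ≤ 3 * kacProduction 1 F := by
  have : Fact (2 ≤ N) := ⟨hN⟩
  obtain ⟨G, hGm, hG0, hFG⟩ := hF.exists_measurable
  have hG := hF.congr hFG
  rw [kacEntropy_congr hFG, kacProduction_congr hFG]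
  have h := kacEntropy_le_of_measurable hGm hG.integrable hG0 hG.integral_eq_one
  rw [kacProduction_eq, ← mul_assoc]
  refine le_trans (le_of_eq ?_) (mul_le_mul_right h _)
  have hN' : (2 : ℝ) ≤ N := by exact_mod_cast hN
  have hN1 : (N : ℝ) - 1 ≠ 0 := by linarith
  rw [← mul_assoc, show (3 : ℝ≥0∞) = ENNReal.ofReal 3 by simp, ← ENNReal.ofReal_mul (by norm_num),
    ← ENNReal.ofReal_mul (by positivity), Nat.cast_choose_two]
  have : 3 * (1 / (4 * Real.pi) * ((N : ℝ) / (N * (N - 1) / 2)))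
      * (2 * Real.pi * (((N : ℝ) - 1) / 3)) = 1 := by
    have := Real.pi_pos.ne'
    field_simp
    norm_num
  rw [this, ENNReal.ofReal_one, one_mul]

end Villani

/-! ### Permutation symmetry -/

section Symmetry
variable {N : ℕ}

lemma exists_perm_pair {i j i' j' : Fin N} (hij : i ≠ j) (hij' : i' ≠ j') :
    ∃ π : Equiv.Perm (Fin N), π i' = i ∧ π j' = j := by
  refine ⟨(Equiv.swap i' i).trans (Equiv.swap (Equiv.swap i' i j') j), ?_, by simp⟩
  have h : Equiv.swap i' i j' ≠ i := by
    intro h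
    have : Equiv.swap i' i j' = Equiv.swap i' i i' := by rw [h, Equiv.swap_apply_left]
    exact hij' ((Equiv.swap i' i).injective this).symm
  simp [Equiv.swap_apply_of_ne_of_ne h.symm hij]

/-- For a symmetric density all pairs of coordinates are equivalent. -/
lemma IsKacSymmetric.lintegral_pair_eq {F : KacSpace N → ℝ} (hF : IsKacSymmetric F)
    {i j i' j' : Fin N} (hij : i ≠ j) (hij' : i' ≠ j') (θ : ℝ) (h : ℝ → ℝ → ℝ → ℝ → ℝ≥0∞) :
    ∫⁻ v, h (v i) (v j) (F v) (F (kacRotation i j θ v)) ∂kacSigma N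
      = ∫⁻ v, h (v i') (v j') (F v) (F (kacRotation i' j' θ v)) ∂kacSigma N := by
  obtain ⟨π, hi, hj⟩ := exists_perm_pair hij hij'
  let e : KacSpace N ≃ₗᵢ[ℝ] KacSpace N := LinearIsometryEquiv.piLpCongrLeft 2 ℝ ℝ π.symm
  have he : ∀ v, e v = WithLp.toLp 2 fun k => v (π k) := fun v => rfl
  have hR : ∀ v, kacRotation i' j' θ (e v) = e (kacRotation i j θ v) := by
    intro v
    ext k
    simp only [he, kacRotation_apply, hi, hj, ← π.injective.eq_iff (a := k)]
  rw [← (measurePreserving_kacSigma e).lintegral_comp_emb e.toHomeomorph.measurableEmbedding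
    fun v => h (v i') (v j') (F v) (F (kacRotation i' j' θ v))]
  refine lintegral_congr_ae ?_
  filter_upwards [hF π, (measurePreserving_kacRotation hij θ).quasiMeasurePreserving.ae (hF π)]
    with v h1 h2
  rw [hR, he, h1, he, h2, ← hi, ← hj]

lemma card_kacPairs : ((kacPairs N).card : ℝ) = N.choose 2 := by
  have h := sum_kacPairs_real (N := N) (f := fun i j => if i = j then 0 else 1)
    (fun i j => by simp only [eq_comm]) (fun i => by simp)
  have h1 : ∑ A ∈ kacPairs N, (if A.1 = A.2 then (0 : ℝ) else 1) = (kacPairs N).card := by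
    rw [Finset.sum_congr rfl fun A hA => if_neg (ne_of_mem_kacPairs hA)]
    simp
  have h2 : ∀ i : Fin N, ∑ j, (if i = j then (0 : ℝ) else 1) = N - 1 := by
    intro i
    have : ∀ j, (if i = j then (0 : ℝ) else 1) = 1 - if i = j then 1 else 0 := fun j => by
      split_ifs <;> ring
    simp [this]
  simp only [h1, h2] at h
  rw [Nat.cast_choose_two]
  simp at h
  linarith

/-- For a symmetric density the entropy production per particle is that of one pair. -/
lemma kacProduction_div_eq (hN : 2 ≤ N) {F : KacSpace N → ℝ} (hF : IsKacSymmetric F)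
    {i j : Fin N} (hij : i ≠ j) (γ : ℝ) :
    kacProduction γ F / N = ENNReal.ofReal (1 / (4 * Real.pi)) *
      ∫⁻ θ in Set.Ioc 0 (2 * Real.pi), kacPairIntegral γ F i j θ := by
  have hN0 : (0 : ℝ) < N := by positivity
  have hc : (0 : ℝ) < N.choose 2 := by
    have := Nat.choose_pos hN
    exact_mod_cast this
  have h1 : ∀ A ∈ kacPairs N, ∫⁻ θ in Set.Ioc 0 (2 * Real.pi), kacPairIntegral γ F A.1 A.2 θ
      = ∫⁻ θ in Set.Ioc 0 (2 * Real.pi), kacPairIntegral γ F i j θ := fun A hA =>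
    lintegral_congr fun θ => hF.lintegral_pair_eq (ne_of_mem_kacPairs hA) hij θ
      fun a b x y => ENNReal.ofReal ((1 + (a ^ 2 + b ^ 2)) ^ γ) * kacPsi x y
  rw [kacProduction_eq, Finset.sum_congr rfl h1, Finset.sum_const, nsmul_eq_mul, ← mul_assoc,
    ENNReal.mul_div_right_comm]
  congr 1
  have h2 : ((kacPairs N).card : ℝ≥0∞) = ENNReal.ofReal (N.choose 2) := by
    rw [← card_kacPairs, ENNReal.ofReal_natCast]
  rw [h2, ← ENNReal.ofReal_mul (by positivity), ← ENNReal.ofReal_natCast N,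
    ← ENNReal.ofReal_div_of_pos hN0]
  congr 1
  field_simp

end Symmetry

/-! ### Interpolation with the log-power property -/

section Interpolation
variable {N : ℕ}

lemma measurable_kacPsiPow (β : ℝ) : Measurable (Function.uncurry (kacPsiPow β)) := by
  unfold kacPsiPow Function.uncurry
  refine Measurable.ite (measurableSet_eq_fun measurable_fst measurable_snd) measurable_const
    (Measurable.ite ?_ measurable_const ?_)
  · exact (measurableSet_eq_fun measurable_fst measurable_const).union
      (measurableSet_eq_fun measurable_snd measurable_const)
  · fun_prop

/-- The factorization of `ψ` behind the use of Hölder's inequality. -/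
lemma kacPsi_eq_mul {β : ℝ} (hβ : 0 < β) (x y : ℝ) (hx : 0 ≤ x) (hy : 0 ≤ y) :
    kacPsi x y = ENNReal.ofReal |x - y| ^ (β / (1 + β)) * kacPsiPow β x y ^ (1 / (1 + β)) := by
  have hβ1 : 0 < 1 + β := by linarith
  rcases eq_or_ne x y with rfl | hxy
  · rw [kacPsi, if_pos rfl, sub_self, abs_zero, ENNReal.ofReal_zero,
      ENNReal.zero_rpow_of_pos (by positivity), zero_mul]
  have hd : 0 < |x - y| := abs_pos.mpr (sub_ne_zero.mpr hxy)
  by_cases h : x = 0 ∨ y = 0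
  · rw [kacPsi, kacPsiPow, if_neg hxy, if_pos h, if_neg hxy, if_pos h,
      ENNReal.top_rpow_of_pos (by positivity), ENNReal.mul_top]
    exact (ENNReal.rpow_pos (ENNReal.ofReal_pos.mpr hd) ENNReal.ofReal_ne_top).ne'
  rw [kacPsi, kacPsiPow, if_neg hxy, if_neg h, if_neg hxy, if_neg h]
  push Not at h
  have hx' := hx.lt_of_ne' h.1
  have hy' := hy.lt_of_ne' h.2
  have hψ := realPsi_nonneg hx' hy'
  rw [ENNReal.ofReal_rpow_of_nonneg hd.le (by positivity),
    ENNReal.ofReal_rpow_of_nonneg (by positivity) (by positivity),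
    ← ENNReal.ofReal_mul (by positivity)]
  congr 1
  rw [Real.mul_rpow hd.le (by positivity), ← mul_assoc, ← Real.rpow_add hd, ← Real.rpow_mul
    (abs_nonneg _), mul_one_div_cancel hβ1.ne', Real.rpow_one, ← add_div, add_comm β,
    div_self hβ1.ne', Real.rpow_one, ← abs_mul, Real.log_div hx'.ne' hy'.ne']
  exact (abs_of_nonneg hψ).symm

/-- The tail `∫ u^q F dσ` over `u > A`, where `u = 1 + v_i² + v_j²`. -/
def kacTail (q A : ℝ) (F : KacSpace N → ℝ) (i j : Fin N) : ℝ≥0∞ :=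
  ∫⁻ v in {v | A < 1 + (v i ^ 2 + v j ^ 2)},
    ENNReal.ofReal ((1 + (v i ^ 2 + v j ^ 2)) ^ q) * ENNReal.ofReal (F v) ∂kacSigma N

lemma measurableSet_tail (A : ℝ) (i j : Fin N) :
    MeasurableSet {v : KacSpace N | A < 1 + (v i ^ 2 + v j ^ 2)} := by
  have : Continuous fun v : KacSpace N => 1 + (v i ^ 2 + v j ^ 2) := by fun_prop
  exact (isOpen_lt continuous_const this).measurableSet

lemma kacTail_comp_kacRotation (q A : ℝ) (F : KacSpace N → ℝ) {i j : Fin N} (hij : i ≠ j) (θ : ℝ) :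
    ∫⁻ v in {v | A < 1 + (v i ^ 2 + v j ^ 2)},
      ENNReal.ofReal ((1 + (v i ^ 2 + v j ^ 2)) ^ q) * ENNReal.ofReal (F (kacRotation i j θ v))
        ∂kacSigma N = kacTail q A F i j := by
  rw [kacTail, ← (measurePreserving_kacRotation hij θ).setLIntegral_comp_preimage_emb
    (kacRotIsom hij θ).toHomeomorph.measurableEmbedding fun v =>
      ENNReal.ofReal ((1 + (v i ^ 2 + v j ^ 2)) ^ q) * ENNReal.ofReal (F v)]
  simp only [sq_add_sq_kacRotation hij, Set.preimage_ofPred_eq]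

lemma measurable_comp_kacRotation {F : KacSpace N → ℝ} (hF : Measurable F) (i j : Fin N) :
    Measurable fun x : ℝ × KacSpace N => F (kacRotation i j x.1 x.2) :=
  hF.comp (continuous_kacRotation i j).measurable

/-- The contribution of `u > A` to the entropy production with `γ = 1`, estimated by Hölder's
inequality with exponents `(1 + β) / β` and `1 + β`. -/
lemma lintegral_kacPsi_tail_le [Fact (2 ≤ N)] {β : ℝ} (hβ : 0 < β) {F : KacSpace N → ℝ}
    (hFm : Measurable F) (h0 : ∀ v, 0 ≤ F v) {i j : Fin N} (hij : i ≠ j) (A : ℝ) :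
    ∫⁻ θ in Set.Ioc 0 (2 * Real.pi), ∫⁻ v in {v | A < 1 + (v i ^ 2 + v j ^ 2)},
        ENNReal.ofReal (1 + (v i ^ 2 + v j ^ 2)) * kacPsi (F v) (F (kacRotation i j θ v))
          ∂kacSigma N
      ≤ (ENNReal.ofReal (4 * Real.pi) * kacTail ((1 + β) / β) A F i j) ^ (β / (1 + β)) *
        (∫⁻ θ in Set.Ioc 0 (2 * Real.pi), ∫⁻ v,
          kacPsiPow β (F v) (F (kacRotation i j θ v)) ∂kacSigma N) ^ (1 / (1 + β)) := by
  have hβ1 : 0 < 1 + β := by linarith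
  have hpi := Real.pi_pos
  set S : Set (KacSpace N) := {v | A < 1 + (v i ^ 2 + v j ^ 2)} with hS
  set q := (1 + β) / β with hq
  have hq0 : 0 < q := by positivity
  set I := Set.Ioc 0 (2 * Real.pi)
  set μ := (volume.restrict I).prod ((kacSigma N).restrict S)
  have hpq : q.HolderConjugate (1 + β) := by
    refine (Real.holderConjugate_iff.mpr ⟨by linarith, ?_⟩).symm
    rw [hq]
    field_simp
  let g₁ : ℝ × KacSpace N → ℝ≥0∞ := fun x => ENNReal.ofReal (1 + (x.2 i ^ 2 + x.2 j ^ 2))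
    * ENNReal.ofReal |F x.2 - F (kacRotation i j x.1 x.2)| ^ (β / (1 + β))
  let g₂ : ℝ × KacSpace N → ℝ≥0∞ := fun x =>
    kacPsiPow β (F x.2) (F (kacRotation i j x.1 x.2)) ^ (1 / (1 + β))
  have hFR := measurable_comp_kacRotation hFm i j
  have hF2 : Measurable fun x : ℝ × KacSpace N => F x.2 := hFm.comp measurable_snd
  have hum : Measurable fun x : ℝ × KacSpace N => ENNReal.ofReal (1 + (x.2 i ^ 2 + x.2 j ^ 2)) :=
    (by fun_prop : Continuous fun x : ℝ × KacSpace N =>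
      1 + (x.2 i ^ 2 + x.2 j ^ 2)).measurable.ennreal_ofReal
  have hdm : Measurable fun x : ℝ × KacSpace N =>
      ENNReal.ofReal |F x.2 - F (kacRotation i j x.1 x.2)| :=
    (hF2.sub hFR).norm.ennreal_ofReal
  have hg₁ : Measurable g₁ := hum.mul (hdm.pow_const _)
  have hψm : Measurable fun x : ℝ × KacSpace N =>
    kacPsiPow β (F x.2) (F (kacRotation i j x.1 x.2)) :=
    (measurable_kacPsiPow β).comp (hF2.prodMk hFR)
  have hg₂ : Measurable g₂ := hψm.pow_const _
  have e1 : ∫⁻ θ in I, ∫⁻ v in S,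
        ENNReal.ofReal (1 + (v i ^ 2 + v j ^ 2)) * kacPsi (F v) (F (kacRotation i j θ v))
          ∂kacSigma N = ∫⁻ x, (g₁ * g₂) x ∂μ := by
    rw [lintegral_prod _ (hg₁.mul hg₂).aemeasurable]
    refine lintegral_congr fun θ => lintegral_congr fun v => ?_
    simp only [Pi.mul_apply, g₁, g₂]
    rw [kacPsi_eq_mul hβ _ _ (h0 _) (h0 _), mul_assoc]
  rw [e1]
  refine (ENNReal.lintegral_mul_le_Lp_mul_Lq μ hpq hg₁.aemeasurable hg₂.aemeasurable).trans ?_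
  have hq1 : 1 / q = β / (1 + β) := one_div_div _ _
  rw [hq1]
  refine mul_le_mul' (ENNReal.rpow_le_rpow ?_ (by positivity)) (ENNReal.rpow_le_rpow ?_
    (by positivity))
  · have hpt : ∀ θ v, g₁ (θ, v) ^ q ≤ ENNReal.ofReal ((1 + (v i ^ 2 + v j ^ 2)) ^ q)
        * ENNReal.ofReal (F v) + ENNReal.ofReal ((1 + (v i ^ 2 + v j ^ 2)) ^ q)
        * ENNReal.ofReal (F (kacRotation i j θ v)) := by
      intro θ v
      simp only [g₁]
      rw [ENNReal.mul_rpow_of_nonneg _ _ hq0.le, ← ENNReal.rpow_mul,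
        ENNReal.ofReal_rpow_of_nonneg (by positivity) hq0.le, ← hq1, one_div_mul_cancel hq0.ne',
        ENNReal.rpow_one, ← mul_add, ← ENNReal.ofReal_add (h0 _) (h0 _)]
      refine mul_le_mul_right (ENNReal.ofReal_le_ofReal ?_) _
      have h1 := h0 v
      have h2 := h0 (kacRotation i j θ v)
      exact abs_sub_le_iff.mpr ⟨by linarith, by linarith⟩
    rw [lintegral_prod _ (hg₁.pow_const _).aemeasurable]
    have hm : Measurable fun v : KacSpace N => ENNReal.ofReal ((1 + (v i ^ 2 + v j ^ 2)) ^ q)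
        * ENNReal.ofReal (F v) := by
      have : Measurable fun v : KacSpace N => 1 + (v i ^ 2 + v j ^ 2) :=
        (by fun_prop : Continuous fun v : KacSpace N => 1 + (v i ^ 2 + v j ^ 2)).measurable
      exact (this.pow_const q).ennreal_ofReal.mul hFm.ennreal_ofReal
    have hθ : ∀ θ, ∫⁻ v in S, g₁ (θ, v) ^ q ∂kacSigma N ≤ 2 * kacTail q A F i j := by
      intro θ
      refine (lintegral_mono fun v => hpt θ v).trans (le_of_eq ?_)
      rw [lintegral_add_left hm, kacTail_comp_kacRotation q A F hij θ, two_mul]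
      rfl
    refine (lintegral_mono hθ).trans (le_of_eq ?_)
    rw [lintegral_const, Measure.restrict_apply_univ, Real.volume_Ioc, sub_zero, mul_right_comm,
      show (2 : ℝ≥0∞) = ENNReal.ofReal 2 by simp, ← ENNReal.ofReal_mul zero_le_two]
    congr 2
    ring
  · rw [lintegral_prod _ (hg₂.pow_const _).aemeasurable]
    refine lintegral_mono fun θ => ?_
    refine (setLIntegral_le_lintegral _ _).trans (le_of_eq (lintegral_congr fun v => ?_))
    simp only [g₂]
    rw [← ENNReal.rpow_mul, one_div_mul_cancel hβ1.ne', ENNReal.rpow_one]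

/-- The contribution of `u ≤ A`, where `u ≤ A^{1-γ} u^γ`, is bounded by the production with
weight `u^γ`. -/
lemma kacPairIntegral_one_le {F : KacSpace N → ℝ} (i j : Fin N) {γ : ℝ} (hγ : γ ≤ 1) (A θ : ℝ) :
    kacPairIntegral 1 F i j θ ≤ ENNReal.ofReal (A ^ (1 - γ)) * kacPairIntegral γ F i j θ +
      ∫⁻ v in {v | A < 1 + (v i ^ 2 + v j ^ 2)},
        ENNReal.ofReal (1 + (v i ^ 2 + v j ^ 2)) * kacPsi (F v) (F (kacRotation i j θ v))
          ∂kacSigma N := by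
  rw [kacPairIntegral, ← lintegral_add_compl _ (measurableSet_tail A i j), add_comm]
  simp only [Real.rpow_one]
  refine add_le_add_left ?_ _
  rw [kacPairIntegral, ← lintegral_const_mul' _ _ ENNReal.ofReal_ne_top]
  refine le_trans (setLIntegral_mono' (measurableSet_tail A i j).compl fun v hv => ?_)
    (setLIntegral_le_lintegral _ _)
  have hu : 0 < 1 + (v i ^ 2 + v j ^ 2) := by positivity
  have hA : 1 + (v i ^ 2 + v j ^ 2) ≤ A := not_lt.mp hv
  rw [← mul_assoc, ← ENNReal.ofReal_mul (Real.rpow_nonneg (hu.le.trans hA) _)]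
  refine mul_le_mul_left (ENNReal.ofReal_le_ofReal ?_) _
  calc 1 + (v i ^ 2 + v j ^ 2)
      = (1 + (v i ^ 2 + v j ^ 2)) ^ (1 - γ) * (1 + (v i ^ 2 + v j ^ 2)) ^ γ := by
        rw [← Real.rpow_add hu, sub_add_cancel, Real.rpow_one]
    _ ≤ _ := mul_le_mul_of_nonneg_right (Real.rpow_le_rpow hu.le hA (sub_nonneg.mpr hγ))
        (Real.rpow_nonneg hu.le _)

/-- The interpolation inequality: the entropy is controlled by the production with weight `u^γ` and
the tail of the density, with a free parameter `A`. -/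
theorem kacEntropy_div_le [Fact (2 ≤ N)] {β : ℝ} (hβ : 0 < β) {C : ℝ} (hC : 0 < C) {γ : ℝ}
    (hγ : γ ≤ 1) {F : KacSpace N → ℝ} (hF : IsKacDensity F) (hFm : Measurable F)
    (h0 : ∀ v, 0 ≤ F v) (hs : IsKacSymmetric F) {i j : Fin N} (hij : i ≠ j)
    (hlog : ENNReal.ofReal (1 / (2 * Real.pi)) * ∫⁻ θ in Set.Ioc 0 (2 * Real.pi), ∫⁻ v,
        kacPsiPow β (F v) (F (kacRotation i j θ v)) ∂kacSigma N ≤ ENNReal.ofReal (C ^ (1 + β)))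
    (A : ℝ) :
    kacEntropy F / N ≤ 3 * (ENNReal.ofReal (A ^ (1 - γ)) * (kacProduction γ F / N)
      + ENNReal.ofReal (C / 2) * (2 * kacTail ((1 + β) / β) A F i j) ^ (β / (1 + β))) := by
  have hN : 2 ≤ N := Fact.out
  have hβ1 : 0 < 1 + β := by linarith
  have hpi := Real.pi_pos
  have h1 : kacEntropy F / N ≤ 3 * (kacProduction 1 F / N) := by
    rw [← mul_div_assoc]
    exact ENNReal.div_le_div_right (kacEntropy_le_three_mul_kacProduction_one hN hF) _
  refine h1.trans (mul_le_mul_right ?_ _)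
  rw [kacProduction_div_eq hN hs hij, kacProduction_div_eq hN hs hij]
  set I := Set.Ioc 0 (2 * Real.pi)
  set Q := ∫⁻ θ in I, ∫⁻ v, kacPsiPow β (F v) (F (kacRotation i j θ v)) ∂kacSigma N with hQ
  set m := kacTail ((1 + β) / β) A F i j
  have hQ' : Q ≤ ENNReal.ofReal (2 * Real.pi * C ^ (1 + β)) := by
    rw [ENNReal.ofReal_mul (by positivity)]
    refine le_trans (le_of_eq ?_) (mul_le_mul_right hlog _)
    rw [← mul_assoc, ← ENNReal.ofReal_mul (by positivity), mul_one_div_cancel (by positivity),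
      ENNReal.ofReal_one, one_mul]
  have hT := lintegral_kacPsi_tail_le hβ hFm h0 hij A
  have h2 : ∫⁻ θ in I, kacPairIntegral 1 F i j θ
      ≤ ENNReal.ofReal (A ^ (1 - γ)) * (∫⁻ θ in I, kacPairIntegral γ F i j θ)
        + (ENNReal.ofReal (4 * Real.pi) * m) ^ (β / (1 + β)) * Q ^ (1 / (1 + β)) := by
    refine (lintegral_mono fun θ => kacPairIntegral_one_le i j hγ A θ).trans ?_
    have hm : Measurable fun θ => kacPairIntegral γ F i j θ := by
      refine Measurable.lintegral_prod_right' (f := fun x : ℝ × KacSpace N =>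
        ENNReal.ofReal ((1 + (x.2 i ^ 2 + x.2 j ^ 2)) ^ γ)
          * kacPsi (F x.2) (F (kacRotation i j x.1 x.2))) ?_
      have hu : Measurable fun x : ℝ × KacSpace N => 1 + (x.2 i ^ 2 + x.2 j ^ 2) :=
        (by fun_prop : Continuous fun x : ℝ × KacSpace N => 1 + (x.2 i ^ 2 + x.2 j ^ 2)).measurable
      exact (hu.pow_const γ).ennreal_ofReal.mul (measurable_kacPsi.comp
        ((hFm.comp measurable_snd).prodMk (measurable_comp_kacRotation hFm i j)))
    rw [lintegral_add_left (hm.const_mul _), lintegral_const_mul' _ _ ENNReal.ofReal_ne_top]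
    exact add_le_add_right hT _
  refine (mul_le_mul_right h2 _).trans ?_
  rw [mul_add, mul_left_comm]
  refine add_le_add_right ?_ _
  calc ENNReal.ofReal (1 / (4 * Real.pi)) *
        ((ENNReal.ofReal (4 * Real.pi) * m) ^ (β / (1 + β)) * Q ^ (1 / (1 + β)))
      ≤ ENNReal.ofReal (1 / (4 * Real.pi)) *
        ((ENNReal.ofReal (4 * Real.pi) * m) ^ (β / (1 + β))
          * ENNReal.ofReal (2 * Real.pi * C ^ (1 + β)) ^ (1 / (1 + β))) := by gcongr
    _ = ENNReal.ofReal (C / 2) * (2 * m) ^ (β / (1 + β)) := by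
        have e1 : ENNReal.ofReal (4 * Real.pi) * m = ENNReal.ofReal (2 * Real.pi) * (2 * m) := by
          rw [← mul_assoc, show (2 : ℝ≥0∞) = ENNReal.ofReal 2 by simp,
            ← ENNReal.ofReal_mul (by positivity)]
          congr 2
          ring
        rw [e1, ENNReal.mul_rpow_of_nonneg _ _ (by positivity),
          ENNReal.ofReal_rpow_of_nonneg (by positivity) (by positivity),
          ENNReal.ofReal_rpow_of_nonneg (by positivity) (by positivity), mul_right_comm,
          ← mul_assoc, ← ENNReal.ofReal_mul (by positivity),
          ← ENNReal.ofReal_mul (by positivity)]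
        congr 2
        rw [Real.mul_rpow (x := 2 * Real.pi) (y := C ^ (1 + β)) (by positivity) (by positivity),
          ← Real.rpow_mul hC.le,
          mul_one_div_cancel hβ1.ne', Real.rpow_one]
        have e2 : (2 * Real.pi) ^ (β / (1 + β)) * (2 * Real.pi) ^ (1 / (1 + β)) = 2 * Real.pi := by
          rw [← Real.rpow_add (by positivity), ← add_div, add_comm β, div_self hβ1.ne',
            Real.rpow_one]
        calc _ = 1 / (4 * Real.pi) * C * ((2 * Real.pi) ^ (β / (1 + β))
              * (2 * Real.pi) ^ (1 / (1 + β))) := by ring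
          _ = C / 2 := by
            rw [e2]
            field_simp
            norm_num

end Interpolation

/-! ### Measurable representatives -/

section Representative
variable {N : ℕ}

lemma IsKacSymmetric.congr {F G : KacSpace N → ℝ} (hF : IsKacSymmetric F)
    (h : F =ᵐ[kacSigma N] G) : IsKacSymmetric G := by
  intro π
  let e : KacSpace N ≃ₗᵢ[ℝ] KacSpace N := LinearIsometryEquiv.piLpCongrLeft 2 ℝ ℝ π.symm
  have he : ∀ v, e v = WithLp.toLp 2 fun k => v (π k) := fun v => rfl
  filter_upwards [hF π, h, (measurePreserving_kacSigma e).quasiMeasurePreserving.ae h]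
    with v h1 h2 h3
  rw [he] at h3
  rw [← h3, h1, h2]

lemma kacTail_congr {F G : KacSpace N → ℝ} (h : F =ᵐ[kacSigma N] G) (q A : ℝ) (i j : Fin N) :
    kacTail q A F i j = kacTail q A G i j := by
  refine lintegral_congr_ae (ae_restrict_of_ae ?_)
  filter_upwards [h] with v hv
  rw [hv]

/-- The interpolation inequality in terms of a real bound `t` for the tail. -/
lemma kacEntropy_div_le_ofReal (hN : 2 ≤ N) {β : ℝ} (hβ : 0 < β) {C : ℝ} (hC : 0 < C) {γ : ℝ}
    (hγ : γ ≤ 1) {F : KacSpace N → ℝ} (hF : IsKacDensity F) (hs : IsKacSymmetric F) {i j : Fin N}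
    (hij : i ≠ j)
    (hlog : ENNReal.ofReal (1 / (2 * Real.pi)) * ∫⁻ θ in Set.Ioc 0 (2 * Real.pi), ∫⁻ v,
        kacPsiPow β (F v) (F (kacRotation i j θ v)) ∂kacSigma N ≤ ENNReal.ofReal (C ^ (1 + β)))
    {A : ℝ} (hA : 0 < A) {t : ℝ} (ht0 : 0 ≤ t)
    (ht : kacTail ((1 + β) / β) A F i j ≤ ENNReal.ofReal t) (hD : kacProduction γ F / N ≠ ⊤) :
    kacEntropy F / N ≤ ENNReal.ofReal (3 * (A ^ (1 - γ) * (kacProduction γ F / N).toReal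
      + C / 2 * (2 * t) ^ (β / (1 + β)))) := by
  have : Fact (2 ≤ N) := ⟨hN⟩
  obtain ⟨G, hGm, hG0, hFG⟩ := hF.exists_measurable
  have hlog' : ENNReal.ofReal (1 / (2 * Real.pi)) * ∫⁻ θ in Set.Ioc 0 (2 * Real.pi), ∫⁻ v,
      kacPsiPow β (G v) (G (kacRotation i j θ v)) ∂kacSigma N ≤ ENNReal.ofReal (C ^ (1 + β)) := by
    refine le_trans (le_of_eq ?_) hlog
    congr 1
    refine lintegral_congr fun θ => lintegral_congr_ae ?_
    filter_upwards [hFG, (measurePreserving_kacRotation hij θ).quasiMeasurePreserving.ae hFG]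
      with v h1 h2
    rw [h1, h2]
  have h := kacEntropy_div_le hβ hC hγ (hF.congr hFG) hGm hG0 (hs.congr hFG) hij hlog' A
  rw [← kacEntropy_congr hFG, ← kacProduction_congr hFG, ← kacTail_congr hFG] at h
  refine h.trans ?_
  rw [ENNReal.ofReal_mul (by norm_num), ENNReal.ofReal_add (by positivity) (by positivity),
    ENNReal.ofReal_mul (by positivity), ENNReal.ofReal_toReal hD, ENNReal.ofReal_mul (by positivity),
    ← ENNReal.ofReal_rpow_of_nonneg (p := β / (1 + β)) (by positivity) (by positivity),
    ENNReal.ofReal_mul zero_le_two]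
  simp only [ENNReal.ofReal_ofNat]
  gcongr

lemma IsKacSymmetric.lintegral_coord_eq {F : KacSpace N → ℝ} (hF : IsKacSymmetric F)
    {i j : Fin N} (hij : i ≠ j) (g : ℝ → ℝ≥0∞) :
    ∫⁻ v, g (v j) * ENNReal.ofReal (F v) ∂kacSigma N
      = ∫⁻ v, g (v i) * ENNReal.ofReal (F v) ∂kacSigma N :=
  hF.lintegral_pair_eq hij.symm hij 0 fun a _ x _ => g a * ENNReal.ofReal x

end Representative

/-! ### Power moments -/

section PowerMoments
variable {N : ℕ}

lemma rpow_add_sq_le {k : ℝ} (hk : 0 < k) (x y : ℝ) :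
    (1 + (x ^ 2 + y ^ 2)) ^ k ≤ 3 ^ k * (1 + |x| ^ (2 * k) + |y| ^ (2 * k)) := by
  have hs : ∀ z : ℝ, |z| ^ (2 * k) = (z ^ 2) ^ k := fun z => by
    rw [Real.rpow_mul (abs_nonneg z), Real.rpow_two, sq_abs]
  rw [hs, hs]
  have hx := Real.rpow_nonneg (sq_nonneg x) k
  have hy := Real.rpow_nonneg (sq_nonneg y) k
  have key : ∀ m : ℝ, 0 ≤ m → 1 + (x ^ 2 + y ^ 2) ≤ 3 * m →
      m ^ k ≤ 1 + (x ^ 2) ^ k + (y ^ 2) ^ k →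
      (1 + (x ^ 2 + y ^ 2)) ^ k ≤ 3 ^ k * (1 + (x ^ 2) ^ k + (y ^ 2) ^ k) := by
    intro m hm h1 h2
    refine (Real.rpow_le_rpow (by positivity) h1 hk.le).trans ?_
    rw [Real.mul_rpow (by norm_num) hm]
    exact mul_le_mul_of_nonneg_left h2 (by positivity)
  rcases le_total (x ^ 2) (y ^ 2) with h | h
  · rcases le_total (y ^ 2) 1 with h' | h'
    · exact key 1 zero_le_one (by linarith) (by rw [Real.one_rpow]; linarith)
    · exact key (y ^ 2) (sq_nonneg y) (by linarith) (by linarith)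
  · rcases le_total (x ^ 2) 1 with h' | h'
    · exact key 1 zero_le_one (by linarith) (by rw [Real.one_rpow]; linarith)
    · exact key (x ^ 2) (sq_nonneg x) (by linarith) (by linarith)

/-- The tail under a moment of order `2k`, by Markov's inequality. -/
lemma kacTail_le_of_moment {F : KacSpace N → ℝ} (hF : IsKacDensity F) (hs : IsKacSymmetric F)
    {i j : Fin N} (hij : i ≠ j) {q k : ℝ} (hq : 0 < q) (hqk : q < k) {A : ℝ} (hA : 0 < A) {M : ℝ}
    (hM0 : 0 ≤ M)
    (hM : ∫⁻ v, ENNReal.ofReal (|v i| ^ (2 * k)) * ENNReal.ofReal (F v) ∂kacSigma N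
      ≤ ENNReal.ofReal M) :
    kacTail q A F i j ≤ ENNReal.ofReal (A ^ (-(k - q)) * (3 ^ k * (1 + 2 * M))) := by
  have hk : 0 < k := hq.trans hqk
  have hm : ∀ l : Fin N, AEMeasurable (fun v : KacSpace N => ENNReal.ofReal (|v l| ^ (2 * k))
      * ENNReal.ofReal (F v)) (kacSigma N) := by
    intro l
    have : Measurable fun v : KacSpace N => |v l| :=
      (by fun_prop : Continuous fun v : KacSpace N => |v l|).measurable
    exact (this.pow_const _).ennreal_ofReal.aemeasurable.mul hF.aemeasurable.ennreal_ofReal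
  have h1 : kacTail q A F i j ≤ ∫⁻ v, ENNReal.ofReal (A ^ (-(k - q)) * 3 ^ k) *
      (ENNReal.ofReal (F v) + ENNReal.ofReal (|v i| ^ (2 * k)) * ENNReal.ofReal (F v)
        + ENNReal.ofReal (|v j| ^ (2 * k)) * ENNReal.ofReal (F v)) ∂kacSigma N := by
    refine le_trans (setLIntegral_mono' (measurableSet_tail A i j) fun v hv => ?_)
      (setLIntegral_le_lintegral _ _)
    have hu : A < 1 + (v i ^ 2 + v j ^ 2) := hv
    have hu0 := hA.trans hu
    have h2 : (1 + (v i ^ 2 + v j ^ 2)) ^ q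
        ≤ A ^ (-(k - q)) * 3 ^ k * (1 + |v i| ^ (2 * k) + |v j| ^ (2 * k)) := by
      calc (1 + (v i ^ 2 + v j ^ 2)) ^ q
          = (1 + (v i ^ 2 + v j ^ 2)) ^ (-(k - q)) * (1 + (v i ^ 2 + v j ^ 2)) ^ k := by
            rw [← Real.rpow_add hu0]
            congr 1
            ring
        _ ≤ A ^ (-(k - q)) * (3 ^ k * (1 + |v i| ^ (2 * k) + |v j| ^ (2 * k))) :=
            mul_le_mul (Real.rpow_le_rpow_of_nonpos hA hu.le (by linarith))
              (rpow_add_sq_le hk _ _) (by positivity) (by positivity)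
        _ = _ := by ring
    refine (mul_le_mul_left (ENNReal.ofReal_le_ofReal h2) _).trans (le_of_eq ?_)
    rw [ENNReal.ofReal_mul (by positivity), ENNReal.ofReal_add (by positivity) (by positivity),
      ENNReal.ofReal_add zero_le_one (by positivity), ENNReal.ofReal_one]
    ring
  refine h1.trans ?_
  rw [lintegral_const_mul' _ _ ENNReal.ofReal_ne_top, lintegral_add_right' _ (hm j),
    lintegral_add_right' _ (hm i), hF.mass_one,
    hs.lintegral_coord_eq hij fun x => ENNReal.ofReal (|x| ^ (2 * k)),
    show A ^ (-(k - q)) * (3 ^ k * (1 + 2 * M)) = A ^ (-(k - q)) * 3 ^ k * (1 + 2 * M) by ring,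
    ENNReal.ofReal_mul (q := 1 + 2 * M) (by positivity)]
  refine mul_le_mul_right ?_ _
  rw [ENNReal.ofReal_add zero_le_one (by positivity), two_mul M, ENNReal.ofReal_add hM0 hM0,
    ENNReal.ofReal_one, add_assoc]
  gcongr

/-- The choice of the parameter `A` that optimizes `A^s d + (B/2) A^{-p}`. -/
lemma le_of_forall_interpolation {s p B h d : ℝ} (hs : 0 < s) (hp : 0 < p) (hB : 0 < B)
    (hh : 0 < h) (H : ∀ A > 0, h ≤ 3 * (A ^ s * d + B / 2 * A ^ (-p))) :
    1 / 3 * (p / (p + s)) * (2 * s * h / (3 * B * (p + s))) ^ (s / p) * h ≤ d := by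
  set τ := 2 * s * h / (3 * B * (p + s)) with hτ
  have hτ0 : 0 < τ := by positivity
  have h1 := H (τ ^ (-(1 / p))) (by positivity)
  have e1 : (τ ^ (-(1 / p))) ^ s = (τ ^ (s / p))⁻¹ := by
    rw [← Real.rpow_mul hτ0.le, ← Real.rpow_neg hτ0.le]
    congr 1
    ring
  have e2 : (τ ^ (-(1 / p))) ^ (-p) = τ := by
    rw [← Real.rpow_mul hτ0.le, neg_mul_neg, one_div_mul_cancel hp.ne', Real.rpow_one]
  have e3 : 3 * (B / 2 * τ) = h - p / (p + s) * h := by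
    rw [hτ]
    field_simp
    ring
  have hx : 0 < τ ^ (s / p) := by positivity
  rw [e1, e2, mul_add, e3] at h1
  have h2 : p / (p + s) * h ≤ 3 * d / τ ^ (s / p) := by
    rw [show 3 * d / τ ^ (s / p) = 3 * ((τ ^ (s / p))⁻¹ * d) by field_simp]
    linarith
  rw [le_div_iff₀ hx] at h2
  linarith

/-- The value of the bound at the optimal truncation level, where `p` is the exponent of decay of the
tail contribution, so that `k = (1 + β) (p + 1) / β`. -/
lemma kacConst_mul_rpow_eq {γ β k C M h : ℝ} (hγ : γ < 1) (hβ : 0 < β) (hC : 0 < C) (hM : 0 ≤ M)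
    (hh : 0 < h) {p : ℝ} (hp : 0 < p) (hpk : k = (1 + β) * (p + 1) / β) :
    kacConst γ β k C M * h ^ (1 + kacEps γ β k)
      = 1 / 3 * (p / (p + (1 - γ))) * (2 * (1 - γ) * h / (3 *
        (C * (2 * (3 ^ k * (1 + 2 * M))) ^ (β / (1 + β))) * (p + (1 - γ)))) ^ ((1 - γ) / p) * h := by
  obtain ⟨s, hs⟩ : ∃ s, s = 1 - γ := ⟨_, rfl⟩
  have hs0 : 0 < s := by linarith
  have hβ1 : 0 < 1 + β := by linarith
  have hM1 : 0 < 1 + 2 * M := by linarith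
  have k1 : k * β - (1 + β) = (1 + β) * p := by
    rw [hpk]
    field_simp
    ring
  have k2 : k * β - γ * (1 + β) = (1 + β) * (p + s) := by
    linear_combination k1 + (1 + β) * (-hs)
  have k3 : 2 * k * β - k * β * γ - γ * (1 + β) = (1 + β) * (p + s + s * (p + 1)) := by
    have : γ = 1 - s := by linarith
    have k4 : k * β = (1 + β) * (p + 1) := by linarith
    rw [this]
    linear_combination (1 + s) * k4
  rw [kacConst, kacEps, if_neg hγ.ne, k1, k2, k3, ← hs]
  have hk0 : 0 < k := by
    rw [hpk]
    positivity
  refine Real.log_injOn_pos (Set.mem_Ioi.mpr (by positivity)) (Set.mem_Ioi.mpr (by positivity)) ?_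
  rw [Real.log_mul (by positivity) (by positivity), Real.log_mul (by positivity) (by positivity),
    Real.log_mul (by positivity) (by positivity), Real.log_mul (by positivity) (by positivity),
    Real.log_div (by positivity) (by positivity), Real.log_mul (by positivity) (by positivity),
    Real.log_mul (by positivity) (by positivity), Real.log_rpow (by positivity),
    Real.log_div (by positivity) (by positivity), Real.log_mul (by positivity) (by positivity),
    Real.log_mul (by positivity) (by positivity), Real.log_div (by positivity) (by positivity),
    Real.log_rpow (by positivity), Real.log_rpow (by positivity),
    Real.log_div (by positivity) (by positivity), Real.log_one,
    Real.log_mul (by positivity) (by positivity), Real.log_rpow (by positivity),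
    Real.log_rpow (by positivity), Real.log_rpow (by positivity)]
  rw [Real.log_mul (x := 1 / 3 * (p / (p + s)) * _) (by positivity) (by positivity),
    Real.log_mul (x := 1 / 3 * (p / (p + s))) (by positivity) (by positivity),
    Real.log_mul (x := 1 / 3) (by positivity) (by positivity),
    Real.log_div (by positivity) (by positivity), Real.log_one,
    Real.log_div (by positivity) (by positivity), Real.log_rpow (by positivity),
    Real.log_div (by positivity) (by positivity), Real.log_mul (by positivity) (by positivity),
    Real.log_mul (by positivity) (by positivity),
    Real.log_mul (x := 3 * _) (by positivity) (by positivity),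
    Real.log_mul (x := 3) (by positivity) (by positivity),
    Real.log_mul (x := C) (by positivity) (by positivity),
    Real.log_rpow (by positivity), Real.log_mul (x := 2) (by positivity) (by positivity),
    Real.log_mul (by positivity) (by positivity), Real.log_rpow (by positivity), hpk]
  field_simp
  ring

lemma kacConst_one (β k C M : ℝ) : kacConst 1 β k C M = 1 / 3 := if_pos rfl

end PowerMoments

/-! ### Exponential moments -/

section ExponentialMoments
variable {N : ℕ}

/-- The function `t ^ r * exp (-c t)` is maximal at `t = r / c`. -/
lemma rpow_le_mul_exp {t r c : ℝ} (ht : 0 < t) (hr : 0 < r) (hc : 0 < c) :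
    t ^ r ≤ (r / (c * Real.exp 1)) ^ r * Real.exp (c * t) := by
  have h1 : c * t / r ≤ Real.exp (c * t / r - 1) := by
    have := Real.add_one_le_exp (c * t / r - 1)
    linarith
  have h2 : t ≤ r / (c * Real.exp 1) * Real.exp (c * t / r) := by
    rw [Real.exp_sub] at h1
    calc t = r / c * (c * t / r) := by field_simp
      _ ≤ r / c * (Real.exp (c * t / r) / Real.exp 1) :=
          mul_le_mul_of_nonneg_left h1 (by positivity)
      _ = _ := by field_simp
  refine (Real.rpow_le_rpow ht.le h2 hr.le).trans (le_of_eq ?_)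
  rw [Real.mul_rpow (by positivity) (Real.exp_pos _).le, ← Real.exp_mul, div_mul_cancel₀ _ hr.ne']

/-- An exponential moment of `1 + x² + y²` splits into those of `x` and `y`, as `1 + x² + y²` is at most
`4` times the largest of `1 / 2`, `x²` and `y²`. -/
lemma exp_rpow_add_sq_le {a μ : ℝ} (ha : 0 < a) (hμ : 0 < μ) (x y : ℝ) :
    Real.exp (a / 2 ^ μ * (1 + (x ^ 2 + y ^ 2)) ^ (μ / 2))
      ≤ Real.exp (a / 2 ^ (μ / 2)) * (Real.exp (a * |x| ^ μ) + Real.exp (a * |y| ^ μ)) := by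
  set u := 1 + (x ^ 2 + y ^ 2) with hu
  have hu0 : 0 < u := by positivity
  have e : a / 2 ^ μ * u ^ (μ / 2) = a * (u / 4) ^ (μ / 2) := by
    rw [Real.div_rpow hu0.le (by norm_num), show (4 : ℝ) = 2 ^ (2 : ℝ) by norm_num,
      ← Real.rpow_mul (by norm_num), mul_div_cancel₀ _ (by norm_num)]
    ring
  have h1 : ∀ z : ℝ, 0 ≤ a * |z| ^ μ := fun z => by positivity
  have hc : 0 ≤ a / 2 ^ (μ / 2) := by positivity
  have hc1 : 1 ≤ Real.exp (a / 2 ^ (μ / 2)) := Real.one_le_exp hc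
  have hz : ∀ z : ℝ, u ≤ 4 * z ^ 2 → Real.exp (a * (u / 4) ^ (μ / 2)) ≤ Real.exp (a * |z| ^ μ) := by
    intro z hz
    rw [Real.exp_le_exp]
    refine mul_le_mul_of_nonneg_left ?_ ha.le
    refine (Real.rpow_le_rpow (by positivity) (show u / 4 ≤ |z| ^ (2 : ℝ) by
      rw [Real.rpow_two, sq_abs]; linarith) (by positivity)).trans (le_of_eq ?_)
    rw [← Real.rpow_mul (abs_nonneg _), mul_div_cancel₀ _ (by norm_num)]
  rw [e]
  have hx := Real.exp_pos (a * |x| ^ μ)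
  have hy := Real.exp_pos (a * |y| ^ μ)
  rcases le_or_gt u 2 with h2 | h2
  · have h3 : Real.exp (a * (u / 4) ^ (μ / 2)) ≤ Real.exp (a / 2 ^ (μ / 2)) := by
      have h4 : a / 2 ^ (μ / 2) = a * (1 / 2) ^ (μ / 2) := by
        rw [Real.div_rpow zero_le_one zero_le_two, Real.one_rpow, mul_one_div]
      rw [Real.exp_le_exp, h4]
      exact mul_le_mul_of_nonneg_left
        (Real.rpow_le_rpow (by positivity) (by linarith) (by positivity)) ha.le
    have h4 := Real.one_le_exp (h1 x)
    refine h3.trans (le_mul_of_one_le_right (Real.exp_pos _).le ?_)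
    linarith
  · refine le_trans ?_ (le_mul_of_one_le_left (add_pos hx hy).le hc1)
    rcases le_total (x ^ 2) (y ^ 2) with h | h
    · have := hz y (by linarith)
      linarith
    · have := hz x (by linarith)
      linarith

/-- The tail under an exponential moment. -/
lemma kacTail_le_of_expMoment {F : KacSpace N → ℝ} (hs : IsKacSymmetric F)
    (hF : AEMeasurable F (kacSigma N))
    {i j : Fin N} (hij : i ≠ j) {q a μ : ℝ} (hq : 0 < q) (ha : 0 < a) (hμ : 0 < μ) {A : ℝ}
    (hA : 0 < A) {M : ℝ} (hM0 : 0 ≤ M)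
    (hM : ∫⁻ v, ENNReal.ofReal (Real.exp (a * |v i| ^ μ)) * ENNReal.ofReal (F v) ∂kacSigma N
      ≤ ENNReal.ofReal M) :
    kacTail q A F i j ≤ ENNReal.ofReal
      ((2 ^ (2 + μ) * q / (a * μ * Real.exp 1)) ^ (2 * q / μ) * Real.exp (a / 2 ^ (μ / 2))
        * Real.exp (-(a / 2 ^ (1 + μ) * A ^ (μ / 2))) * (2 * M)) := by
  set X := (2 ^ (2 + μ) * q / (a * μ * Real.exp 1)) ^ (2 * q / μ) with hX
  set c := X * Real.exp (a / 2 ^ (μ / 2)) * Real.exp (-(a / 2 ^ (1 + μ) * A ^ (μ / 2))) with hc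
  have hX0 : 0 ≤ X := by positivity
  have hc0 : 0 ≤ c := by positivity
  have hm : AEMeasurable (fun v : KacSpace N => ENNReal.ofReal (Real.exp (a * |v i| ^ μ))
      * ENNReal.ofReal (F v)) (kacSigma N) := by
    have : Measurable fun v : KacSpace N => |v i| :=
      (by fun_prop : Continuous fun v : KacSpace N => |v i|).measurable
    exact ((this.pow_const μ).const_mul a).exp.ennreal_ofReal.aemeasurable.mul hF.ennreal_ofReal
  have h1 : kacTail q A F i j ≤ ∫⁻ v, ENNReal.ofReal c *
      (ENNReal.ofReal (Real.exp (a * |v i| ^ μ)) * ENNReal.ofReal (F v)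
        + ENNReal.ofReal (Real.exp (a * |v j| ^ μ)) * ENNReal.ofReal (F v)) ∂kacSigma N := by
    refine le_trans (setLIntegral_mono' (measurableSet_tail A i j) fun v hv => ?_)
      (setLIntegral_le_lintegral _ _)
    have hu : A < 1 + (v i ^ 2 + v j ^ 2) := hv
    set u := 1 + (v i ^ 2 + v j ^ 2) with hu'
    have hu0 : 0 < u := hA.trans hu
    have h2 : u ^ q ≤ c * (Real.exp (a * |v i| ^ μ) + Real.exp (a * |v j| ^ μ)) := by
      set b := a / 2 ^ (1 + μ) with hb
      have hb0 : 0 < b := by positivity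
      have hb2 : a / 2 ^ μ = b + b := by
        rw [hb, Real.rpow_add (by norm_num), Real.rpow_one]
        field_simp
        norm_num
      have hX' : (2 * q / μ) / (b * Real.exp 1) = 2 ^ (2 + μ) * q / (a * μ * Real.exp 1) := by
        rw [hb, Real.rpow_add (by norm_num), Real.rpow_add (by norm_num), Real.rpow_one,
          Real.rpow_two]
        field_simp
      have h3 : u ^ q ≤ X * Real.exp (b * u ^ (μ / 2)) := by
        have := rpow_le_mul_exp (t := u ^ (μ / 2)) (r := 2 * q / μ) (c := b) (by positivity)
          (by positivity) hb0
        rw [hX', ← Real.rpow_mul hu0.le] at this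
        rwa [show μ / 2 * (2 * q / μ) = q by field_simp] at this
      have h4 : Real.exp (b * u ^ (μ / 2))
          ≤ Real.exp (-(b * A ^ (μ / 2))) * Real.exp (a / 2 ^ μ * u ^ (μ / 2)) := by
        rw [← Real.exp_add, Real.exp_le_exp, hb2]
        have := mul_le_mul_of_nonneg_left
          (Real.rpow_le_rpow hA.le hu.le (show 0 ≤ μ / 2 by positivity)) hb0.le
        linarith
      calc u ^ q ≤ X * (Real.exp (-(b * A ^ (μ / 2))) * (Real.exp (a / 2 ^ (μ / 2))
            * (Real.exp (a * |v i| ^ μ) + Real.exp (a * |v j| ^ μ)))) :=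
            h3.trans (mul_le_mul_of_nonneg_left (h4.trans (mul_le_mul_of_nonneg_left
              (exp_rpow_add_sq_le ha hμ _ _) (Real.exp_pos _).le)) hX0)
        _ = _ := by rw [hc]; ring
    refine (mul_le_mul_left (ENNReal.ofReal_le_ofReal h2) _).trans (le_of_eq ?_)
    rw [ENNReal.ofReal_mul hc0, ENNReal.ofReal_add (Real.exp_pos _).le (Real.exp_pos _).le]
    ring
  refine h1.trans ?_
  rw [lintegral_const_mul' _ _ ENNReal.ofReal_ne_top, lintegral_add_left' hm,
    hs.lintegral_coord_eq hij fun x => ENNReal.ofReal (Real.exp (a * |x| ^ μ)),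
    ENNReal.ofReal_mul hc0]
  refine mul_le_mul_right ?_ _
  rw [two_mul, ENNReal.ofReal_add hM0 hM0]
  gcongr

/-- The choice `A = |(2^{1+μ} / a) log (K / (h/6)^q)|^{2/μ}` makes the tail term at most `h / 4`. -/
lemma le_of_forall_exp_interpolation {s q a μ K h d : ℝ} (hs : 0 < s) (hq : 0 < q) (ha : 0 < a)
    (hμ : 0 < μ) (hK : 0 ≤ K) (hh : 0 < h) (hd : 0 ≤ d)
    (H : ∀ A > 0, h ≤ 3 * (A ^ s * d
      + 1 / 2 * (K * Real.exp (-(a / 2 ^ (1 + μ) * A ^ (μ / 2)))) ^ (1 / q))) :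
    1 / 6 * |2 ^ (1 + μ) / a * Real.log (K / (h / 6) ^ q)| ^ (-(2 * s / μ)) * h ≤ d := by
  set L := Real.log (K / (h / 6) ^ q) with hL
  set Y := |2 ^ (1 + μ) / a * L| with hY
  rcases (abs_nonneg (2 ^ (1 + μ) / a * L)).eq_or_lt with hY0 | hY0
  · rw [← hY] at hY0
    rw [← hY0, Real.zero_rpow (by
      have : 0 < 2 * s / μ := by positivity
      linarith), mul_zero, zero_mul]
    exact hd
  rw [← hY] at hY0
  have hYL : a / 2 ^ (1 + μ) * Y = |L| := by
    rw [hY, abs_mul, abs_of_pos (by positivity : (0 : ℝ) < 2 ^ (1 + μ) / a)]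
    field_simp
  have hK0 : 0 < K := by
    refine hK.lt_of_ne fun h0 => hY0.ne' ?_
    rw [hY, hL, ← h0]
    simp
  have hP : 0 < (h / 6) ^ q := by positivity
  have h1 := H (Y ^ (2 / μ)) (by positivity)
  rw [← Real.rpow_mul hY0.le, ← Real.rpow_mul hY0.le, show 2 / μ * (μ / 2) = 1 by field_simp,
    Real.rpow_one, hYL] at h1
  have h2 : K * Real.exp (-|L|) ≤ (h / 6) ^ q := by
    have : K = (h / 6) ^ q * Real.exp L := by
      rw [hL, Real.exp_log (by positivity)]
      field_simp
    rw [this, mul_assoc, ← Real.exp_add]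
    refine mul_le_of_le_one_right hP.le (Real.exp_le_one_iff.mpr ?_)
    linarith [le_abs_self L]
  have h3 : (K * Real.exp (-|L|)) ^ (1 / q) ≤ h / 6 := by
    refine (Real.rpow_le_rpow (by positivity) h2 (by positivity)).trans (le_of_eq ?_)
    rw [← Real.rpow_mul (by positivity), mul_one_div_cancel hq.ne', Real.rpow_one]
  have h4 : h ≤ 6 * (Y ^ (2 / μ * s) * d) := by linarith
  have hY1 : 0 < Y ^ (2 / μ * s) := by positivity
  rw [Real.rpow_neg hY0.le, show 2 * s / μ = 2 / μ * s by ring]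
  have h5 : h / Y ^ (2 / μ * s) ≤ 6 * d := by
    rw [div_le_iff₀ hY1]
    linarith
  calc _ = 1 / 6 * (h / Y ^ (2 / μ * s)) := by ring
    _ ≤ d := by linarith

end ExponentialMoments

/-! ### Moments of the marginal -/

section Marginal

lemma lintegral_le_kacMoment {F : (N : ℕ) → KacSpace N → ℝ} (p : ℝ) {N : ℕ} (hN : 2 ≤ N)
    (hF : IsKacDensity (F N)) :
    ∫⁻ v, ENNReal.ofReal (|v (⟨0, by omega⟩ : Fin N)| ^ p) * ENNReal.ofReal (F N v) ∂kacSigma N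
      ≤ kacMoment p F := by
  refine le_trans (le_of_eq ?_) (le_iSup₂ (f := fun (N : ℕ) (hN : 2 ≤ N) =>
    ∫⁻ x, ENNReal.ofReal (|x| ^ p) ∂(kacMarginal hN (F N))) N hN)
  have hg : Measurable fun x : ℝ => ENNReal.ofReal (|x| ^ p) :=
    (measurable_norm.pow_const p).ennreal_ofReal
  have hc : Measurable fun v : KacSpace N => v (⟨0, by omega⟩ : Fin N) :=
    (by fun_prop : Continuous fun v : KacSpace N => v (⟨0, _⟩ : Fin N)).measurable
  rw [kacMarginal, lintegral_map hg hc,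
    lintegral_withDensity_eq_lintegral_mul₀
      (g := fun v : KacSpace N => ENNReal.ofReal (|v (⟨0, _⟩ : Fin N)| ^ p))
      hF.aemeasurable.ennreal_ofReal (hg.comp hc).aemeasurable]
  refine lintegral_congr fun v => ?_
  rw [Pi.mul_apply, mul_comm]

end Marginal

/-! ### The entropy production inequalities -/

theorem theorem2 (γ : ℝ) (hγ₀ : 0 ≤ γ) (hγ₁ : γ ≤ 1)
    (β : ℝ) (hβ : 0 < β) (C : ℝ) (hC : 0 < C)
    (F : (N : ℕ) → KacSpace N → ℝ)
    (hF : ∀ N : ℕ, 2 ≤ N → IsKacDensity (F N))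
    (hsymm : ∀ N : ℕ, 2 ≤ N → IsKacSymmetric (F N))
    (hlog : HasLogPower β C F) :
    (∀ k : ℝ, 1 + 1 / β < k → kacMoment (2 * k) F < ⊤ →
      ∀ N : ℕ, 2 ≤ N →
        ENNReal.ofReal (kacConst γ β k C (kacMoment (2 * k) F).toReal) *
            (kacEntropy (F N) / (N : ℝ≥0∞)) ^ (1 + kacEps γ β k)
          ≤ kacProduction γ (F N) / (N : ℝ≥0∞)) ∧
    (∀ a μ : ℝ, 0 < a → 0 < μ → kacExpMoment a μ F < ⊤ →
      ∀ N : ℕ, 2 ≤ N →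
        (kacEntropy (F N) < ⊤ →
          ENNReal.ofReal (kacExpBound γ β a μ C (kacExpMoment a μ F).toReal
              ((kacEntropy (F N)).toReal / (N : ℝ)))
            ≤ kacProduction γ (F N) / (N : ℝ≥0∞)) ∧
        (kacEntropy (F N) = ⊤ → kacProduction γ (F N) = ⊤)) := by
  have hβ1 : 0 < 1 + β := by linarith
  set q := (1 + β) / β with hq
  have hq0 : 0 < q := by positivity
  have hne : ∀ N : ℕ, ∀ hN : 2 ≤ N, (⟨0, by omega⟩ : Fin N) ≠ ⟨1, by omega⟩ := fun N hN => by
    simp [Fin.ext_iff]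
  have hvil : γ = 1 → ∀ N : ℕ, 2 ≤ N →
      kacEntropy (F N) / N ≤ 3 * (kacProduction γ (F N) / N) := by
    rintro rfl N hN
    rw [← mul_div_assoc]
    exact ENNReal.div_le_div_right (kacEntropy_le_three_mul_kacProduction_one hN (hF N hN)) _
  refine ⟨fun k hk hMt N hN => ?_, fun a μ ha hμ hMt N hN => ?_⟩
  · rcases eq_or_ne (kacProduction γ (F N) / (N : ℝ≥0∞)) ⊤ with hD | hD
    · rw [hD]
      exact le_top
    rcases hγ₁.eq_or_lt with rfl | hγ
    · have h := hvil rfl N hN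
      rw [kacConst_one, kacEps, sub_self, zero_mul, zero_div, add_zero, ENNReal.rpow_one,
        ENNReal.ofReal_div_of_pos (by norm_num)]
      simp only [ENNReal.ofReal_one, ENNReal.ofReal_ofNat]
      rw [mul_comm, mul_one_div]
      exact ENNReal.div_le_of_le_mul' h
    set M := (kacMoment (2 * k) F).toReal with hM
    have hM0 : 0 ≤ M := ENNReal.toReal_nonneg
    have hMb := lintegral_le_kacMoment (2 * k) hN (hF N hN)
    rw [← ENNReal.ofReal_toReal hMt.ne, ← hM] at hMb
    have hqk : q < k := by
      have : q = 1 + 1 / β := by rw [hq]; field_simp; ring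
      rwa [this]
    -- the tail is of order `A ^ (-(k - q))`, and Hölder's inequality raises it to `β / (1 + β)`
    obtain ⟨p, hpk⟩ : ∃ p, p = (k - q) * (β / (1 + β)) := ⟨_, rfl⟩
    have hp : 0 < p := by
      rw [hpk]
      exact mul_pos (sub_pos.mpr hqk) (by positivity)
    have hkp : k = (1 + β) * (p + 1) / β := by
      rw [hpk, hq]
      field_simp
      ring
    set B := C * (2 * (3 ^ k * (1 + 2 * M))) ^ (β / (1 + β)) with hB
    have hB0 : 0 < B := by positivity
    set d := (kacProduction γ (F N) / (N : ℝ≥0∞)).toReal with hd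
    have key : ∀ A > 0, kacEntropy (F N) / N
        ≤ ENNReal.ofReal (3 * (A ^ (1 - γ) * d + B / 2 * A ^ (-p))) := by
      intro A hA
      refine (kacEntropy_div_le_ofReal hN hβ hC hγ₁ (hF N hN) (hsymm N hN) (hne N hN) (hlog N hN)
        hA (by positivity) (kacTail_le_of_moment (hF N hN) (hsymm N hN) (hne N hN) hq0 hqk hA hM0
          hMb) hD).trans (le_of_eq ?_)
      congr 3
      rw [hB, show 2 * (A ^ (-(k - q)) * (3 ^ k * (1 + 2 * M)))
        = A ^ (-(k - q)) * (2 * (3 ^ k * (1 + 2 * M))) by ring,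
        Real.mul_rpow (by positivity) (by positivity), ← Real.rpow_mul hA.le, neg_mul, ← hpk]
      ring
    have hHt : kacEntropy (F N) / N ≠ ⊤ :=
      ((key 1 one_pos).trans_lt ENNReal.ofReal_lt_top).ne
    have hε : 0 < 1 + kacEps γ β k := by
      have : 0 ≤ kacEps γ β k := by
        refine div_nonneg (mul_nonneg (by linarith) hβ1.le) ?_
        have : k * β - (1 + β) = (1 + β) * p := by
          rw [hkp]
          field_simp
          ring
        rw [this]
        positivity
      linarith
    rcases eq_or_ne (kacEntropy (F N) / (N : ℝ≥0∞)) 0 with h0 | h0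
    · rw [h0, ENNReal.zero_rpow_of_pos hε, mul_zero]
      exact zero_le
    set h := (kacEntropy (F N) / (N : ℝ≥0∞)).toReal with hh
    have hh0 : 0 < h := ENNReal.toReal_pos h0 hHt
    have e1 : kacEntropy (F N) / (N : ℝ≥0∞) = ENNReal.ofReal h := (ENNReal.ofReal_toReal hHt).symm
    have e2 : kacProduction γ (F N) / (N : ℝ≥0∞) = ENNReal.ofReal d :=
      (ENNReal.ofReal_toReal hD).symm
    have hd0 : 0 ≤ d := ENNReal.toReal_nonneg
    rw [e1] at key ⊢
    rw [e2, ENNReal.ofReal_rpow_of_pos hh0, ← ENNReal.ofReal_mul' (by positivity),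
      kacConst_mul_rpow_eq hγ hβ hC hM0 hh0 hp hkp]
    refine ENNReal.ofReal_le_ofReal
      (le_of_forall_interpolation (by linarith) hp hB0 hh0 fun A hA => ?_)
    exact (ENNReal.ofReal_le_ofReal_iff (by positivity)).mp (key A hA)
  · have hN0 : (N : ℝ≥0∞) ≠ 0 := by
      have : N ≠ 0 := by omega
      exact_mod_cast this
    set M := (kacExpMoment a μ F).toReal with hM
    have hM0 : 0 ≤ M := ENNReal.toReal_nonneg
    have hMb : ∫⁻ v, ENNReal.ofReal (Real.exp (a * |v (⟨0, by omega⟩ : Fin N)| ^ μ)) *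
        ENNReal.ofReal (F N v) ∂kacSigma N ≤ ENNReal.ofReal M := by
      rw [hM, ENNReal.ofReal_toReal hMt.ne]
      exact le_iSup₂ (f := fun (N : ℕ) (hN : 2 ≤ N) => ∫⁻ v,
        ENNReal.ofReal (Real.exp (a * |v (⟨0, by omega⟩ : Fin N)| ^ μ)) *
          ENNReal.ofReal (F N v) ∂(kacSigma N)) N hN
    set d := (kacProduction γ (F N) / (N : ℝ≥0∞)).toReal with hd
    have hd0 : 0 ≤ d := ENNReal.toReal_nonneg
    set K := 4 * C ^ ((1 + β) / β) *
      ((2 : ℝ) ^ (2 + μ) * (1 + β) / (a * β * μ * Real.exp 1)) ^ (2 * (1 + β) / (β * μ)) *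
        Real.exp (a / (2 : ℝ) ^ (μ / 2)) * M with hK
    have hK0 : 0 ≤ K := by positivity
    have key : kacProduction γ (F N) / (N : ℝ≥0∞) ≠ ⊤ → ∀ A > 0, kacEntropy (F N) / N
        ≤ ENNReal.ofReal (3 * (A ^ (1 - γ) * d
          + 1 / 2 * (K * Real.exp (-(a / 2 ^ (1 + μ) * A ^ (μ / 2)))) ^ (1 / q))) := by
      intro hD A hA
      refine (kacEntropy_div_le_ofReal hN hβ hC hγ₁ (hF N hN) (hsymm N hN) (hne N hN) (hlog N hN)
        hA (by positivity) (kacTail_le_of_expMoment (hsymm N hN) (hF N hN).aemeasurable (hne N hN)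
          hq0 ha hμ hA hM0 hMb) hD).trans (le_of_eq ?_)
      congr 3
      set E := Real.exp (-(a / 2 ^ (1 + μ) * A ^ (μ / 2))) with hE
      have hE0 : 0 < E := Real.exp_pos _
      have e1 : 2 ^ (2 + μ) * q / (a * μ * Real.exp 1)
          = (2 : ℝ) ^ (2 + μ) * (1 + β) / (a * β * μ * Real.exp 1) := by
        rw [hq]
        field_simp
      have e2 : 2 * q / μ = 2 * (1 + β) / (β * μ) := by
        rw [hq]
        field_simp
      have e3 : C = (C ^ q) ^ (1 / q) := by
        rw [← Real.rpow_mul hC.le, mul_one_div_cancel hq0.ne', Real.rpow_one]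
      have e4 : β / (1 + β) = 1 / q := (one_div_div _ _).symm
      rw [e1, e2, e4]
      have e5 : C / 2 = 1 / 2 * (C ^ q) ^ (1 / q) := by
        rw [← e3]
        ring
      rw [e5, mul_assoc, ← Real.mul_rpow (by positivity) (by positivity), hK]
      congr 2
      rw [← hq]
      ring
    refine ⟨fun hHt => ?_, fun hHt => ?_⟩
    · rcases eq_or_ne (kacProduction γ (F N) / (N : ℝ≥0∞)) ⊤ with hD | hD
      · rw [hD]
        exact le_top
      have eh : (kacEntropy (F N)).toReal / (N : ℝ) = (kacEntropy (F N) / (N : ℝ≥0∞)).toReal := by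
        rw [ENNReal.toReal_div, ENNReal.toReal_natCast]
      have hHt' : kacEntropy (F N) / (N : ℝ≥0∞) ≠ ⊤ := ENNReal.div_ne_top hHt.ne hN0
      rw [eh]
      set h := (kacEntropy (F N) / (N : ℝ≥0∞)).toReal with hh
      have e1 : kacEntropy (F N) / (N : ℝ≥0∞) = ENNReal.ofReal h :=
        (ENNReal.ofReal_toReal hHt').symm
      have e2 : kacProduction γ (F N) / (N : ℝ≥0∞) = ENNReal.ofReal d :=
        (ENNReal.ofReal_toReal hD).symm
      rw [e2]
      refine ENNReal.ofReal_le_ofReal ?_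
      have hh0 : 0 ≤ h := ENNReal.toReal_nonneg
      rcases hh0.eq_or_lt with h0 | h0
      · rw [← h0, kacExpBound, mul_zero]
        exact hd0
      rcases hγ₁.eq_or_lt with hγ | hγ
      · have hv := hvil hγ N hN
        rw [e1, e2, show (3 : ℝ≥0∞) = ENNReal.ofReal 3 by simp, ← ENNReal.ofReal_mul (by norm_num),
          ENNReal.ofReal_le_ofReal_iff (by positivity)] at hv
        rw [hγ, kacExpBound, sub_self, mul_zero, zero_div, neg_zero, Real.rpow_zero, mul_one]
        linarith
      · refine le_of_forall_exp_interpolation (by linarith) hq0 ha hμ hK0 h0 hd0 fun A hA => ?_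
        have := key hD A hA
        rw [e1] at this
        exact (ENNReal.ofReal_le_ofReal_iff (by positivity)).mp this
    · by_contra hD
      have hD' : kacProduction γ (F N) / (N : ℝ≥0∞) ≠ ⊤ := ENNReal.div_ne_top hD hN0
      have := (key hD' 1 one_pos).trans_lt ENNReal.ofReal_lt_top
      rw [hHt, ENNReal.top_div_of_ne_top (ENNReal.natCast_ne_top N)] at this
      exact this.ne rfl
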